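/- **Definitions.** Let $\gamma\in[-1,1]$. A *complex Gaussian elliptic matrix* of parameter $\gamma$ is a random complex $N\times N$ matrix $X=(X_{ij})$ such that the random elements $X_{ii}$ ($1\le i\le N$) and $(X_{ij},X_{ji})$ ($i<j$) are independent, the pairs $(X_{ij},X_{ji})$, $i<j$, are i.i.d. centered Gaussian with $\mathbb E X_{ij}^2=\mathbb E X_{ji}^2=\mathbb E X_{ij}\overline{X_{ji}}=0$, $\mathbb E|X_{ij}|^2=\mathbb E|X_{ji}|^2=1$, $\mathbb E X_{ij}X_{ji}=\gamma$, and the $X_{ii}$ are i.i.d. centered Gaussian with $\mathbb E|X_{ii}|^2=1$, $\mathbb E X_{ii}^2=\gamma$. A *real Gaussian elliptic matrix* is defined in the same way with real entries, $\mathbb E X_{ij}^2=\mathbb E X_{ji}^2=1$, $\mathbb E X_{ij}X_{ji}=\gamma$ for $i<j$, and $\mathbb E X_{ii}^2=1+\gamma$. Write $\operatorname{tr}=\frac1N\operatorname{Tr}$, $\operatorname{cov}(\xi,\eta)=\mathbb E[\xi\eta]-\mathbb E[\xi]\mathbb E[\eta]$, and $\kappa_r$ for the classical joint cumulants. A *second-order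 non-commutative probability space* $(\mathcal A,\varphi_1,\varphi_2)$ is a unital complex algebra with a unital tracial linear functional $\varphi_1$ and a symmetric bilinear functional $\varphi_2$ that is tracial in each argument and satisfies $\varphi_2(1,a)=0$ for all $a$. A color sequence $(c_1,\dots,c_n)$ is *alternating* if $c_r\ne c_{r+1}$ for $1\le r<n$, and *cyclically alternating* if moreover $c_n\neq c_1$ (no condition when $n=1$). Subalgebras $(\mathcal A_i)_{i\in I}$ are *second-order free* if * $\varphi_1(a_1\cdots a_n)=0$ whenever $n\ge1$, $a_r\in\mathcal A_{c_r}$, $\varphi_1(a_r)=0$ for all $r$, and $c$ is alternating; * for $p,q\ge1$ and all $a_r\in\mathcal A_{c_r}$ ($1\le r\le p$), $b_s\in\mathcal A_{d_s}$ ($1\le s\le q$) with $\varphi_1(a_r)=\varphi_1(b_s)=0$ and $c,d$ cyclically alternating, excluding the case $p=q=1$, $c_1=d_1$, $$\varphi_2(a_1\cdots a_p,\,b_1\cdots b_q)=\delta_{p,q}\sum_{k=1}^p\prod_{i=1}^p\varphi_1(a_ib_{k-i}),$$ with indices modulo $p$. Given a linear involution $a\mapsto a^t$ of $\mathcal A$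 that reverses products and leaves $\varphi_1$ and (in each argument) $\varphi_2$ invariant, they are *real second-order free* if the same holds with the right-hand side of the second condition replaced by $$\delta_{p,q}\sum_{k=1}^p\Big(\prod_{i=1}^p\varphi_1(a_ib_{k-i})+\prod_{i=1}^p\varphi_1(a_ib^t_{k+i})\Big).$$ Random $N\times N$ matrices $(X_i^N)_{i\in I}$, $N\ge1$, are *asymptotically second-order free* if traces of $*$-polynomials in them have moments of all orders and there are a second-order non-commutative probability space $(\mathcal A,\varphi_1,\varphi_2)$ with a conjugate-linear involution $*$ reversing products, and elements $a_i\in\mathcal A$ ($i\in I$), such that for all $P,Q,P_1,\dots,P_r\in\mathbb C\langle x_i,x_i^*\mid i\in I\rangle$ and $r\ge3$, as $N\to\infty$, $$\mathbb E\operatorname{tr}P(X^N)\to\varphi_1(P(a)),\qquad \operatorname{cov}\big(\operatorname{Tr}P(X^N),\operatorname{Tr}Q(X^N)\big)\to\varphi_2(P(a),Q(a)),\qquad \kappa_r\big(\operatorname{Tr}P_1(X^N),\dots,\operatorname{Tr}P_r(X^N)\big)\to0,$$ and the unital algebras generated by $\{a_i,a_i^*\}$, $i\in I$, are second-order free. For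 matrices with real entries, *asymptotically real second-order free* means the same with real second-order freeness, with respect to an involution $t$ as above with $a_i^t=a_i^*$ for all $i$. **Theorem.** Let $I$ be a set and $\gamma_i\in[-1,1]$ for $i\in I$. For each $N$ let $(Y_i^N)_{i\in I}$ be independent $N\times N$ Gaussian elliptic matrices, $Y_i^N$ of parameter $\gamma_i$, and put $X_i^N=N^{-1/2}\,Y_i^N$. 1. If the $Y^N_i$ are complex Gaussian elliptic matrices, then $(X_i^N)_{i\in I}$ is asymptotically second-order free. 2. If the $Y^N_i$ are real Gaussian elliptic matrices, then $(X_i^N)_{i\in I}$ is asymptotically real second-order free. Moreover, let $p,q\ge2$, let $(c_1,\dots,c_p)$ and $(d_1,\dots,d_q)$ in $I$ be cyclically alternating, let $P_i,Q_j\in\mathbb C\langle x,x^*\rangle$, and set $A_i=P_i(X^N_{c_i})-\mathbb E\operatorname{tr}P_i(X^N_{c_i})$ and $B_j=Q_j(X^N_{d_j})-\mathbb E\operatorname{tr}Q_j(X^N_{d_j})$. Then all the limits below exist, and in the complex case $$\lim_{N\to\infty}\operatorname{cov}\big(\operatorname{Tr}(A_1\cdots A_p),\operatorname{Tr}(B_1\cdots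 B_q)\big)=\delta_{p,q}\sum_{k=1}^p\prod_{i=1}^p\lim_{N\to\infty}\mathbb E\operatorname{tr}(A_iB_{k-i}),$$ while in the real case $$\lim_{N\to\infty}\operatorname{cov}\big(\operatorname{Tr}(A_1\cdots A_p),\operatorname{Tr}(B_1\cdots B_q)\big)=\delta_{p,q}\sum_{k=1}^p\Big(\prod_{i=1}^p\lim_{N\to\infty}\mathbb E\operatorname{tr}(A_iB_{k-i})+\prod_{i=1}^p\lim_{N\to\infty}\mathbb E\operatorname{tr}(A_iB^T_{k+i})\Big),$$ with indices modulo $p$. -/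

import Mathlib

open MeasureTheory ProbabilityTheory Filter Topology
open scoped BigOperators ComplexConjugate

noncomputable section

namespace Elliptic

/-! ### Gaussian elliptic matrices -/

/-- A complex Gaussian elliptic matrix of parameter `γ` (before normalization).
The random element attached to `i < j` is the pair `(X i j, X j i)`, the one attached to `i = j` is
`X i i` (written as the pair `(X i i, X i i)`). "Gaussian" means that the law on the underlying
real vector space is Gaussian. The mean and the listed second moments determine a Gaussian law,
so the identical distribution of the pairs, and of the diagonal entries, is implied. -/
structure IsComplexElliptic {Ω : Type*} [MeasurableSpace Ω] (μ : Measure Ω) {N : ℕ} (γ : ℝ)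
    (X : Ω → Matrix (Fin N) (Fin N) ℂ) : Prop where
  indep : iIndepFun
    (fun (e : {e : Fin N × Fin N // e.1 ≤ e.2}) (ω : Ω) => (X ω e.1.1 e.1.2, X ω e.1.2 e.1.1)) μ
  gaussian_pair : ∀ i j, i < j → HasGaussianLaw (fun ω => (X ω i j, X ω j i)) μ
  gaussian_diag : ∀ i, HasGaussianLaw (fun ω => X ω i i) μ
  centered : ∀ i j, ∫ ω, X ω i j ∂μ = 0
  sq_offdiag : ∀ i j, i ≠ j → ∫ ω, X ω i j ^ 2 ∂μ = 0
  mul_conj_offdiag : ∀ i j, i < j → ∫ ω, X ω i j * conj (X ω j i) ∂μ = 0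
  norm_sq : ∀ i j, ∫ ω, ‖X ω i j‖ ^ 2 ∂μ = 1
  mul_offdiag : ∀ i j, i < j → ∫ ω, X ω i j * X ω j i ∂μ = (γ : ℂ)
  sq_diag : ∀ i, ∫ ω, X ω i i ^ 2 ∂μ = (γ : ℂ)

/-- A real Gaussian elliptic matrix of parameter `γ` (before normalization). -/
structure IsRealElliptic {Ω : Type*} [MeasurableSpace Ω] (μ : Measure Ω) {N : ℕ} (γ : ℝ)
    (X : Ω → Matrix (Fin N) (Fin N) ℝ) : Prop where
  indep : iIndepFun
    (fun (e : {e : Fin N × Fin N // e.1 ≤ e.2}) (ω : Ω) => (X ω e.1.1 e.1.2, X ω e.1.2 e.1.1)) μ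
  gaussian_pair : ∀ i j, i < j → HasGaussianLaw (fun ω => (X ω i j, X ω j i)) μ
  gaussian_diag : ∀ i, HasGaussianLaw (fun ω => X ω i i) μ
  centered : ∀ i j, ∫ ω, X ω i j ∂μ = 0
  sq_offdiag : ∀ i j, i ≠ j → ∫ ω, X ω i j ^ 2 ∂μ = 1
  mul_offdiag : ∀ i j, i < j → ∫ ω, X ω i j * X ω j i ∂μ = γ
  sq_diag : ∀ i, ∫ ω, X ω i i ^ 2 ∂μ = 1 + γ

/-- A random family of `N × N` matrices is independent: the matrices, viewed as random vectors of
their entries, are independent. -/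
def IndepMatrices {Ω : Type*} [MeasurableSpace Ω] (μ : Measure Ω) {N : ℕ} {I R : Type*}
    [MeasurableSpace R] (X : I → Ω → Matrix (Fin N) (Fin N) R) : Prop :=
  iIndepFun (fun (i : I) (ω : Ω) (e : Fin N × Fin N) => X i ω e.1 e.2) μ

/-- A real matrix viewed as a complex one. -/
def complexify {N : ℕ} (X : Matrix (Fin N) (Fin N) ℝ) : Matrix (Fin N) (Fin N) ℂ :=
  X.map (fun x : ℝ => (x : ℂ))

/-- The normalized trace `Tr / N`. -/
def normTrace {N : ℕ} (X : Matrix (Fin N) (Fin N) ℂ) : ℂ :=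
  X.trace / N

/-! ### Classical cumulants -/

/-- The classical joint cumulant of the random variables `ξ j`, `j ∈ S`, computed from the
moment-cumulant formula `E[∏_{j ∈ S} ξ j] = ∑_π ∏_{B ∈ π} κ(B)`, where `π` runs over the
partitions of `S`, by solving it for the term of the one-block partition. -/
def cumulant {Ω : Type*} [MeasurableSpace Ω] (μ : Measure Ω) {r : ℕ} (ξ : Fin r → Ω → ℂ)
    (S : Finset (Fin r)) : ℂ :=
  (∫ ω, ∏ j ∈ S, ξ j ω ∂μ) -
    ∑ π : {π : Finpartition S // S ∉ π.parts},
      ∏ B : {B : Finset (Fin r) // B ∈ π.1.parts}, cumulant μ ξ B.1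
termination_by S.card
decreasing_by
  exact Finset.card_lt_card
    ((π.1.le B.2).lt_of_ne (fun h => π.2 (by simpa [h] using B.2)))

/-- The moment-cumulant formula. -/
theorem moment_cumulant {Ω : Type*} [MeasurableSpace Ω] (μ : Measure Ω) {r : ℕ} (ξ : Fin r → Ω → ℂ)
    (S : Finset (Fin r)) (hS : S.Nonempty) :
    (∫ ω, ∏ j ∈ S, ξ j ω ∂μ) = ∑ π : Finpartition S, ∏ B ∈ π.parts, cumulant μ ξ B := by
  classical
  have h1 : ∀ π : Finpartition S, S ∈ π.parts ↔ π = Finpartition.indiscrete hS.ne_empty := by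
    intro π
    constructor
    · intro h
      ext B
      simp only [Finpartition.indiscrete_parts, Finset.mem_singleton]
      constructor
      · intro hB
        by_contra hne
        have := π.disjoint hB h hne
        have hle := π.le hB
        have : B = ⊥ := this.eq_bot_of_le hle
        subst this
        exact π.bot_notMem hB
      · rintro rfl; exact h
    · rintro rfl; simp
  have h2 := Fintype.sum_subtype_add_sum_subtype (fun π : Finpartition S => S ∉ π.parts)
    (fun π => ∏ B ∈ π.parts, cumulant μ ξ B)
  rw [← h2]
  have h3 : (∑ π : {π : Finpartition S // ¬ S ∉ π.parts}, ∏ B ∈ π.1.parts, cumulant μ ξ B)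
      = cumulant μ ξ S := by
    rw [Fintype.sum_eq_single ⟨Finpartition.indiscrete hS.ne_empty, by simp⟩]
    · simp
    · rintro ⟨π, hπ⟩ hne
      exact absurd ((h1 π).1 (not_not.1 hπ)) (fun h => hne (Subtype.ext h))
  rw [h3, cumulant]
  have h4 : ∀ π : {π : Finpartition S // S ∉ π.parts},
      (∏ B : {B : Finset (Fin r) // B ∈ π.1.parts}, cumulant μ ξ B.1) =
      ∏ B ∈ π.1.parts, cumulant μ ξ B := fun π => Finset.prod_coe_sort _ _
  simp only [h4]
  ring

/-- The covariance `E[ξη] - E[ξ]E[η]` (bilinear, without complex conjugation). -/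
def covar {Ω : Type*} [MeasurableSpace Ω] (μ : Measure Ω) (ξ η : Ω → ℂ) : ℂ :=
  (∫ ω, ξ ω * η ω ∂μ) - (∫ ω, ξ ω ∂μ) * ∫ ω, η ω ∂μ

/-! ### Non-commutative polynomials -/

/-- The non-commutative `*`-polynomials `ℂ⟨x_i, x_i^* | i ∈ I⟩`: the letter `x_i` is `Sum.inl i`,
the letter `x_i^*` is `Sum.inr i`. -/
abbrev StarPoly (I : Type*) : Type _ := FreeAlgebra ℂ (I ⊕ I)

/-- Evaluation of a `*`-polynomial under `x_i ↦ a i`, `x_i^* ↦ (a i)^*`. -/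
def starEval {I A : Type*} [Ring A] [Algebra ℂ A] [Star A] (a : I → A) : StarPoly I →ₐ[ℂ] A :=
  FreeAlgebra.lift ℂ (Sum.elim a (fun i => star (a i)))

/-- The unital algebra generated by `a` and `a^*`. -/
def starAlg {A : Type*} [Ring A] [Algebra ℂ A] [Star A] (a : A) : Subalgebra ℂ A :=
  Algebra.adjoin ℂ {a, star a}

/-! ### Second-order freeness -/

/-- The functionals of a (tracial) second-order non-commutative probability space on `A`. -/
structure SecondOrderSpace (A : Type*) [Ring A] [Algebra ℂ A] where
  φ₁ : A →ₗ[ℂ] ℂ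
  φ₂ : A →ₗ[ℂ] A →ₗ[ℂ] ℂ
  φ₁_one : φ₁ 1 = 1
  φ₁_tracial : ∀ a b, φ₁ (a * b) = φ₁ (b * a)
  φ₂_tracial_left : ∀ a b c, φ₂ (a * b) c = φ₂ (b * a) c
  φ₂_tracial_right : ∀ a b c, φ₂ c (a * b) = φ₂ c (b * a)
  φ₂_symm : ∀ a b, φ₂ a b = φ₂ b a
  φ₂_one_left : ∀ a, φ₂ 1 a = 0
  φ₂_one_right : ∀ a, φ₂ a 1 = 0

/-- Neighbouring colors differ. -/
def Alternating {I : Type*} {n : ℕ} (c : Fin n → I) : Prop :=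
  ∀ r s : Fin n, (r : ℕ) + 1 = s → c r ≠ c s

/-- Neighbouring colors differ, and so do the last and the first one. As usual, the latter is
no condition on a sequence of length one. -/
def CyclicallyAlternating {I : Type*} {n : ℕ} (c : Fin n → I) : Prop :=
  2 ≤ n → ∀ r : Fin n, c r ≠ c (finRotate n r)

/-- The ordered product `a_1 a_2 ⋯ a_n`. -/
def wordProd {A : Type*} [Monoid A] {n : ℕ} (a : Fin n → A) : A :=
  (List.ofFn a).prod

section Freeness

variable {A : Type*} [Ring A] [Algebra ℂ A]

/-- `(a_1, …, a_n)` consists of centered elements of the subalgebras of the colors `c`. -/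
def CenteredIn (S : SecondOrderSpace A) {I : Type*} (B : I → Subalgebra ℂ A) {n : ℕ}
    (c : Fin n → I) (a : Fin n → A) : Prop :=
  ∀ r, a r ∈ B (c r) ∧ S.φ₁ (a r) = 0

/-- Freeness of a family of subalgebras with respect to `φ₁`. -/
def IsFree (S : SecondOrderSpace A) {I : Type*} (B : I → Subalgebra ℂ A) : Prop :=
  ∀ n : ℕ, 1 ≤ n → ∀ (c : Fin n → I) (a : Fin n → A),
    Alternating c → CenteredIn S B c a → S.φ₁ (wordProd a) = 0

/-- The part that complex and real second-order freeness have in common: freeness, and vanishing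
of `φ₂` on centered, cyclically alternating words with different numbers of factors, and on two
single elements of different colors. -/
structure SecondOrderFreeBase (S : SecondOrderSpace A) {I : Type*} (B : I → Subalgebra ℂ A) :
    Prop where
  free : IsFree S B
  cov_ne : ∀ p q : ℕ, 1 ≤ p → 1 ≤ q → p ≠ q →
    ∀ (c : Fin p → I) (d : Fin q → I) (a : Fin p → A) (b : Fin q → A),
      CyclicallyAlternating c → CyclicallyAlternating d → CenteredIn S B c a →
      CenteredIn S B d b → S.φ₂ (wordProd a) (wordProd b) = 0
  cov_single : ∀ c d : I, c ≠ d → ∀ a ∈ B c, ∀ b ∈ B d, S.φ₂ a b = 0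

/-- Second-order freeness. Subtraction in `Fin p` is modulo `p`. -/
structure SecondOrderFree (S : SecondOrderSpace A) {I : Type*} (B : I → Subalgebra ℂ A) : Prop
    extends SecondOrderFreeBase S B where
  cov_eq : ∀ p : ℕ, 2 ≤ p → ∀ (c d : Fin p → I) (a b : Fin p → A),
      CyclicallyAlternating c → CyclicallyAlternating d → CenteredIn S B c a →
      CenteredIn S B d b →
      S.φ₂ (wordProd a) (wordProd b) = ∑ k : Fin p, ∏ i : Fin p, S.φ₁ (a i * b (k - i))

/-- Real second-order freeness with respect to `t`. Subtraction and addition in `Fin p` are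
modulo `p`. -/
structure RealSecondOrderFree (S : SecondOrderSpace A) (t : A →ₗ[ℂ] A) {I : Type*}
    (B : I → Subalgebra ℂ A) : Prop extends SecondOrderFreeBase S B where
  cov_eq : ∀ p : ℕ, 2 ≤ p → ∀ (c d : Fin p → I) (a b : Fin p → A),
      CyclicallyAlternating c → CyclicallyAlternating d → CenteredIn S B c a →
      CenteredIn S B d b →
      S.φ₂ (wordProd a) (wordProd b) =
        ∑ k : Fin p, ((∏ i : Fin p, S.φ₁ (a i * b (k - i))) +
          ∏ i : Fin p, S.φ₁ (a i * t (b (k + i))))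

/-- `t` is a transposition on the second-order space `S`: a linear involution that reverses
products and leaves `φ₁` and `φ₂` invariant. -/
structure IsTransposition (S : SecondOrderSpace A) (t : A →ₗ[ℂ] A) : Prop where
  invol : ∀ a, t (t a) = a
  map_mul : ∀ a b, t (a * b) = t b * t a
  φ₁_map : ∀ a, S.φ₁ (t a) = S.φ₁ a
  φ₂_map_left : ∀ a b, S.φ₂ (t a) b = S.φ₂ a b
  φ₂_map_right : ∀ a b, S.φ₂ a (t b) = S.φ₂ a b

end Freeness

/-! ### Asymptotic second-order freeness of random matrices -/

section Asymptotic

universe u v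

variable {I : Type u} {Ω : ℕ → Type v} [∀ N, MeasurableSpace (Ω N)]

/-- The family `X N i` of random matrices has the second-order limit distribution given by the
elements `a i` of the second-order space `S`. The first field says that the moments in the other
fields exist. -/
structure HasSecondOrderLimit (μ : ∀ N, Measure (Ω N))
    (X : ∀ N, I → Ω N → Matrix (Fin N) (Fin N) ℂ)
    {A : Type*} [Ring A] [Algebra ℂ A] [Star A] (S : SecondOrderSpace A) (a : I → A) : Prop where
  memLp : ∀ (N r : ℕ) (P : StarPoly I),
    MemLp (fun ω => (starEval (fun i => X N i ω) P).trace) r (μ N)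
  tendsto_mean : ∀ P : StarPoly I,
    Tendsto (fun N => ∫ ω, normTrace (starEval (fun i => X N i ω) P) ∂(μ N)) atTop
      (𝓝 (S.φ₁ (starEval a P)))
  tendsto_cov : ∀ P Q : StarPoly I,
    Tendsto (fun N => covar (μ N) (fun ω => (starEval (fun i => X N i ω) P).trace)
      (fun ω => (starEval (fun i => X N i ω) Q).trace)) atTop
      (𝓝 (S.φ₂ (starEval a P) (starEval a Q)))
  tendsto_cumulant : ∀ r : ℕ, 3 ≤ r → ∀ P : Fin r → StarPoly I,
    Tendsto (fun N => cumulant (μ N)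
      (fun j ω => (starEval (fun i => X N i ω) (P j)).trace) Finset.univ) atTop (𝓝 0)

/-- Asymptotic second-order freeness: there is a second-order limit distribution, and the algebras
generated by the limiting random variables are second-order free. -/
def AsymptoticallySecondOrderFree (μ : ∀ N, Measure (Ω N))
    (X : ∀ N, I → Ω N → Matrix (Fin N) (Fin N) ℂ) : Prop :=
  ∃ (A : Type u) (_ : Ring A) (_ : Algebra ℂ A) (_ : StarRing A) (_ : StarModule ℂ A)
    (S : SecondOrderSpace A) (a : I → A),
    HasSecondOrderLimit μ X S a ∧ SecondOrderFree S (fun i => starAlg (a i))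

/-- Asymptotic real second-order freeness of random matrices with real entries. For such matrices
the adjoint is the transpose, so the transposition `t` of the limit space sends `a i` to its
adjoint. -/
def AsymptoticallyRealSecondOrderFree (μ : ∀ N, Measure (Ω N))
    (X : ∀ N, I → Ω N → Matrix (Fin N) (Fin N) ℝ) : Prop :=
  ∃ (A : Type u) (_ : Ring A) (_ : Algebra ℂ A) (_ : StarRing A) (_ : StarModule ℂ A)
    (S : SecondOrderSpace A) (t : A →ₗ[ℂ] A) (a : I → A),
    IsTransposition S t ∧ (∀ i, t (a i) = star (a i)) ∧
    HasSecondOrderLimit μ (fun N i ω => complexify (X N i ω)) S a ∧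
    RealSecondOrderFree S t (fun i => starAlg (a i))

/-- The centered element `P(X, X^*) - E tr(P(X, X^*))` of the algebra generated by the matrix `X`
and its adjoint. -/
def centeredEval {Ω' : Type*} [MeasurableSpace Ω'] (μ : Measure Ω') {N : ℕ}
    (X : Ω' → Matrix (Fin N) (Fin N) ℂ) (P : StarPoly Unit) (ω : Ω') :
    Matrix (Fin N) (Fin N) ℂ :=
  starEval (fun _ => X ω) P - (∫ ω', normTrace (starEval (fun _ => X ω') P) ∂μ) • 1

/-- The covariance `cov(Tr(A_1 ⋯ A_p), Tr(B_1 ⋯ B_q))` at size `N`, where `A_i` is the centered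
`P i` in the matrix of color `c i` and `B_j` the centered `Q j` in the matrix of color `d j`. -/
def wordCov (μ : ∀ N, Measure (Ω N)) (X : ∀ N, I → Ω N → Matrix (Fin N) (Fin N) ℂ)
    {p q : ℕ} (c : Fin p → I) (d : Fin q → I) (P : Fin p → StarPoly Unit)
    (Q : Fin q → StarPoly Unit) (N : ℕ) : ℂ :=
  covar (μ N)
    (fun ω => (wordProd (fun i => centeredEval (μ N) (X N (c i)) (P i) ω)).trace)
    (fun ω => (wordProd (fun j => centeredEval (μ N) (X N (d j)) (Q j) ω)).trace)

/-- The covariance formula for words that are centered at every size `N`. -/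
def CovarianceFormula (μ : ∀ N, Measure (Ω N))
    (X : ∀ N, I → Ω N → Matrix (Fin N) (Fin N) ℂ) : Prop :=
  (∀ p q : ℕ, 2 ≤ p → 2 ≤ q → p ≠ q → ∀ (c : Fin p → I) (d : Fin q → I)
    (P : Fin p → StarPoly Unit) (Q : Fin q → StarPoly Unit),
    CyclicallyAlternating c → CyclicallyAlternating d →
    Tendsto (wordCov μ X c d P Q) atTop (𝓝 0)) ∧
  ∀ p : ℕ, 2 ≤ p → ∀ (c d : Fin p → I) (P Q : Fin p → StarPoly Unit),
    CyclicallyAlternating c → CyclicallyAlternating d →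
    ∃ L : Fin p → Fin p → ℂ,
      (∀ i j, Tendsto (fun N => ∫ ω, normTrace (centeredEval (μ N) (X N (c i)) (P i) ω *
        centeredEval (μ N) (X N (d j)) (Q j) ω) ∂(μ N)) atTop (𝓝 (L i j))) ∧
      Tendsto (wordCov μ X c d P Q) atTop (𝓝 (∑ k : Fin p, ∏ i : Fin p, L i (k - i)))

/-- The covariance formula of the real case, with the additional transpose term. -/
def RealCovarianceFormula (μ : ∀ N, Measure (Ω N))
    (X : ∀ N, I → Ω N → Matrix (Fin N) (Fin N) ℂ) : Prop :=
  (∀ p q : ℕ, 2 ≤ p → 2 ≤ q → p ≠ q → ∀ (c : Fin p → I) (d : Fin q → I)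
    (P : Fin p → StarPoly Unit) (Q : Fin q → StarPoly Unit),
    CyclicallyAlternating c → CyclicallyAlternating d →
    Tendsto (wordCov μ X c d P Q) atTop (𝓝 0)) ∧
  ∀ p : ℕ, 2 ≤ p → ∀ (c d : Fin p → I) (P Q : Fin p → StarPoly Unit),
    CyclicallyAlternating c → CyclicallyAlternating d →
    ∃ L L' : Fin p → Fin p → ℂ,
      (∀ i j, Tendsto (fun N => ∫ ω, normTrace (centeredEval (μ N) (X N (c i)) (P i) ω *
        centeredEval (μ N) (X N (d j)) (Q j) ω) ∂(μ N)) atTop (𝓝 (L i j))) ∧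
      (∀ i j, Tendsto (fun N => ∫ ω, normTrace (centeredEval (μ N) (X N (c i)) (P i) ω *
        (centeredEval (μ N) (X N (d j)) (Q j) ω).transpose) ∂(μ N)) atTop (𝓝 (L' i j))) ∧
      Tendsto (wordCov μ X c d P Q) atTop
        (𝓝 (∑ k : Fin p, ((∏ i : Fin p, L i (k - i)) + ∏ i : Fin p, L' i (k + i))))

end Asymptotic

end Elliptic

end

noncomputable section
namespace Elliptic

/-! ### Gaussian integration by parts -/

/-! The letters are the matrices `x_i` and their adjoints `x_i^*`, exchanged by `τ`. All entries are
linear forms in one centered Gaussian process, and the covariance of the entry `(i, j)` of the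
letter `a` with the entry `(k, l)` of the letter `b` is `N⁻¹ (g a b δ_il δ_jk + ε g a (τ b) δ_ik
δ_jl)`, with `ε = 0` for complex and `ε = 1` for real matrices. The parameters `γ_i` enter only
through `g`, and independence only through the vanishing of `g` between different colors.
`LoopModel` keeps just this and integration by parts.

Integration by parts in the first letter of a trace gives the loop equations,
`LoopModel.E_T_cons_mul_G`. The first contraction cuts the trace in two or merges it with another
trace; the second glues the pieces after transposing one of them. Each trace is written as `N` times
its mean plus a centered part. The leading powers of `N` then cancel, and the means and the joint
moments of centered traces obey recursions with bounded coefficients, corrections of order `N⁻¹`,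
and words of smaller total length on the right. Hence all limits exist (`exists_limits`).

In the limit the mean `α` satisfies the Schwinger-Dyson equation `α(x_a P) = (α ⊗ α)(∂_a P)`, where
`∂_a` is a weighted free difference quotient. The covariance satisfies the linearization of this
equation, with a source made of the cyclic derivative of the second argument and, with weight `ε`,
of its transpose (`limCov_ι_mul`). The higher moments satisfy the Wick recursion (`momentLim_wick`),
so the cumulants of order at least three vanish in the limit.

Freeness holds because `∂_a` kills the algebras of the other colors. In a product of a word of the
color of `a` and an alternating centered product, `∂_a` can cut only the word itself or a later
factor of the same color, and then one of the two pieces has trace zero by induction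
(`FreeLoopState.α_word_mul_lprod`). For the covariance, fix the second word and all factors of the
first word except its first one. As a function of that factor, the covariance and the sum over
rotations obey the same linear recursion: freeness removes the terms in which `∂_a` meets another
factor of the first word, and it evaluates the source as a sum over rotations
(`FreeLoopState.secondOrder_of_source`, `FreeLoopState.spokeSum_x_mul`). The source of the
transposed word gives the extra sum of the real case.

The limit space is the algebra of `*`-polynomials itself. Centering at size `N` instead of in the
limit changes the factors only by convergent scalars. -/

theorem integral_pow_succ_gaussianReal (v : NNReal) (n : ℕ) :
    ∫ x, x ^ (n + 1) ∂(gaussianReal 0 v) = v * (n * ∫ x, x ^ (n - 1) ∂(gaussianReal 0 v)) := by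
  -- For `v = 0` the law is a Dirac mass and has no density to integrate by parts. For `n = 0` the
  -- truncated exponent `n - 1` is harmless because of the factor `n`.
  rcases eq_or_ne v 0 with rfl | hv
  · simp
  have hInt : ∀ m : ℕ, Integrable (fun x : ℝ => gaussianPDFReal 0 v x * x ^ m) := by
    intro m
    have h : Integrable (fun x : ℝ => x ^ m) (gaussianReal 0 v) := by
      have := (memLp_id_gaussianReal (μ := 0) (v := v) m).integrable_norm_pow'
      refine (integrable_norm_iff (by fun_prop)).1 ?_
      simpa using this
    rw [gaussianReal_of_var_ne_zero _ hv, integrable_withDensity_iff (by fun_prop)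
      (by simp [gaussianPDF])] at h
    simpa [toReal_gaussianPDF, mul_comm] using h
  have hder : ∀ x : ℝ, HasDerivAt (gaussianPDFReal 0 v)
      (-(x / v) * gaussianPDFReal 0 v x) x := by
    intro x
    have h1 : HasDerivAt (fun x : ℝ => -(x - 0) ^ 2 / (2 * v)) (-(x / v)) x := by
      refine (((((hasDerivAt_id x).sub_const 0).pow 2).neg).div_const (2 * (v : ℝ))).congr_deriv ?_
      have : (v : ℝ) ≠ 0 := by exact_mod_cast hv
      simp only [id]
      field_simp
      ring
    have := (h1.exp).const_mul (Real.sqrt (2 * Real.pi * v))⁻¹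
    rw [gaussianPDFReal_def]
    refine this.congr_deriv ?_
    ring
  have hv' : (v : ℝ) ≠ 0 := by exact_mod_cast hv
  have key := integral_mul_deriv_eq_deriv_mul_of_integrable (A := ℝ)
    (u := fun x : ℝ => x ^ n) (v := gaussianPDFReal 0 v)
    (u' := fun x => n * x ^ (n - 1)) (v' := fun x => -(x / v) * gaussianPDFReal 0 v x)
    (fun x _ => hasDerivAt_pow n x) (fun x _ => hder x)
    (by
      refine ((hInt (n + 1)).const_mul (-(v : ℝ)⁻¹)).congr (.of_forall fun x => ?_)
      simp only [Pi.mul_apply]; field_simp; ring)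
    (by
      refine ((hInt (n - 1)).const_mul n).congr (.of_forall fun x => ?_)
      simp only [Pi.mul_apply]; ring)
    (by
      refine (hInt n).congr (.of_forall fun x => ?_)
      simp only [Pi.mul_apply]; ring)
  simp only [integral_gaussianReal_eq_integral_smul hv, smul_eq_mul]
  have e1 : ∀ x : ℝ, x ^ n * (-(x / v) * gaussianPDFReal 0 v x) =
      -(v : ℝ)⁻¹ * (gaussianPDFReal 0 v x * x ^ (n + 1)) := by
    intro x; field_simp; ring
  have e2 : ∀ x : ℝ, n * x ^ (n - 1) * gaussianPDFReal 0 v x =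
      n * (gaussianPDFReal 0 v x * x ^ (n - 1)) := by
    intro x; ring
  simp only [e1, e2, integral_const_mul] at key
  field_simp at key
  linarith

/-- A function with finite moments of all orders. -/
def AllMoments {Ω : Type*} [MeasurableSpace Ω] (P : Measure Ω) (f : Ω → ℂ) : Prop :=
  ∀ p : ENNReal, p ≠ ⊤ → MemLp f p P

section AllMoments

variable {Ω : Type*} [MeasurableSpace Ω] {P : Measure Ω} {f g : Ω → ℂ}

theorem AllMoments.mul (hf : AllMoments P f) (hg : AllMoments P g) :
    AllMoments P (fun ω => f ω * g ω) := by
  intro p hp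
  have h2 : 2 * p ≠ ⊤ := ENNReal.mul_ne_top (by simp) hp
  have : ENNReal.HolderTriple (2 * p) (2 * p) p := by
    constructor
    rw [ENNReal.mul_inv (by simp) (by simp), ← add_mul, ENNReal.inv_two_add_inv_two, one_mul]
  exact (hg _ h2).mul' (hf _ h2)

theorem AllMoments.add (hf : AllMoments P f) (hg : AllMoments P g) :
    AllMoments P (fun ω => f ω + g ω) := fun p hp => (hf p hp).add (hg p hp)

theorem AllMoments.const [IsFiniteMeasure P] (c : ℂ) : AllMoments P (fun _ => c) :=
  fun _ _ => memLp_const c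

theorem AllMoments.integrable (hf : AllMoments P f) : Integrable f P :=
  memLp_one_iff_integrable.1 (hf 1 (by simp))

end AllMoments

/-! ### Polynomials in the values of a Gaussian process -/

section Wick

variable {Ω J : Type*} [MeasurableSpace Ω] {P : Measure Ω} {ξ : J → Ω → ℝ}

/-- Evaluation of a complex polynomial at the values of a real process. -/
def polyEval (ξ : J → Ω → ℝ) (ω : Ω) : MvPolynomial J ℂ →ₐ[ℂ] ℂ :=
  MvPolynomial.aeval (fun j => (ξ j ω : ℂ))

theorem polyEval_X (ξ : J → Ω → ℝ) (ω : Ω) (j : J) :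
    polyEval ξ ω (MvPolynomial.X j) = ξ j ω := by simp [polyEval]

theorem polyEval_allMoments (hξ : IsGaussianProcess ξ P) (F : MvPolynomial J ℂ) :
    AllMoments P (fun ω => polyEval ξ ω F) := by
  have := hξ.isProbabilityMeasure
  induction F using MvPolynomial.induction_on with
  | C a => simpa [polyEval] using AllMoments.const a
  | add p q hp hq => simpa using hp.add hq
  | mul_X p j hp =>
    simp only [map_mul, polyEval_X]
    exact hp.mul fun p hp => ((hξ.hasGaussianLaw_eval j).memLp hp).ofReal

theorem measurable_aeval_ofReal (F : MvPolynomial J ℂ) :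
    Measurable (fun z : J → ℝ => MvPolynomial.aeval (fun j => (z j : ℂ)) F) := by
  induction F using MvPolynomial.induction_on with
  | C a => simp
  | add p q hp hq =>
    simp only [map_add]
    exact hp.add hq
  | mul_X p j hp =>
    simp only [map_mul, MvPolynomial.aeval_X]
    exact hp.mul (by fun_prop)

/-- The expectation of a polynomial in the values of a Gaussian process. -/
def gaussExp (hξ : IsGaussianProcess ξ P) : MvPolynomial J ℂ →ₗ[ℂ] ℂ where
  toFun F := ∫ ω, polyEval ξ ω F ∂P
  map_add' F G := by
    simp only [map_add]
    exact integral_add (polyEval_allMoments hξ F).integrable (polyEval_allMoments hξ G).integrable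
  map_smul' c F := by
    simp only [map_smul, smul_eq_mul, RingHom.id_apply]
    exact integral_const_mul _ _

theorem gaussExp_apply (hξ : IsGaussianProcess ξ P) (F : MvPolynomial J ℂ) :
    gaussExp hξ F = ∫ ω, polyEval ξ ω F ∂P := rfl

theorem gaussExp_one (hξ : IsGaussianProcess ξ P) : gaussExp hξ 1 = 1 := by
  have := hξ.isProbabilityMeasure
  simp [gaussExp_apply]

open MvPolynomial in
/-- Gaussian integration by parts for polynomials. -/
theorem gaussExp_X_mul (hξ : IsGaussianProcess ξ P) (hc : ∀ j, ∫ ω, ξ j ω ∂P = 0) (j : J)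
    (F : MvPolynomial J ℂ) :
    gaussExp hξ (X j * F) =
      gaussExp hξ (mkDerivation ℂ (fun f => C (gaussExp hξ (X j * X f))) F) := by
  have := hξ.isProbabilityMeasure
  have hL2 : ∀ f, MemLp (ξ f) 2 P := fun f => (hξ.hasGaussianLaw_eval f).memLp_two
  set s : ℝ := ∫ ω, ξ j ω * ξ j ω ∂P with hs
  have hcov : ∀ f, gaussExp hξ (X j * X f) = ((∫ ω, ξ j ω * ξ f ω ∂P : ℝ) : ℂ) := by
    intro f
    simp only [gaussExp_apply, map_mul, polyEval_X]
    rw [← integral_complex_ofReal]; simp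
  -- `c f` is the coefficient of the regression of `ξ f` on `ξ j`. If `ξ j` has variance zero, it
  -- vanishes almost surely, and the coefficient `0` does.
  obtain ⟨c, hcs⟩ : ∃ c : J → ℝ, ∀ f, ∫ ω, ξ j ω * ξ f ω ∂P = s * c f := by
    by_cases h0 : s = 0
    · have : ξ j =ᵐ[P] 0 := by
        have h1 := (integral_eq_zero_iff_of_nonneg (fun ω => mul_self_nonneg (ξ j ω))
          ((hL2 j).integrable_mul (hL2 j))).1 (hs.symm.trans h0)
        filter_upwards [h1] with ω hω
        simpa using hω
      refine ⟨0, fun f => ?_⟩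
      rw [integral_eq_zero_of_ae]
      · simp
      · filter_upwards [this] with ω hω
        simp [hω]
    · exact ⟨fun f => (∫ ω, ξ j ω * ξ f ω ∂P) / s, fun f => by field_simp⟩
  -- The residuals of the regression. They are jointly Gaussian with `ξ j` and uncorrelated with it,
  -- hence independent of it. This reduces the claim to the moments of the single variable `ξ j`.
  set ζ : J → Ω → ℝ := fun f ω => ξ f ω - c f * ξ j ω with hζdef
  have hζ : IsGaussianProcess ζ P := by
    classical
    exact hξ.of_isGaussianProcess fun f => ⟨{f, j},
      { toFun x := x ⟨f, by simp⟩ - c f * x ⟨j, by simp⟩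
        map_add' x y := by simp; ring
        map_smul' r x := by simp; ring }, by simp [hζdef]⟩
  have hjoint : IsGaussianProcess (Sum.elim (fun _ : Unit => ξ j) ζ) P := by
    classical
    refine hξ.of_isGaussianProcess fun f => ?_
    rcases f with _ | f
    · exact ⟨{j}, { toFun x := x ⟨j, by simp⟩
                    map_add' x y := by simp
                    map_smul' r x := by simp }, by simp⟩
    · exact ⟨{f, j},
        { toFun x := x ⟨f, by simp⟩ - c f * x ⟨j, by simp⟩
          map_add' x y := by simp; ring
          map_smul' r x := by simp; ring }, by simp [hζdef]⟩
  have hind : IndepFun (fun ω (_ : Unit) => ξ j ω) (fun ω f => ζ f ω) P := by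
    refine hjoint.indepFun_of_covariance_eq_zero (fun _ => hξ.aemeasurable j)
      (fun f => hζ.aemeasurable f) fun _ f => ?_
    rw [covariance_eq_sub (hL2 j) (hζ.hasGaussianLaw_eval f).memLp_two, hc j, zero_mul, sub_zero]
    have : (∫ ω, (ξ j * ζ f) ω ∂P) =
        ∫ ω, (ξ j ω * ξ f ω - c f * (ξ j ω * ξ j ω)) ∂P := by
      congr 1; ext ω; simp [hζdef]; ring
    have i1 : ∀ f, Integrable (fun ω => ξ j ω * ξ f ω) P := fun f =>
      (hL2 j).integrable_mul (hL2 f)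
    rw [this, integral_sub (i1 f) ((i1 j).const_mul _), integral_const_mul, hcs f, ← hs]
    ring
  have hmom : ∀ k : ℕ, ∫ ω, ((ξ j ω : ℂ)) ^ (k + 1) ∂P =
      s * (k * ∫ ω, ((ξ j ω : ℂ)) ^ (k - 1) ∂P) := by
    intro k
    have hlaw := (hξ.hasGaussianLaw_eval j).map_eq_gaussianReal
    have hvar : ((Var[ξ j; P]).toNNReal : ℝ) = s := by
      rw [Real.coe_toNNReal _ (variance_nonneg _ _), variance_eq_sub (hL2 j), hc j, hs]
      simp [pow_two]
    have h1 : ∀ m : ℕ, ∫ ω, (ξ j ω) ^ m ∂P = ∫ x, x ^ m ∂(P.map (ξ j)) := fun m =>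
      (integral_map (f := fun x : ℝ => x ^ m) (hξ.aemeasurable j) (by fun_prop)).symm
    have h2 : ∀ m : ℕ, ∫ ω, ((ξ j ω : ℂ)) ^ m ∂P = ((∫ ω, (ξ j ω) ^ m ∂P : ℝ) : ℂ) := by
      intro m
      rw [← integral_complex_ofReal]; simp
    have h3 := integral_pow_succ_gaussianReal (Var[ξ j; P]).toNNReal k
    rw [hvar] at h3
    rw [hc j] at hlaw
    rw [h2, h2, h1, h1, hlaw, h3]
    push_cast; rfl
  have hsplit : ∀ (k : ℕ) (m : MvPolynomial J ℂ),
      ∫ ω, polyEval ζ ω m * (ξ j ω : ℂ) ^ k ∂P =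
        (∫ ω, polyEval ζ ω m ∂P) * ∫ ω, (ξ j ω : ℂ) ^ k ∂P := by
    intro k m
    have hm : Measurable (fun z : Unit → ℝ => ((z () : ℝ) : ℂ) ^ k) :=
      (Complex.measurable_ofReal.comp (measurable_pi_apply ())).pow_const k
    have h := hind.symm.comp (measurable_aeval_ofReal m) hm
    refine h.integral_fun_mul_eq_mul_integral
      (polyEval_allMoments hζ m).integrable.aestronglyMeasurable ?_
    have := (polyEval_allMoments hξ (X j ^ k)).integrable.aestronglyMeasurable
    simp only [map_pow, polyEval_X] at this
    exact this
  -- The substitution `ξ f = ζ f + c f ξ j`: a polynomial in `ξ` becomes a polynomial in the one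
  -- variable `ξ j` with coefficients that are polynomials in the residuals.
  let Φ : MvPolynomial J ℂ →ₐ[ℂ] Polynomial (MvPolynomial J ℂ) :=
    aeval (fun f => Polynomial.C (X f) + Polynomial.C (C (c f : ℂ)) * Polynomial.X)
  let val : Ω → Polynomial (MvPolynomial J ℂ) →+* ℂ := fun ω =>
    Polynomial.eval₂RingHom (polyEval ζ ω).toRingHom (ξ j ω : ℂ)
  have hval : ∀ ω G, val ω (Φ G) = polyEval ξ ω G := by
    intro ω G
    induction G using MvPolynomial.induction_on with
    | C a =>
      simp only [Φ, val, MvPolynomial.aeval_C, polyEval]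
      simp [Polynomial.algebraMap_apply]
    | add p q hp hq => simp only [map_add, hp, hq]
    | mul_X p f hp =>
      rw [map_mul, map_mul, map_mul, hp, polyEval_X]
      congr 1
      simp [Φ, val, polyEval, hζdef]
  have hvalint : ∀ q, Integrable (fun ω => val ω q) P ∧
      Integrable (fun ω => (ξ j ω : ℂ) * val ω q) P := by
    have hm : ∀ q, AllMoments P (fun ω => val ω q) := by
      intro q
      induction q using Polynomial.induction_on' with
      | add p q hp hq => simpa using hp.add hq
      | monomial n a =>
        have : ∀ ω, val ω (Polynomial.monomial n a) =
            polyEval ζ ω a * polyEval ξ ω (X j ^ n) := by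
          intro ω; simp [val, polyEval_X]
        simp only [this]
        exact (polyEval_allMoments hζ a).mul (polyEval_allMoments hξ _)
    intro q
    refine ⟨(hm q).integrable, ?_⟩
    have := ((polyEval_allMoments hξ (X j)).mul (hm q)).integrable
    simpa only [polyEval_X] using this
  have hone : ∀ q, ∫ ω, (ξ j ω : ℂ) * val ω q ∂P =
      s * ∫ ω, val ω (Polynomial.derivative q) ∂P := by
    intro q
    induction q using Polynomial.induction_on' with
    | add p q hp hq =>
      simp only [map_add, mul_add]
      rw [integral_add (hvalint p).2 (hvalint q).2, integral_add (hvalint _).1 (hvalint _).1,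
        hp, hq, mul_add]
    | monomial n a =>
      have e1 : ∀ ω, (ξ j ω : ℂ) * val ω (Polynomial.monomial n a) =
          polyEval ζ ω a * (ξ j ω : ℂ) ^ (n + 1) := by
        intro ω; simp [val]; ring
      have e2 : ∀ ω, val ω (Polynomial.derivative (Polynomial.monomial n a)) =
          n * (polyEval ζ ω a * (ξ j ω : ℂ) ^ (n - 1)) := by
        intro ω; simp [val, Polynomial.derivative_monomial]; ring
      simp only [e1, e2, integral_const_mul]
      rw [hsplit, hsplit, hmom]
      ring
  -- Under the substitution, `s` times the derivative in the variable `ξ j` is the derivation of the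
  -- claim: both send `X f` to `s * c f`, the covariance of `ξ j` and `ξ f`.
  have hder : ∀ G, Polynomial.C (C (s : ℂ)) * Polynomial.derivative (Φ G) =
      Φ (mkDerivation ℂ (fun f => C (gaussExp hξ (X j * X f))) G) := by
    intro G
    induction G using MvPolynomial.induction_on with
    | C a => simp [Φ, Polynomial.algebraMap_apply]
    | add p q hp hq => simp only [map_add, mul_add, hp, hq]
    | mul_X p f hp =>
      have hX : Φ (X f) = Polynomial.C (X f) + Polynomial.C (C (c f : ℂ)) * Polynomial.X := by
        simp [Φ]
      have hdX : Polynomial.C (C (s : ℂ)) * Polynomial.derivative (Φ (X f)) =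
          Φ (C (gaussExp hξ (X j * X f))) := by
        rw [hX, hcov, hcs]
        simp [Φ, Polynomial.algebraMap_apply]
      rw [Derivation.leibniz, mkDerivation_X, map_mul Φ, Polynomial.derivative_mul, map_add,
        smul_eq_mul, smul_eq_mul, map_mul Φ, map_mul Φ, ← hp, ← hdX]
      ring
  rw [gaussExp_apply, gaussExp_apply]
  simp only [map_mul, polyEval_X]
  simp only [← hval, ← hder]
  rw [hone, ← integral_const_mul]
  congr 1; ext ω
  simp [val, polyEval]

end Wick

end Elliptic
end

noncomputable section
namespace Elliptic

/-! ### Recursion for classical cumulants -/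

/-- A partition of `S` amounts to the block `B` that contains `j` together with a partition of `S \
B`. This turns the moment-cumulant formula into a recursion. -/
theorem sum_finpartition_eq_sum_block {α : Type*} [DecidableEq α] (f : Finset α → ℂ)
    (S : Finset α) {j : α} (hj : j ∈ S) :
    ∑ π : Finpartition S, ∏ B ∈ π.parts, f B =
      ∑ B ∈ S.powerset with j ∈ B, f B * ∑ π : Finpartition (S \ B), ∏ B ∈ π.parts, f B := by
  simp only [Finset.mul_sum]
  rw [Finset.sum_sigma', eq_comm]
  have hB : ∀ x : (B : Finset α) × Finpartition (S \ B),
      x ∈ ((S.powerset.filter (j ∈ ·)).sigma fun B => (Finset.univ : Finset (Finpartition (S \ B)))) →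
      x.1 ⊆ S ∧ j ∈ x.1 := by
    intro x hx
    simpa using hx
  have hnot : ∀ x : (B : Finset α) × Finpartition (S \ B), x.1.Nonempty → x.1 ∉ x.2.parts := by
    rintro ⟨B, π⟩ ⟨i, hi⟩ h
    have := π.le h hi
    simp at this
    exact this.2 hi
  refine Finset.sum_bij (fun x hx => x.2.extend (b := x.1) (c := S)
    (Finset.nonempty_iff_ne_empty.1 ⟨j, (hB x hx).2⟩) Finset.sdiff_disjoint
    (by rw [Finset.sup_eq_union, Finset.sdiff_union_of_subset (hB x hx).1])) ?_ ?_ ?_ ?_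
  · intro x hx; simp
  · rintro x hx y hy h
    have h' : insert x.1 x.2.parts = insert y.1 y.2.parts := congrArg Finpartition.parts h
    have key : ∀ x y : (B : Finset α) × Finpartition (S \ B), j ∈ x.1 → j ∈ y.1 →
        insert x.1 x.2.parts = insert y.1 y.2.parts → x.1 = y.1 := by
      intro x y hx hy h
      have : x.1 ∈ insert y.1 y.2.parts := h ▸ Finset.mem_insert_self _ _
      rcases Finset.mem_insert.1 this with h | h
      · exact h
      · have := y.2.le h hx
        simp at this
        exact absurd hy this.2
    have e := key x y (hB x hx).2 (hB y hy).2 h'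
    obtain ⟨B, π⟩ := x
    obtain ⟨B', π'⟩ := y
    obtain rfl : B = B' := e
    have hn := hnot ⟨B, π⟩ ⟨j, (hB _ hx).2⟩
    have hn' := hnot ⟨B, π'⟩ ⟨j, (hB _ hx).2⟩
    have : π = π' := by
      ext1
      have := congrArg (fun s => Finset.erase s B) h'
      simpa [Finset.erase_insert hn, Finset.erase_insert hn'] using this
    rw [this]
  · intro π _
    have hm := π.part_mem.2 hj
    have hsub := π.le hm
    refine ⟨⟨π.part j, (π.avoid (π.part j))⟩, by simpa [hj] using hsub, ?_⟩
    ext B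
    simp only [Finpartition.extend, Finset.mem_insert, Finpartition.mem_avoid]
    have hdis : ∀ d ∈ π.parts, d ≠ π.part j → d \ π.part j = d := fun d hd hne =>
      sdiff_eq_left.2 (π.disjoint hd hm hne)
    constructor
    · rintro (rfl | ⟨d, hd, hle, rfl⟩)
      · exact hm
      · rw [hdis d hd (fun h => hle h.le)]; exact hd
    · intro hB
      by_cases h : B = π.part j
      · exact Or.inl h
      · refine Or.inr ⟨B, hB, fun hle => ?_, hdis B hB h⟩
        exact π.ne_bot hB ((π.disjoint hB hm h).eq_bot_of_le hle)
  · intro x hx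
    change _ = ∏ B ∈ insert x.1 x.2.parts, f B
    rw [Finset.prod_insert (hnot x ⟨j, (hB x hx).2⟩)]

theorem filter_powerset_eq_insert {α : Type*} [DecidableEq α] {S : Finset α} {j : α}
    (hj : j ∈ S) :
    S.powerset.filter (j ∈ ·) = insert S (S.ssubsets.filter (j ∈ ·)) := by
  ext B
  simp only [Finset.mem_filter, Finset.mem_powerset, Finset.mem_insert, Finset.mem_ssubsets]
  constructor
  · rintro ⟨h1, h2⟩
    rcases h1.eq_or_ssubset with h | h
    · exact Or.inl h
    · exact Or.inr ⟨h, h2⟩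
  · rintro (rfl | ⟨h1, h2⟩)
    · exact ⟨subset_rfl, hj⟩
    · exact ⟨h1.subset, h2⟩

/-! ### The moment-cumulant recursion and shifts by constants -/

section Cumulant

variable {Ω : Type*} [MeasurableSpace Ω] (μ : Measure Ω) {r : ℕ}

theorem moment_eq_sum_cumulant [IsProbabilityMeasure μ] (ξ : Fin r → Ω → ℂ)
    (S : Finset (Fin r)) {j : Fin r} (hj : j ∈ S) :
    ∫ ω, ∏ i ∈ S, ξ i ω ∂μ =
      ∑ B ∈ S.powerset with j ∈ B, cumulant μ ξ B * ∫ ω, ∏ i ∈ S \ B, ξ i ω ∂μ := by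
  rw [moment_cumulant μ ξ S ⟨j, hj⟩, sum_finpartition_eq_sum_block _ _ hj]
  refine Finset.sum_congr rfl fun B hB => ?_
  congr 1
  -- `moment_cumulant` needs a nonempty set. For `B = S` there is one partition of the empty set,
  -- its empty product is `1`, and so is the empty moment, because `μ` is a probability measure.
  rcases (S \ B).eq_empty_or_nonempty with h | h
  · rw [h]
    have : ∀ π : Finpartition (∅ : Finset (Fin r)), π.parts = ∅ := fun π =>
      Finpartition.parts_eq_empty_iff.2 rfl
    have hu : Unique (Finpartition (∅ : Finset (Fin r))) :=
      inferInstanceAs (Unique (Finpartition (⊥ : Finset (Fin r))))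
    simp [this]
  · rw [moment_cumulant μ ξ _ h]

theorem cumulant_eq_moment_sub [IsProbabilityMeasure μ] (ξ : Fin r → Ω → ℂ)
    (S : Finset (Fin r)) {j : Fin r} (hj : j ∈ S) :
    cumulant μ ξ S = (∫ ω, ∏ i ∈ S, ξ i ω ∂μ) -
      ∑ B ∈ S.ssubsets with j ∈ B, cumulant μ ξ B * ∫ ω, ∏ i ∈ S \ B, ξ i ω ∂μ := by
  rw [moment_eq_sum_cumulant μ ξ S hj, filter_powerset_eq_insert hj, Finset.sum_insert (by simp)]
  simp

theorem cumulant_congr {ξ η : Fin r → Ω → ℂ} (S : Finset (Fin r)) (h : ∀ j ∈ S, ξ j = η j) :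
    cumulant μ ξ S = cumulant μ η S := by
  induction S using Finset.strongInduction with
  | H S ih =>
    rw [cumulant, cumulant]
    congr 1
    · congr 1; ext ω
      exact Finset.prod_congr rfl fun j hj => by rw [h j hj]
    · refine Finset.sum_congr rfl fun π _ => Finset.prod_congr rfl fun B _ => ?_
      refine ih B.1 ((π.1.le B.2).lt_of_ne (fun e => π.2 (by simpa [e] using B.2))) ?_
      exact fun j hj => h j (π.1.le B.2 hj)

/-- Adding a constant to a random variable changes only its mean. -/
theorem cumulant_update_add [IsProbabilityMeasure μ] (ξ : Fin r → Ω → ℂ) (j : Fin r) (c : ℂ)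
    (hInt : ∀ S : Finset (Fin r), Integrable (fun ω => ∏ i ∈ S, ξ i ω) μ)
    (S : Finset (Fin r)) :
    cumulant μ (Function.update ξ j (fun ω => ξ j ω + c)) S =
      cumulant μ ξ S + if S = {j} then c else 0 := by
  set η := Function.update ξ j (fun ω => ξ j ω + c) with hη
  have hne : ∀ i, i ≠ j → η i = ξ i := fun i hi => by simp [hη, hi]
  have hjj : η j = fun ω => ξ j ω + c := by simp [hη]
  induction S using Finset.strongInduction with
  | H S ih =>
    by_cases hj : j ∈ S
    · rw [cumulant_eq_moment_sub μ η S hj, cumulant_eq_moment_sub μ ξ S hj]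
      have h1 : ∀ T : Finset (Fin r), j ∉ T → ∀ ω, ∏ i ∈ T, η i ω = ∏ i ∈ T, ξ i ω :=
        fun T hT ω => Finset.prod_congr rfl fun i hi => by
          rw [hne i (fun h => hT (h ▸ hi))]
      have h2 : ∫ ω, ∏ i ∈ S, η i ω ∂μ =
          (∫ ω, ∏ i ∈ S, ξ i ω ∂μ) + c * ∫ ω, ∏ i ∈ S \ {j}, ξ i ω ∂μ := by
        rw [← integral_const_mul, ← integral_add (hInt S) ((hInt _).const_mul c)]
        congr 1; ext ω
        rw [← Finset.mul_prod_erase S _ hj, ← Finset.mul_prod_erase S (fun i => ξ i ω) hj,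
          h1 _ (Finset.notMem_erase j S), hjj, Finset.sdiff_singleton_eq_erase]
        ring
      have h3 : ∀ B ∈ S.ssubsets.filter (j ∈ ·),
          cumulant μ η B * ∫ ω, ∏ i ∈ S \ B, η i ω ∂μ =
            cumulant μ ξ B * (∫ ω, ∏ i ∈ S \ B, ξ i ω ∂μ) +
              if B = {j} then c * ∫ ω, ∏ i ∈ S \ {j}, ξ i ω ∂μ else 0 := by
        intro B hB
        simp only [Finset.mem_filter, Finset.mem_ssubsets] at hB
        rw [ih B hB.1, add_mul]
        simp only [h1 (S \ B) (by simp [hB.2])]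
        split_ifs with h
        · rw [h]
        · ring
      rw [h2, Finset.sum_congr rfl h3, Finset.sum_add_distrib, Finset.sum_ite_eq']
      by_cases hS : S = {j}
      · subst hS
        simp
        ring
      · have hs : {j} ⊂ S := (Finset.singleton_subset_iff.2 hj).ssubset_of_ne (Ne.symm hS)
        simp [hS, hs]
    · rw [cumulant_congr μ S (fun i hi => hne i (fun h => hj (h ▸ hi))), if_neg]
      · simp
      · rintro rfl; simp at hj

/-- The constants are added one coordinate at a time, and each addition changes only the cumulant of
one singleton. This permits replacing traces by centered traces. -/
theorem cumulant_add_const [IsProbabilityMeasure μ] (ξ : Fin r → Ω → ℂ) (c : Fin r → ℂ)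
    (hξ : ∀ (c : Fin r → ℂ) (S : Finset (Fin r)),
      Integrable (fun ω => ∏ i ∈ S, (ξ i ω + c i)) μ)
    (S : Finset (Fin r)) (hS : 2 ≤ S.card) :
    cumulant μ (fun j ω => ξ j ω + c j) S = cumulant μ ξ S := by
  classical
  suffices H : ∀ F : Finset (Fin r),
      cumulant μ (fun j ω => ξ j ω + if j ∈ F then c j else 0) S = cumulant μ ξ S by
    simpa using H Finset.univ
  intro F
  induction F using Finset.induction_on with
  | empty => simp
  | insert j F hj ih =>
    rw [← ih]
    have h := cumulant_update_add μ (fun i ω => ξ i ω + if i ∈ F then c i else 0) j (c j)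
      (fun S => hξ (fun i => if i ∈ F then c i else 0) S) S
    rw [if_neg (show S ≠ {j} by rintro rfl; simp at hS), add_zero] at h
    rw [← h]
    congr 1
    ext i ω
    by_cases hi : i = j
    · subst hi; simp [hj]
    · simp [Function.update_of_ne hi, hi]

end Cumulant

/-- If the joint moments of a sequence of families converge to Gaussian ones, then the joint
cumulants converge to the Gaussian ones. -/
theorem tendsto_cumulant_of_wick {Ω : ℕ → Type*} [∀ N, MeasurableSpace (Ω N)]
    (μ : ∀ N, Measure (Ω N)) [∀ N, IsProbabilityMeasure (μ N)] {r : ℕ}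
    (ξ : ∀ N, Fin r → Ω N → ℂ) (M : Finset (Fin r) → ℂ)
    (hM : ∀ S, Tendsto (fun N => ∫ ω, ∏ j ∈ S, ξ N j ω ∂(μ N)) atTop (𝓝 (M S)))
    (hwick : ∀ S, ∀ j ∈ S, M S = ∑ k ∈ S.erase j, M {j, k} * M ((S.erase j).erase k))
    (S : Finset (Fin r)) (hS : S.Nonempty) :
    Tendsto (fun N => cumulant (μ N) (ξ N) S) atTop (𝓝 (if S.card = 2 then M S else 0)) := by
  induction S using Finset.strongInduction with
  | H S ih =>
    obtain ⟨j, hj⟩ := hS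
    have h0 : M ∅ = 1 := tendsto_nhds_unique (hM ∅) (by simp)
    -- The Wick recursion is the moment-cumulant recursion for cumulants supported on pairs: among
    -- the blocks containing `j` only the sets `{j, k}` contribute.
    have hlim : M S - ∑ B ∈ S.ssubsets with j ∈ B, (if B.card = 2 then M B else 0) * M (S \ B) =
        if S.card = 2 then M S else 0 := by
      have h1 : ∑ B ∈ S.powerset with j ∈ B, (if B.card = 2 then M B else 0) * M (S \ B) = M S := by
        rw [hwick S j hj]
        symm
        rw [← Finset.sum_filter_of_ne (p := fun B : Finset (Fin r) => B.card = 2)]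
        swap
        · intro B _ h
          by_contra hc
          exact h (by simp [hc])
        refine Finset.sum_bij (fun k _ => {j, k}) ?_ ?_ ?_ ?_
        · intro k hk
          simp only [Finset.mem_erase] at hk
          simp only [Finset.mem_filter, Finset.mem_powerset]
          refine ⟨⟨?_, by simp⟩, Finset.card_pair (Ne.symm hk.1)⟩
          intro x hx
          simp only [Finset.mem_insert, Finset.mem_singleton] at hx
          rcases hx with rfl | rfl
          exacts [hj, hk.2]
        · intro k hk l hl h
          simp only [Finset.mem_erase] at hk hl
          have : k ∈ ({j, l} : Finset (Fin r)) := h ▸ by simp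
          simpa [hk.1] using this
        · intro B hB
          simp only [Finset.mem_filter, Finset.mem_powerset] at hB
          obtain ⟨⟨hBS, hjB⟩, hc⟩ := hB
          obtain ⟨k, hk⟩ : ∃ k, B.erase j = {k} := by
            rw [← Finset.card_eq_one, Finset.card_erase_of_mem hjB, hc]
          have hkB : k ∈ B.erase j := by simp [hk]
          rw [Finset.mem_erase] at hkB
          refine ⟨k, Finset.mem_erase.2 ⟨hkB.1, hBS hkB.2⟩, ?_⟩
          rw [← Finset.insert_erase hjB, hk]
        · intro k hk
          simp only [Finset.mem_erase] at hk
          rw [if_pos (Finset.card_pair (Ne.symm hk.1))]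
          congr 2
          ext x; simp; tauto
      rw [filter_powerset_eq_insert hj, Finset.sum_insert (by simp)] at h1
      rw [Finset.sdiff_self, h0, mul_one] at h1
      rw [sub_eq_iff_eq_add, h1]
    rw [← hlim]
    simp only [fun N => cumulant_eq_moment_sub (μ N) (ξ N) S hj]
    refine (hM S).sub (tendsto_finsetSum _ fun B hB => ?_)
    simp only [Finset.mem_filter, Finset.mem_ssubsets] at hB
    exact (ih B hB.1 ⟨j, hB.2⟩).mul (hM _)

end Elliptic
end

noncomputable section
namespace Elliptic

/-! ### Sums over the splittings of a list -/

section SplitSum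

variable {α M : Type*} [AddCommMonoid M]

/-- The sum of `f u b v` over all decompositions `w = u ++ b :: v`. -/
def splitSum (w : List α) (f : List α → α → List α → M) : M :=
  ∑ p : Fin w.length, f (w.take p) (w.get p) (w.drop (p + 1))

@[simp] theorem splitSum_nil (f : List α → α → List α → M) : splitSum [] f = 0 := by
  simp [splitSum]

theorem splitSum_cons (a : α) (w : List α) (f : List α → α → List α → M) :
    splitSum (a :: w) f = f [] a w + splitSum w (fun u b v => f (a :: u) b v) := by
  simp only [splitSum, List.length_cons]
  rw [Fin.sum_univ_succ]
  simp

theorem splitSum_congr (w : List α) {f g : List α → α → List α → M}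
    (h : ∀ u b v, w = u ++ b :: v → f u b v = g u b v) : splitSum w f = splitSum w g := by
  refine Finset.sum_congr rfl fun p _ => h _ _ _ ?_
  simp

theorem map_splitSum {M' F : Type*} [AddCommMonoid M'] [FunLike F M M'] [AddMonoidHomClass F M M']
    (φ : F) (w : List α) (f : List α → α → List α → M) :
    φ (splitSum w f) = splitSum w (fun u b v => φ (f u b v)) := by
  simp [splitSum, map_sum]

theorem splitSum_add (w : List α) (f g : List α → α → List α → M) :
    splitSum w (fun u b v => f u b v + g u b v) = splitSum w f + splitSum w g :=
  Finset.sum_add_distrib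

theorem splitSum_sub {M : Type*} [AddCommGroup M] (w : List α) (f g : List α → α → List α → M) :
    splitSum w (fun u b v => f u b v - g u b v) = splitSum w f - splitSum w g :=
  Finset.sum_sub_distrib _ _

theorem splitSum_mul_left {R : Type*} [NonUnitalNonAssocSemiring R] (r : R) (w : List α)
    (f : List α → α → List α → R) :
    splitSum w (fun u b v => r * f u b v) = r * splitSum w f :=
  (Finset.mul_sum _ _ _).symm

theorem splitSum_mul_right {R : Type*} [NonUnitalNonAssocSemiring R] (r : R) (w : List α)
    (f : List α → α → List α → R) :
    splitSum w (fun u b v => f u b v * r) = splitSum w f * r :=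
  (Finset.sum_mul _ _ _).symm

theorem splitSum_smul {R : Type*} [Monoid R] [DistribMulAction R M] (r : R) (w : List α)
    (f : List α → α → List α → M) :
    splitSum w (fun u b v => r • f u b v) = r • splitSum w f :=
  Finset.smul_sum.symm

theorem sum_splitSum {ι : Type*} (s : Finset ι) (w : List α) (f : ι → List α → α → List α → M) :
    ∑ i ∈ s, splitSum w (f i) = splitSum w (fun u b v => ∑ i ∈ s, f i u b v) :=
  Finset.sum_comm

theorem splitSum_zero (w : List α) : splitSum w (fun _ _ _ => (0 : M)) = 0 := by simp [splitSum]

theorem splitSum_append (w w' : List α) (f : List α → α → List α → M) :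
    splitSum (w ++ w') f =
      splitSum w (fun u b v => f u b (v ++ w')) + splitSum w' (fun u b v => f (w ++ u) b v) := by
  induction w generalizing f with
  | nil => simp
  | cons a w ih => simp [splitSum_cons, ih, add_assoc]

theorem splitSum_map {β : Type*} (φ : β → α) (w : List β) (f : List α → α → List α → M) :
    splitSum (w.map φ) f = splitSum w (fun u b v => f (u.map φ) (φ b) (v.map φ)) := by
  induction w generalizing f with
  | nil => simp
  | cons a w ih => simp [splitSum_cons, ih]

theorem splitSum_reverse (w : List α) (f : List α → α → List α → M) :
    splitSum w.reverse f = splitSum w (fun u b v => f v.reverse b u.reverse) := by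
  induction w generalizing f with
  | nil => simp
  | cons a w ih => simp [splitSum_cons, splitSum_append, ih, add_comm]

theorem tendsto_splitSum {ι : Type*} {l : Filter ι} {M : Type*} [AddCommMonoid M]
    [TopologicalSpace M] [ContinuousAdd M] (w : List α) {f : ι → List α → α → List α → M}
    {g : List α → α → List α → M}
    (h : ∀ u b v, w = u ++ b :: v → Tendsto (fun i => f i u b v) l (𝓝 (g u b v))) :
    Tendsto (fun i => splitSum w (f i)) l (𝓝 (splitSum w g)) :=
  tendsto_finsetSum _ fun p _ => h _ _ _ (by simp)

theorem Derivation.list_prod {R : Type*} [CommRing R] [Algebra ℂ R] (D : Derivation ℂ R R)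
    (Z : α → R) (S : List α) :
    D (S.map Z).prod = splitSum S (fun u b v => D (Z b) * ((u ++ v).map Z).prod) := by
  induction S with
  | nil => simp
  | cons a S ih =>
    rw [List.map_cons, List.prod_cons, Derivation.leibniz, ih, splitSum_cons, smul_eq_mul,
      smul_eq_mul, ← splitSum_mul_left, add_comm]
    congr 1
    · simp [mul_comm]
    · refine splitSum_congr _ fun u b v _ => ?_
      simp; ring

end SplitSum

/-! ### Matrix models satisfying the Gaussian loop equations -/

/-- A model, inside a commutative algebra `R` with an expectation `E`, of a family of `N × N`
Gaussian matrices `Y a` with covariances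
`E (Y a i j * Y b k l) = N⁻¹ * (g a b * δ_il * δ_jk + ε * g a (τ b) * δ_ik * δ_jl)`.
Gaussianity is expressed by integration by parts. If `ε ≠ 0`, then `Y (τ a)` is the transpose of
`Y a`. -/
structure LoopModel {L : Type*} (τ : L → L) (g : L → L → ℂ) (ε : ℂ) (N : ℕ) where
  R : Type*
  [ring : CommRing R]
  [alg : Algebra ℂ R]
  E : R →ₗ[ℂ] ℂ
  E_one : E 1 = 1
  Y : L → Matrix (Fin N) (Fin N) R
  D : L → Fin N → Fin N → Derivation ℂ R R
  D_Y : ∀ a i j b k l, D a i j (Y b k l) = algebraMap ℂ R ((N : ℂ)⁻¹ *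
    ((if k = j ∧ l = i then g a b else 0) + if k = i ∧ l = j then ε * g a (τ b) else 0))
  ibp : ∀ a i j F, E (Y a i j * F) = E (D a i j F)
  transpose : ε ≠ 0 → ∀ a, Y (τ a) = (Y a).transpose

attribute [instance] LoopModel.ring LoopModel.alg

/-- The transpose of a word. -/
def transposeWord {L : Type*} (τ : L → L) (w : List L) : List L := (w.map τ).reverse

namespace LoopModel

variable {L : Type*} {τ : L → L} {g : L → L → ℂ} {ε : ℂ} {N : ℕ} (m : LoopModel τ g ε N)

/-- The value of a word at the matrices of the model. -/
def W (w : List L) : Matrix (Fin N) (Fin N) m.R := (w.map m.Y).prod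

/-- The trace of a word. -/
def T (w : List L) : m.R := (m.W w).trace

/-- The centered trace of a word. -/
def Z (w : List L) : m.R := m.T w - algebraMap ℂ m.R (m.E (m.T w))

/-- The product of the centered traces of several words. -/
def G (S : List (List L)) : m.R := (S.map m.Z).prod

/-- The normalized expected trace of a word. -/
def mean (w : List L) : ℂ := (N : ℂ)⁻¹ * m.E (m.T w)

/-- The joint moment of centered traces of words. -/
def moment (S : List (List L)) : ℂ := m.E (m.G S)

@[simp] theorem W_nil : m.W [] = 1 := rfl

theorem W_cons (a : L) (w : List L) : m.W (a :: w) = m.Y a * m.W w := by simp [W]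

theorem W_append (u v : List L) : m.W (u ++ v) = m.W u * m.W v := by simp [W]

theorem W_transposeWord (hε : ε ≠ 0) (w : List L) :
    m.W (transposeWord τ w) = (m.W w).transpose := by
  induction w with
  | nil => simp [transposeWord]
  | cons a w ih =>
    have : transposeWord τ (a :: w) = transposeWord τ w ++ [τ a] := by simp [transposeWord]
    rw [this, W_append, ih, m.W_cons a w, Matrix.transpose_mul, W_cons, m.transpose hε]
    simp

theorem map_mul_derivation {n R : Type*} [Fintype n] [CommRing R] [Algebra ℂ R]
    (D : Derivation ℂ R R) (A B : Matrix n n R) :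
    (A * B).map D = A.map D * B + A * B.map D := by
  ext i j
  simp only [Matrix.map_apply, Matrix.mul_apply, Matrix.add_apply, map_sum, Derivation.leibniz,
    smul_eq_mul, Finset.sum_add_distrib]
  rw [add_comm]
  congr 1
  exact Finset.sum_congr rfl fun k _ => mul_comm _ _

theorem map_W (D : Derivation ℂ m.R m.R) (w : List L) :
    (m.W w).map D = splitSum w (fun u b v => m.W u * (m.Y b).map D * m.W v) := by
  induction w with
  | nil =>
    ext i j
    by_cases h : i = j <;> simp [h]
  | cons a w ih =>
    rw [W_cons, map_mul_derivation, ih, splitSum_cons, ← splitSum_mul_left]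
    simp [W_cons, mul_assoc]

theorem Y_map_D (a b : L) (i j : Fin N) :
    (m.Y b).map (m.D a i j) = ((N : ℂ)⁻¹ * g a b) • Matrix.single j i 1 +
      ((N : ℂ)⁻¹ * (ε * g a (τ b))) • Matrix.single i j 1 := by
  ext k l
  simp only [Matrix.map_apply, D_Y, Matrix.add_apply, Matrix.smul_apply, Matrix.single_apply,
    Algebra.algebraMap_eq_smul_one, mul_add, add_smul, eq_comm (a := k), eq_comm (a := l)]
  congr 1 <;> split_ifs <;> simp

theorem single_entry (A B : Matrix (Fin N) (Fin N) m.R) (p q i j : Fin N) :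
    (A * (Matrix.single p q 1 : Matrix (Fin N) (Fin N) m.R) * B) i j = A i p * B q j := by
  rw [Matrix.mul_apply, Finset.sum_eq_single q]
  · simp
  · intro k _ hk
    rw [Matrix.mul_single_apply_of_ne _ _ _ _ _ hk]; simp
  · simp

theorem D_W_apply (a : L) (w : List L) (i j k l : Fin N) :
    m.D a i j (m.W w k l) = (N : ℂ)⁻¹ • splitSum w (fun u b v =>
      g a b • (m.W u k j * m.W v i l) + (ε * g a (τ b)) • (m.W u k i * m.W v j l)) := by
  have h := congrFun (congrFun (m.map_W (m.D a i j) w) k) l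
  have h2 : ∀ f : List L → L → List L → Matrix (Fin N) (Fin N) m.R,
      (splitSum w f) k l = splitSum w (fun u b v => f u b v k l) :=
    fun f => map_splitSum (Matrix.entryAddMonoidHom m.R k l) w f
  rw [Matrix.map_apply, h2] at h
  rw [h, ← splitSum_smul]
  refine splitSum_congr _ fun u b v _ => ?_
  rw [Y_map_D, mul_add, add_mul, Matrix.add_apply]
  simp only [Matrix.mul_smul, Matrix.smul_mul, Matrix.smul_apply, single_entry, smul_add, smul_smul]

/-- Differentiating the letter `b` of `w = u b v` inserts a matrix unit there. Summing over the
indices of `a` closes `u` and `v` into separate traces for the first contraction, and into one trace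
of `u` and the transpose of `v` for the second. -/
theorem sum_D_W (a : L) (w : List L) :
    ∑ i, ∑ j, m.D a i j (m.W w j i) = (N : ℂ)⁻¹ • splitSum w (fun u b v =>
      g a b • (m.T u * m.T v) + (ε * g a (τ b)) • m.T (u ++ transposeWord τ v)) := by
  simp only [D_W_apply, ← Finset.smul_sum, sum_splitSum]
  congr 1
  refine splitSum_congr _ fun u b v _ => ?_
  simp only [Finset.sum_add_distrib, ← Finset.smul_sum]
  congr 1
  · congr 1
    simp only [T, Matrix.trace, Matrix.diag]
    rw [Finset.sum_mul_sum, Finset.sum_comm]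
  -- The matrices of the model are related by transposition only if `ε ≠ 0`. If `ε = 0`, the term is
  -- absent.
  · by_cases hε : ε = 0
    · simp [hε]
    · congr 1
      simp only [T, W_append, m.W_transposeWord hε, Matrix.trace, Matrix.diag, Matrix.mul_apply,
        Matrix.transpose_apply]
      rw [Finset.sum_comm]

/-- Here the contraction joins two different traces. The second trace is opened at `b` and read
cyclically as `v u`, either directly or transposed. -/
theorem sum_mul_D_T (a : L) (x w : List L) :
    ∑ i, ∑ j, m.W x j i * m.D a i j (m.T w) = (N : ℂ)⁻¹ • splitSum w (fun u b v =>
      g a b • m.T (x ++ (v ++ u)) + (ε * g a (τ b)) • m.T (x ++ transposeWord τ (v ++ u))) := by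
  have h : ∀ i j, m.W x j i * m.D a i j (m.T w) = (N : ℂ)⁻¹ • splitSum w (fun u b v =>
      g a b • (m.W x j i * m.W (v ++ u) i j) +
      (ε * g a (τ b)) • (m.W x j i * m.W (v ++ u) j i)) := by
    intro i j
    simp only [T, Matrix.trace, Matrix.diag, map_sum, D_W_apply, ← Finset.smul_sum, sum_splitSum]
    rw [mul_smul_comm, ← splitSum_mul_left]
    congr 1
    refine splitSum_congr _ fun u b v _ => ?_
    simp only [Finset.sum_add_distrib, ← Finset.smul_sum, mul_add, mul_smul_comm, W_append,
      Matrix.mul_apply]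
    congr 3 <;> exact Finset.sum_congr rfl fun k _ => mul_comm _ _
  simp only [h, ← Finset.smul_sum, sum_splitSum]
  congr 1
  refine splitSum_congr _ fun u b v _ => ?_
  simp only [Finset.sum_add_distrib, ← Finset.smul_sum]
  congr 1
  · congr 1
    rw [T, m.W_append x, Matrix.trace, Finset.sum_comm]
    simp [Matrix.mul_apply]
  · by_cases hε : ε = 0
    · simp [hε]
    · congr 1
      rw [T, m.W_append x, m.W_transposeWord hε, Matrix.trace, Finset.sum_comm]
      simp [Matrix.mul_apply]

theorem D_Z (D : Derivation ℂ m.R m.R) (w : List L) : D (m.Z w) = D (m.T w) := by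
  simp [Z]

theorem G_cons (w : List L) (S : List (List L)) : m.G (w :: S) = m.Z w * m.G S := by simp [G]

/-- The loop equation. -/
theorem E_T_cons_mul_G (a : L) (w : List L) (S : List (List L)) :
    m.E (m.T (a :: w) * m.G S) = (N : ℂ)⁻¹ * (
      splitSum w (fun u b v => g a b * m.E (m.T u * m.T v * m.G S) +
        (ε * g a (τ b)) * m.E (m.T (u ++ transposeWord τ v) * m.G S)) +
      splitSum S (fun S₁ x S₂ => splitSum x (fun u b v =>
        g a b * m.E (m.T (w ++ (v ++ u)) * m.G (S₁ ++ S₂)) +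
        (ε * g a (τ b)) * m.E (m.T (w ++ transposeWord τ (v ++ u)) * m.G (S₁ ++ S₂))))) := by
  -- After integration by parts in the first letter, the derivation hits either the rest `w` of the
  -- same trace or one of the centered traces in `S`.
  have h1 : m.E (m.T (a :: w) * m.G S) =
      m.E ((∑ i, ∑ j, m.D a i j (m.W w j i)) * m.G S +
        ∑ i, ∑ j, m.W w j i * m.D a i j (m.G S)) := by
    have : m.T (a :: w) * m.G S = ∑ i, ∑ j, m.Y a i j * (m.W w j i * m.G S) := by
      simp only [T, W_cons, Matrix.trace, Matrix.diag, Matrix.mul_apply, Finset.sum_mul, mul_assoc]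
    rw [this]
    simp only [map_sum, ibp, Derivation.leibniz, smul_eq_mul, Finset.sum_mul, map_add,
      Finset.sum_add_distrib]
    rw [add_comm]
    congr 1
    refine Finset.sum_congr rfl fun i _ => Finset.sum_congr rfl fun j _ => ?_
    rw [mul_comm]
  have h2 : ∑ i, ∑ j, m.W w j i * m.D a i j (m.G S) = (N : ℂ)⁻¹ •
      splitSum S (fun S₁ x S₂ => splitSum x (fun u b v =>
        g a b • (m.T (w ++ (v ++ u)) * m.G (S₁ ++ S₂)) +
        (ε * g a (τ b)) • (m.T (w ++ transposeWord τ (v ++ u)) * m.G (S₁ ++ S₂)))) := by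
    simp only [G, Derivation.list_prod, D_Z, ← splitSum_mul_left, sum_splitSum, ← mul_assoc,
      ← Finset.sum_mul, sum_mul_D_T, smul_mul_assoc, ← splitSum_mul_right, add_mul, splitSum_smul]
  rw [h1, h2, sum_D_W]
  simp only [smul_mul_assoc, ← splitSum_mul_right, add_mul, map_add, map_smul, map_splitSum,
    smul_eq_mul, mul_add]

theorem moment_nil : m.moment [] = 1 := by simp [moment, G, m.E_one]

theorem moment_singleton (w : List L) : m.moment [w] = 0 := by
  simp [moment, G, Z, Algebra.algebraMap_eq_smul_one, m.E_one]

theorem moment_nil_cons (S : List (List L)) : m.moment ([] :: S) = 0 := by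
  have : m.Z [] = 0 := by
    have : m.T [] = (N : ℂ) • (1 : m.R) := by
      simp [T, Matrix.trace_one, Algebra.smul_def]
    rw [Z, this, map_smul, m.E_one, Algebra.smul_def]
    simp
  simp [moment, G, this]

variable (hN : N ≠ 0)
include hN

theorem E_T (w : List L) : m.E (m.T w) = N * m.mean w := by
  have : (N : ℂ) ≠ 0 := by exact_mod_cast hN
  rw [mean]; field_simp

/-- Writing each trace as `N` times its mean plus its centered part makes the powers of `N`
explicit. -/
theorem E_T_mul_G (w : List L) (S : List (List L)) :
    m.E (m.T w * m.G S) = N * m.mean w * m.moment S + m.moment (w :: S) := by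
  have : m.T w * m.G S = (N * m.mean w) • m.G S + m.G (w :: S) := by
    rw [G_cons, Z, m.E_T hN, Algebra.smul_def]; ring
  rw [this, map_add, map_smul]; rfl

theorem E_T_mul_T_mul_G (u v : List L) (S : List (List L)) :
    m.E (m.T u * m.T v * m.G S) = N ^ 2 * m.mean u * m.mean v * m.moment S +
      N * m.mean u * m.moment (v :: S) + N * m.mean v * m.moment (u :: S) +
      m.moment (u :: v :: S) := by
  have : m.T u * m.T v * m.G S = (N * m.mean u) • (m.T v * m.G S) +
      (N * m.mean v) • m.G (u :: S) + m.G (u :: v :: S) := by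
    simp only [G_cons]
    rw [Z, Z, m.E_T hN, m.E_T hN, Algebra.smul_def, Algebra.smul_def]; ring
  rw [this, map_add, map_add, map_smul, map_smul, m.E_T_mul_G hN]
  simp only [smul_eq_mul, moment]
  ring

theorem mean_nil : m.mean [] = 1 := by
  have : (N : ℂ) ≠ 0 := by exact_mod_cast hN
  have h : m.T [] = (N : ℂ) • (1 : m.R) := by
    simp [T, Matrix.trace_one, Algebra.smul_def]
  rw [mean, h, map_smul, m.E_one]
  simp [this]

/-- The loop equation without further traces, divided by `N`. The fluctuations enter at order `N⁻²`
and the transposed contraction at order `N⁻¹`. -/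
theorem mean_cons (a : L) (w : List L) :
    m.mean (a :: w) = splitSum w (fun u b v =>
      g a b * (m.mean u * m.mean v + (N : ℂ)⁻¹ ^ 2 * m.moment [u, v]) +
      (ε * g a (τ b)) * ((N : ℂ)⁻¹ * m.mean (u ++ transposeWord τ v))) := by
  have h0 : (N : ℂ) ≠ 0 := by exact_mod_cast hN
  have h := m.E_T_cons_mul_G a w []
  simp only [m.E_T_mul_G hN, m.E_T_mul_T_mul_G hN, moment_nil, moment_singleton, splitSum_nil,
    add_zero, mul_one, mul_zero] at h
  rw [← mul_right_inj' h0, h, ← splitSum_mul_left, ← splitSum_mul_left]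
  refine splitSum_congr _ fun u b v _ => ?_
  field_simp

/-- The loop equation for `a :: w` with the traces `S`, minus `N` times the equation for the mean
multiplied by the moment of `S`. The subtraction cancels the terms of order `N` and the mean of the
glued word, so no positive power of `N` remains. -/
theorem moment_cons_cons (a : L) (w : List L) (S : List (List L)) :
    m.moment ((a :: w) :: S) =
      splitSum w (fun u b v =>
        g a b * (m.mean u * m.moment (v :: S) + m.mean v * m.moment (u :: S) +
          (N : ℂ)⁻¹ * (m.moment (u :: v :: S) - m.moment [u, v] * m.moment S)) +
        (ε * g a (τ b)) * ((N : ℂ)⁻¹ * m.moment ((u ++ transposeWord τ v) :: S))) +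
      splitSum S (fun S₁ x S₂ => splitSum x (fun u b v =>
        g a b * (m.mean (w ++ (v ++ u)) * m.moment (S₁ ++ S₂) +
          (N : ℂ)⁻¹ * m.moment ((w ++ (v ++ u)) :: (S₁ ++ S₂))) +
        (ε * g a (τ b)) * (m.mean (w ++ transposeWord τ (v ++ u)) * m.moment (S₁ ++ S₂) +
          (N : ℂ)⁻¹ * m.moment ((w ++ transposeWord τ (v ++ u)) :: (S₁ ++ S₂))))) := by
  have h0 : (N : ℂ) ≠ 0 := by exact_mod_cast hN
  have h := m.E_T_cons_mul_G a w S
  rw [m.E_T_mul_G hN, m.mean_cons hN] at h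
  rw [← eq_sub_iff_add_eq'] at h
  rw [h, mul_add, add_sub_right_comm]
  simp only [← splitSum_mul_left, m.E_T_mul_G hN, m.E_T_mul_T_mul_G hN]
  rw [← splitSum_mul_right, ← splitSum_sub]
  congr 1
  · refine splitSum_congr _ fun u b v _ => ?_
    field_simp
    ring
  · refine splitSum_congr _ fun S₁ x S₂ _ => splitSum_congr _ fun u b v _ => ?_
    field_simp

end LoopModel

end Elliptic
end

noncomputable section
namespace Elliptic

/-! ### Large `N` limits in the loop models -/

section Limits

variable {L : Type*} {τ : L → L} {g : L → L → ℂ} {ε : ℂ} (m : ∀ N, LoopModel τ g ε N)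

theorem tendsto_inv_natCast_complex : Tendsto (fun N : ℕ => (N : ℂ)⁻¹) atTop (𝓝 0) :=
  tendsto_inv_atTop_nhds_zero_nat

/-- The total length of a list of words. -/
def totalLength (S : List (List L)) : ℕ := (S.map List.length).sum

@[simp] theorem totalLength_nil : totalLength ([] : List (List L)) = 0 := rfl

@[simp] theorem totalLength_cons (w : List L) (S : List (List L)) :
    totalLength (w :: S) = w.length + totalLength S := by simp [totalLength]

@[simp] theorem totalLength_append (S S' : List (List L)) :
    totalLength (S ++ S') = totalLength S + totalLength S' := by simp [totalLength]

@[simp] theorem length_transposeWord (w : List L) : (transposeWord τ w).length = w.length := by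
  simp [transposeWord]

/-- All words on the right of the finite `N` recursion have total length at most that of `w`, so the
bounded hypotheses suffice. Everything except the product of two means carries a factor `N⁻¹`. -/
theorem mean_step {a : L} {w : List L} {A : List L → ℂ} {M : List (List L) → ℂ}
    (hA : ∀ v, v.length ≤ w.length → Tendsto (fun N => (m N).mean v) atTop (𝓝 (A v)))
    (hM : ∀ S, totalLength S ≤ w.length → Tendsto (fun N => (m N).moment S) atTop (𝓝 (M S))) :
    Tendsto (fun N => (m N).mean (a :: w)) atTop
      (𝓝 (splitSum w (fun u b v => g a b * (A u * A v)))) := by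
  have h : ∀ᶠ N in atTop, splitSum w (fun u b v =>
      g a b * ((m N).mean u * (m N).mean v + (N : ℂ)⁻¹ ^ 2 * (m N).moment [u, v]) +
      (ε * g a (τ b)) * ((N : ℂ)⁻¹ * (m N).mean (u ++ transposeWord τ v))) =
      (m N).mean (a :: w) := by
    filter_upwards [eventually_ne_atTop 0] with N hN
    rw [(m N).mean_cons hN]
  refine Tendsto.congr' h (tendsto_splitSum w fun u b v hw => ?_)
  have hl : w.length = u.length + (v.length + 1) := by simp [hw]
  have hN := tendsto_inv_natCast_complex
  have := (((hA u (by omega)).mul (hA v (by omega))).add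
    ((hN.pow 2).mul (hM [u, v] (by simp; omega)))).const_mul (g a b)
  have := this.add ((hN.mul (hA (u ++ transposeWord τ v) (by simp; omega))).const_mul
    (ε * g a (τ b)))
  simpa using this

theorem moment_step {a : L} {w : List L} {S : List (List L)} {A : List L → ℂ}
    {M : List (List L) → ℂ}
    (hA : ∀ v, v.length ≤ w.length + totalLength S →
      Tendsto (fun N => (m N).mean v) atTop (𝓝 (A v)))
    (hM : ∀ S', totalLength S' ≤ w.length + totalLength S →
      Tendsto (fun N => (m N).moment S') atTop (𝓝 (M S'))) :
    Tendsto (fun N => (m N).moment ((a :: w) :: S)) atTop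
      (𝓝 (splitSum w (fun u b v => g a b * (A u * M (v :: S) + A v * M (u :: S))) +
        splitSum S (fun S₁ x S₂ => splitSum x (fun u b v =>
          g a b * A (w ++ (v ++ u)) + ε * g a (τ b) * A (w ++ transposeWord τ (v ++ u))) *
          M (S₁ ++ S₂)))) := by
  have hN := tendsto_inv_natCast_complex
  refine Tendsto.congr' ((eventually_ne_atTop 0).mono
    fun N hN => ((m N).moment_cons_cons hN a w S).symm) ((tendsto_splitSum w fun u b v hw => ?_).add
    (tendsto_splitSum S fun S₁ x S₂ hS => ?_))
  · have hl : w.length = u.length + (v.length + 1) := by simp [hw]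
    have h1 := ((hA u (by omega)).mul (hM (v :: S) (by simp; omega))).add
      ((hA v (by omega)).mul (hM (u :: S) (by simp; omega)))
    have h2 := hN.mul ((hM (u :: v :: S) (by simp; omega)).sub
      ((hM [u, v] (by simp; omega)).mul (hM S (by omega))))
    have h3 := hN.mul (hM ((u ++ transposeWord τ v) :: S) (by simp; omega))
    have := ((h1.add h2).const_mul (g a b)).add (h3.const_mul (ε * g a (τ b)))
    simpa using this
  · rw [← splitSum_mul_right]
    refine tendsto_splitSum x fun u b v hx => ?_
    have hl : x.length = u.length + (v.length + 1) := by simp [hx]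
    have hl' : totalLength S = totalLength S₁ + (x.length + totalLength S₂) := by simp [hS]
    have h0 := hM (S₁ ++ S₂) (by simp; omega)
    have h1 := ((hA (w ++ (v ++ u)) (by simp; omega)).mul h0).add
      (hN.mul (hM ((w ++ (v ++ u)) :: (S₁ ++ S₂)) (by simp; omega)))
    have h2 := ((hA (w ++ transposeWord τ (v ++ u)) (by simp; omega)).mul h0).add
      (hN.mul (hM ((w ++ transposeWord τ (v ++ u)) :: (S₁ ++ S₂)) (by simp; omega)))
    have := (h1.const_mul (g a b)).add (h2.const_mul (ε * g a (τ b)))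
    convert this using 2
    ring

/-- Means and moments have to be treated together, by induction on the total length: each recursion
contains both kinds of quantities, but only at smaller total length. Limits chosen beyond the range
of the induction hypothesis are arbitrary and are never used. -/
theorem exists_limits (n : ℕ) :
    (∀ w : List L, w.length ≤ n → ∃ l, Tendsto (fun N => (m N).mean w) atTop (𝓝 l)) ∧
    (∀ S : List (List L), totalLength S ≤ n →
      ∃ l, Tendsto (fun N => (m N).moment S) atTop (𝓝 l)) := by
  induction n with
  | zero =>
    constructor
    · intro w hw
      obtain rfl : w = [] := by simpa using hw
      refine ⟨1, tendsto_const_nhds.congr' ?_⟩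
      filter_upwards [eventually_ne_atTop 0] with N hN
      exact ((m N).mean_nil hN).symm
    · rintro (_ | ⟨w, S⟩) hS
      · exact ⟨1, by simp [LoopModel.moment_nil]⟩
      · obtain rfl : w = [] := by
          rw [totalLength_cons] at hS
          exact List.length_eq_zero_iff.1 (by omega)
        exact ⟨0, by simp [LoopModel.moment_nil_cons]⟩
  | succ n ih =>
    obtain ⟨ih1, ih2⟩ := ih
    choose! A hA using ih1
    choose! M hM using ih2
    constructor
    · rintro (_ | ⟨a, w⟩) hw
      · exact ⟨_, hA [] (by simp)⟩
      · have hwn : w.length ≤ n := by simpa using hw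
        exact ⟨_, mean_step m (fun v hv => hA v (hv.trans hwn)) fun S hS => hM S (hS.trans hwn)⟩
    · rintro (_ | ⟨_ | ⟨a, w⟩, S⟩) hS
      · exact ⟨1, by simp [LoopModel.moment_nil]⟩
      · exact ⟨0, by simp [LoopModel.moment_nil_cons]⟩
      · have hw' : w.length + totalLength S ≤ n := by
          simp at hS; omega
        exact ⟨_, moment_step m (fun v hv => hA v (hv.trans hw')) fun S hS => hM S (hS.trans hw')⟩

/-- The limit of the normalized expected trace of a word. -/
def meanLim (w : List L) : ℂ := ((exists_limits m w.length).1 w le_rfl).choose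

theorem tendsto_meanLim (w : List L) :
    Tendsto (fun N => (m N).mean w) atTop (𝓝 (meanLim m w)) :=
  ((exists_limits m w.length).1 w le_rfl).choose_spec

/-- The limit of the joint moment of the centered traces of several words. -/
def momentLim (S : List (List L)) : ℂ := ((exists_limits m (totalLength S)).2 S le_rfl).choose

theorem tendsto_momentLim (S : List (List L)) :
    Tendsto (fun N => (m N).moment S) atTop (𝓝 (momentLim m S)) :=
  ((exists_limits m (totalLength S)).2 S le_rfl).choose_spec

theorem meanLim_nil : meanLim m [] = 1 := by
  refine tendsto_nhds_unique (tendsto_meanLim m []) (tendsto_const_nhds.congr' ?_)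
  filter_upwards [eventually_ne_atTop 0] with N hN
  exact ((m N).mean_nil hN).symm

theorem meanLim_cons (a : L) (w : List L) :
    meanLim m (a :: w) = splitSum w (fun u b v => g a b * (meanLim m u * meanLim m v)) :=
  tendsto_nhds_unique (tendsto_meanLim m _)
    (mean_step m (fun v _ => tendsto_meanLim m v) fun S _ => tendsto_momentLim m S)

theorem momentLim_nil : momentLim m [] = 1 :=
  tendsto_nhds_unique (tendsto_momentLim m _) (by simp [LoopModel.moment_nil])

theorem momentLim_nil_cons (S : List (List L)) : momentLim m ([] :: S) = 0 :=
  tendsto_nhds_unique (tendsto_momentLim m _) (by simp [LoopModel.moment_nil_cons])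

theorem momentLim_cons_cons (a : L) (w : List L) (S : List (List L)) :
    momentLim m ((a :: w) :: S) =
      splitSum w (fun u b v => g a b * (meanLim m u * momentLim m (v :: S) +
        meanLim m v * momentLim m (u :: S))) +
      splitSum S (fun S₁ x S₂ => splitSum x (fun u b v =>
        g a b * meanLim m (w ++ (v ++ u)) +
        ε * g a (τ b) * meanLim m (w ++ transposeWord τ (v ++ u))) * momentLim m (S₁ ++ S₂)) :=
  tendsto_nhds_unique (tendsto_momentLim m _)
    (moment_step m (fun v _ => tendsto_meanLim m v) fun S _ => tendsto_momentLim m S)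

theorem momentLim_pair (a : L) (w x : List L) :
    momentLim m [a :: w, x] =
      splitSum w (fun u b v => g a b * (meanLim m u * momentLim m [v, x] +
        meanLim m v * momentLim m [u, x])) +
      splitSum x (fun u b v => g a b * meanLim m (w ++ (v ++ u)) +
        ε * g a (τ b) * meanLim m (w ++ transposeWord τ (v ++ u))) := by
  rw [momentLim_cons_cons, splitSum_cons]
  simp [momentLim_nil]

/-- The limiting joint moments obey the Wick recursion. -/
theorem momentLim_wick (w : List L) (S : List (List L)) :
    momentLim m (w :: S) =
      splitSum S (fun S₁ x S₂ => momentLim m [w, x] * momentLim m (S₁ ++ S₂)) := by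
  induction hn : w.length using Nat.strong_induction_on generalizing w with
  | _ n ih =>
    rcases w with _ | ⟨a, w⟩
    · simp [momentLim_nil_cons, splitSum_zero]
    -- Both sides satisfy the same linear recursion in the first word. The source terms agree, and
    -- the remaining terms contain only the shorter words `u` and `v`.
    · rw [momentLim_cons_cons]
      simp only [momentLim_pair, add_mul]
      rw [splitSum_add]
      congr 1
      simp only [← splitSum_mul_right]
      rw [splitSum, splitSum]
      simp only [splitSum, Finset.sum_comm (s := (Finset.univ : Finset (Fin S.length)))]
      refine Finset.sum_congr rfl fun p _ => ?_
      have e : w = w.take p ++ w.get p :: w.drop (p + 1) := by simp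
      have hl := congrArg List.length e
      simp only [List.length_append, List.length_cons] at hl hn
      rw [ih _ (by omega) (w.take p) rfl, ih _ (by omega) (w.drop (p + 1)) rfl, splitSum, splitSum]
      rw [Finset.mul_sum, Finset.mul_sum, ← Finset.sum_add_distrib, Finset.mul_sum]
      exact Finset.sum_congr rfl fun q _ => by ring

end Limits

end Elliptic
end

noncomputable section
namespace Elliptic

/-! ### Freeness from the loop equations -/

open scoped TensorProduct

section Pair

variable {A : Type*} [Ring A] [Algebra ℂ A]

/-- The functional `u ⊗ v ↦ f u * h v`. -/
def tensorPair (f h : A →ₗ[ℂ] ℂ) : A ⊗[ℂ] A →ₗ[ℂ] ℂ :=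
  LinearMap.mul' ℂ ℂ ∘ₗ TensorProduct.map f h

@[simp] theorem tensorPair_tmul (f h : A →ₗ[ℂ] ℂ) (u v : A) :
    tensorPair f h (u ⊗ₜ v) = f u * h v := by simp [tensorPair]

variable (A) in
/-- The linear map `u ⊗ v ↦ v * u`. -/
def flipMul : A ⊗[ℂ] A →ₗ[ℂ] A :=
  LinearMap.mul' ℂ A ∘ₗ (TensorProduct.comm ℂ A A).toLinearMap

@[simp] theorem flipMul_tmul (u v : A) : flipMul A (u ⊗ₜ v) = v * u := by simp [flipMul]

end Pair

/-- Free difference quotients on an algebra `A` with respect to elements `x a`, where the letter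
`b` is weighted by `g a b`, and a tracial functional satisfying the Schwinger-Dyson equations. The
weights vanish between letters of different colors. -/
structure FreeLoopState {A L I : Type*} [Ring A] [Algebra ℂ A] (x : L → A) (col : L → I)
    (g : L → L → ℂ) where
  D : L → A →ₗ[ℂ] A ⊗[ℂ] A
  D_mul : ∀ a P Q, D a (P * Q) = D a P * (1 ⊗ₜ Q) + (P ⊗ₜ 1) * D a Q
  D_x : ∀ a b, D a (x b) = g a b • 1
  g_eq_zero : ∀ a b, col a ≠ col b → g a b = 0
  α : A →ₗ[ℂ] ℂ
  α_one : α 1 = 1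
  α_comm : ∀ P Q, α (P * Q) = α (Q * P)
  α_x_mul : ∀ a P, α (x a * P) = tensorPair α α (D a P)

namespace FreeLoopState

variable {A L I : Type*} [Ring A] [Algebra ℂ A] {x : L → A} {col : L → I}
  {g : L → L → ℂ} (s : FreeLoopState x col g)

/-- The subalgebra generated by the letters of color `c`. -/
def colorAlg (x : L → A) (col : L → I) (c : I) : Subalgebra ℂ A :=
  Algebra.adjoin ℂ (x '' {a | col a = c})

/-- The product of the letters of a word. -/
def word (x : L → A) (w : List L) : A := (w.map x).prod

@[simp] theorem word_nil : word x [] = 1 := rfl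

theorem word_cons (a : L) (w : List L) : word x (a :: w) = x a * word x w := by simp [word]

theorem word_append (w w' : List L) : word x (w ++ w') = word x w * word x w' := by simp [word]

theorem word_mem_colorAlg {c : I} {w : List L} (hw : ∀ a ∈ w, col a = c) :
    word x w ∈ colorAlg x col c := by
  refine Subalgebra.list_prod_mem _ fun y hy => ?_
  obtain ⟨a, ha, rfl⟩ := List.mem_map.1 hy
  exact Algebra.subset_adjoin ⟨a, hw a ha, rfl⟩

/-- The color algebra is spanned by the words in its letters, so a linear identity on it can be
proved by induction on words. -/
theorem eq_zero_of_words {M : Type*} [AddCommMonoid M] [Module ℂ M] {c : I} (f : A →ₗ[ℂ] M)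
    (hf : ∀ w : List L, (∀ a ∈ w, col a = c) → f (word x w) = 0) {P : A}
    (hP : P ∈ colorAlg x col c) : f P = 0 := by
  have hP' : P ∈ Subalgebra.toSubmodule (colorAlg x col c) := hP
  rw [colorAlg, Algebra.adjoin_eq_span] at hP'
  have : Submodule.span ℂ (Submonoid.closure (x '' {a | col a = c}) : Set A) ≤ LinearMap.ker f := by
    rw [Submodule.span_le]
    intro y hy
    obtain ⟨l, hl, rfl⟩ := Submonoid.exists_list_of_mem_closure hy
    have : ∃ w : List L, (∀ a ∈ w, col a = c) ∧ w.map x = l := by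
      clear hy
      induction l with
      | nil => exact ⟨[], by simp⟩
      | cons y l ih =>
        obtain ⟨w, hw, hwl⟩ := ih fun z hz => hl z (List.mem_cons_of_mem _ hz)
        obtain ⟨a, ha, hay⟩ := hl y List.mem_cons_self
        exact ⟨a :: w, by simpa using ⟨ha, hw⟩, by simp [hwl, hay]⟩
    obtain ⟨w, hw, rfl⟩ := this
    exact hf w hw
  exact this hP'

theorem leibniz_one {D : A →ₗ[ℂ] A ⊗[ℂ] A}
    (hD : ∀ P Q, D (P * Q) = D P * (1 ⊗ₜ Q) + (P ⊗ₜ 1) * D Q) : D 1 = 0 := by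
  have h := hD 1 1
  rw [mul_one, ← Algebra.TensorProduct.one_def, mul_one, one_mul] at h
  simpa using h

theorem leibniz_word {D : A →ₗ[ℂ] A ⊗[ℂ] A} {h : L → ℂ}
    (hD : ∀ P Q, D (P * Q) = D P * (1 ⊗ₜ Q) + (P ⊗ₜ 1) * D Q) (hx : ∀ b, D (x b) = h b • 1)
    (w : List L) :
    D (word x w) = splitSum w (fun u b v => h b • (word x u ⊗ₜ[ℂ] word x v)) := by
  induction w with
  | nil => simp [leibniz_one hD]
  | cons b w ih =>
    rw [word_cons, hD, hx, ih, splitSum_cons, ← splitSum_mul_left]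
    congr 1
    · simp
    · refine splitSum_congr _ fun u b v _ => ?_
      simp [word_cons]

theorem D_one (a : L) : s.D a 1 = 0 := leibniz_one (s.D_mul a)

theorem D_word (a : L) (w : List L) :
    s.D a (word x w) = splitSum w (fun u b v => g a b • (word x u ⊗ₜ[ℂ] word x v)) :=
  leibniz_word (s.D_mul a) (s.D_x a) w

/-- No letter of color `c` has a nonzero weight against `a`. This is the only way in which the
separation of colors enters freeness. -/
theorem D_eq_zero {a : L} {c : I} (ha : col a ≠ c) {P : A} (hP : P ∈ colorAlg x col c) :
    s.D a P = 0 := by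
  refine eq_zero_of_words (s.D a) (fun w hw => ?_) hP
  rw [s.D_word, ← splitSum_zero w]
  refine splitSum_congr _ fun u b v h => ?_
  rw [s.g_eq_zero a b, zero_smul]
  rw [hw b (by simp [h])]
  exact ha

/-- Differentiating a word of color `c` cuts it into two words of color `c`. Hence `s.D a P` is a
combination of tensors of elements of that color algebra, and two functionals need to be compared
only there. -/
theorem apply_D_eq_of_tmul {M : Type*} [AddCommGroup M] [Module ℂ M] (a : L) {c : I}
    {f h : A ⊗[ℂ] A →ₗ[ℂ] M}
    (H : ∀ u ∈ colorAlg x col c, ∀ v ∈ colorAlg x col c, f (u ⊗ₜ v) = h (u ⊗ₜ v))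
    {P : A} (hP : P ∈ colorAlg x col c) : f (s.D a P) = h (s.D a P) := by
  rw [← sub_eq_zero]
  refine eq_zero_of_words ((f - h) ∘ₗ s.D a) (fun w hw => ?_) hP
  rw [LinearMap.comp_apply, s.D_word, map_splitSum, ← splitSum_zero w]
  refine splitSum_congr _ fun u b v e => ?_
  rw [map_smul, LinearMap.sub_apply, H, sub_self, smul_zero]
  · exact word_mem_colorAlg fun a ha => hw a (by simp [e, ha])
  · exact word_mem_colorAlg fun a ha => hw a (by simp [e, ha])

/-- The product of the elements of a list of colored elements. -/
def lprod (l : List (I × A)) : A := (l.map Prod.snd).prod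

@[simp] theorem lprod_nil : lprod ([] : List (I × A)) = 1 := rfl

@[simp] theorem lprod_cons (p : I × A) (l : List (I × A)) :
    lprod (p :: l) = p.2 * lprod l := by simp [lprod]

@[simp] theorem lprod_append (l l' : List (I × A)) :
    lprod (l ++ l') = lprod l * lprod l' := by simp [lprod]

/-- A list of centered elements of the color algebras, neighbours having different colors. -/
def Good (l : List (I × A)) : Prop :=
  l.IsChain (fun p q => p.1 ≠ q.1) ∧ ∀ p ∈ l, p.2 ∈ colorAlg x col p.1 ∧ s.α p.2 = 0

/-- The first element of a list has a color different from `c`. -/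
def HeadNe (c : I) (l : List (I × A)) : Prop := ∀ p ∈ l.head?, p.1 ≠ c

/-- The last element of a list has a color different from `c`. -/
def LastNe (c : I) (l : List (I × A)) : Prop := ∀ p ∈ l.getLast?, p.1 ≠ c

theorem good_append {l l' : List (I × A)} :
    s.Good (l ++ l') ↔ s.Good l ∧ s.Good l' ∧ ∀ p ∈ l.getLast?, ∀ q ∈ l'.head?, p.1 ≠ q.1 := by
  simp only [Good, List.isChain_append, List.mem_append]
  constructor
  · rintro ⟨⟨h1, h2, h3⟩, h4⟩
    exact ⟨⟨h1, fun p hp => h4 p (.inl hp)⟩, ⟨h2, fun p hp => h4 p (.inr hp)⟩, h3⟩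
  · rintro ⟨⟨h1, h4⟩, ⟨h2, h5⟩, h3⟩
    exact ⟨⟨h1, h2, h3⟩, fun p hp => hp.elim (h4 p) (h5 p)⟩

theorem good_cons {p : I × A} {l : List (I × A)} :
    s.Good (p :: l) ↔ (p.2 ∈ colorAlg x col p.1 ∧ s.α p.2 = 0) ∧ s.Good l ∧ HeadNe p.1 l := by
  have := s.good_append (l := [p]) (l' := l)
  rw [List.singleton_append] at this
  rw [this]
  have h1 : s.Good [p] ↔ p.2 ∈ colorAlg x col p.1 ∧ s.α p.2 = 0 := by simp [Good]
  rw [h1]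
  refine and_congr Iff.rfl (and_congr Iff.rfl ?_)
  simp [HeadNe, ne_comm]

theorem good_nil : s.Good [] := by simp [Good]

/-- The centered version of an element. -/
def center (P : A) : A := P - algebraMap ℂ A (s.α P)

theorem center_mem {c : I} {P : A} (hP : P ∈ colorAlg x col c) :
    s.center P ∈ colorAlg x col c := sub_mem hP (Subalgebra.algebraMap_mem _ _)

theorem α_center (P : A) : s.α (s.center P) = 0 := by
  simp [center, Algebra.algebraMap_eq_smul_one, s.α_one]

theorem eq_center_add (P : A) : P = s.center P + s.α P • 1 := by
  simp [center, Algebra.algebraMap_eq_smul_one]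

theorem D_lprod (a : L) (l : List (I × A)) :
    s.D a (lprod l) = splitSum l (fun l₁ p l₂ =>
      (lprod l₁ ⊗ₜ 1) * (s.D a p.2 * (1 ⊗ₜ lprod l₂))) := by
  induction l with
  | nil => simp [s.D_one]
  | cons p l ih =>
    rw [lprod_cons, s.D_mul, ih, splitSum_cons, ← splitSum_mul_left]
    congr 1
    · simp [← Algebra.TensorProduct.one_def]
    · refine splitSum_congr _ fun l₁ q l₂ _ => ?_
      rw [← mul_assoc]
      simp

/-- The core of freeness, by induction on the length of `l` and, inside it, on the length of `z`.
The Schwinger-Dyson equation for the first letter of `z` either cuts `z`, leaving a shorter word in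
front of `l`, or cuts a factor of color `c`. In the second case the part `l₁` of `l` before the cut
is nonempty, since the head of `l` has another color, and by traciality it yields a trace of the
same form with a shorter list. -/
theorem α_word_mul_lprod (n : ℕ) (l : List (I × A)) (hn : l.length ≤ n) (hl : s.Good l)
    (hne : l ≠ []) (c : I) (hc : HeadNe c l) (z : List L) (hz : ∀ a ∈ z, col a = c) :
    s.α (word x z * lprod l) = 0 := by
  induction n generalizing l c z with
  | zero => exact absurd (List.length_eq_zero_iff.1 (Nat.le_zero.1 hn)) hne
  | succ n ih =>
    -- By linearity the word in front of the shorter list may be any element of the color algebra.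
    -- With an empty `z` this absorbs the first factor of `l` as the new element in front.
    have ih' : ∀ (l : List (I × A)), l.length ≤ n → s.Good l → l ≠ [] → ∀ c, HeadNe c l →
        ∀ P ∈ colorAlg x col c, s.α (P * lprod l) = 0 := by
      intro l hln hl hne c hc P hP
      exact eq_zero_of_words (s.α ∘ₗ LinearMap.mulRight ℂ (lprod l))
        (fun w hw => ih l hln hl hne c hc w hw) hP
    induction hk : z.length using Nat.strong_induction_on generalizing z with
    | _ k ihz =>
      rcases z with _ | ⟨a, w⟩
      · rcases l with _ | ⟨p, l⟩
        · exact absurd rfl hne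
        · obtain ⟨hp, hl', hh⟩ := s.good_cons.1 hl
          rw [word_nil, one_mul, lprod_cons]
          rcases eq_or_ne l [] with rfl | hne'
          · simpa using hp.2
          · exact ih' l (by simpa using hn) hl' hne' p.1 hh p.2 hp.1
      · have hac : col a = c := hz a List.mem_cons_self
        have hw : ∀ b ∈ w, col b = c := fun b hb => hz b (List.mem_cons_of_mem _ hb)
        rw [word_cons, mul_assoc, s.α_x_mul, s.D_mul, map_add, s.D_word, s.D_lprod,
          ← splitSum_mul_right, ← splitSum_mul_left, map_splitSum, map_splitSum]
        convert add_zero (0 : ℂ) using 2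
        · rw [← splitSum_zero w]
          refine splitSum_congr _ fun u b v e => ?_
          have hv := ihz v.length (by simp [e] at hk; omega) v
            (fun a ha => hw a (by simp [e, ha])) rfl
          simp [hv]
        · rw [← splitSum_zero l]
          refine splitSum_congr _ fun l₁ p l₂ e => ?_
          by_cases hpc : p.1 = c
          swap
          · rw [s.D_eq_zero (c := p.1) (by rw [hac]; exact Ne.symm hpc)
              (hl.2 p (by simp [e])).1]
            simp
          have hl₁ : l₁ ≠ [] := by
            rintro rfl
            exact hc p (by simp [e]) hpc
          have hgood := hl
          rw [e, s.good_append] at hgood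
          have hh : HeadNe c l₁ := by
            intro q hq
            refine hc q ?_
            rw [e]
            simp at hq ⊢
            simp [hq]
          have key := s.apply_D_eq_of_tmul (c := c) a
            (f := tensorPair s.α s.α ∘ₗ LinearMap.mulLeft ℂ ((word x w * lprod l₁) ⊗ₜ 1) ∘ₗ
              LinearMap.mulRight ℂ (1 ⊗ₜ lprod l₂)) (h := 0) (P := p.2) ?_
            (hpc ▸ (hl.2 p (by simp [e])).1)
          · simpa [mul_assoc, ← mul_assoc (word x w ⊗ₜ[ℂ] (1 : A))] using key
          · intro u hu v hv
            have : s.α (word x w * lprod l₁ * u) = 0 := by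
              rw [s.α_comm, ← mul_assoc]
              exact ih' l₁ (by simp [e] at hn; omega) hgood.1 hl₁ c hh _
                (mul_mem hu (word_mem_colorAlg hw))
            simp [this]

theorem α_mul_lprod {l : List (I × A)} (hl : s.Good l) (hne : l ≠ []) {c : I} (hc : HeadNe c l)
    {P : A} (hP : P ∈ colorAlg x col c) : s.α (P * lprod l) = 0 :=
  eq_zero_of_words (s.α ∘ₗ LinearMap.mulRight ℂ (lprod l))
    (fun w hw => s.α_word_mul_lprod l.length l le_rfl hl hne c hc w hw) hP

/-- The algebras generated by the letters of the different colors are free. -/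
theorem α_lprod {l : List (I × A)} (hl : s.Good l) (hne : l ≠ []) : s.α (lprod l) = 0 := by
  rcases l with _ | ⟨p, l⟩
  · exact absurd rfl hne
  · obtain ⟨hp, hl', hh⟩ := s.good_cons.1 hl
    rw [lprod_cons]
    rcases eq_or_ne l [] with rfl | hne'
    · simpa using hp.2
    · exact s.α_mul_lprod hl' hne' hh hp.1

theorem α_mul_lprod_mul {l : List (I × A)} (hl : s.Good l) (hne : l ≠ []) {c : I}
    (hc : HeadNe c l) {P Q : A} (hP : P ∈ colorAlg x col c) (hQ : Q ∈ colorAlg x col c) :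
    s.α (P * lprod l * Q) = 0 := by
  rw [s.α_comm, ← mul_assoc]
  exact s.α_mul_lprod hl hne hc (mul_mem hQ hP)

/-- The product of the `α (p * r)` over matching elements of two lists of the same length. -/
def spoke : List (I × A) → List (I × A) → ℂ
  | [], [] => 1
  | p :: P, r :: R => s.α (p.2 * r.2) * spoke P R
  | _, _ => 0

/-- The two innermost factors meet. If their colors agree, the centered part of their product
completes an alternating word of trace zero, and its scalar part passes to the next pair. If the
colors differ, the whole product is alternating and its trace vanishes, as does `α (p.2 * r.2)`. -/
theorem α_lprod_reverse_mul_lprod (P R : List (I × A)) (hP : s.Good P.reverse) (hR : s.Good R) :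
    s.α (lprod P.reverse * lprod R) = s.spoke P R := by
  induction P generalizing R with
  | nil =>
    rcases R with _ | ⟨r, R⟩
    · simp [spoke, s.α_one]
    · simpa [spoke] using s.α_lprod hR (by simp)
  | cons p P ih =>
    rcases R with _ | ⟨r, R⟩
    · have := s.α_lprod hP (by simp)
      simpa [spoke] using this
    · rw [List.reverse_cons, s.good_append] at hP
      obtain ⟨hP', hp, hpP⟩ := hP
      obtain ⟨hr, hR', hrR⟩ := s.good_cons.1 hR
      rw [s.good_cons] at hp
      rw [spoke]
      by_cases h : p.1 = r.1
      · have hmem : p.2 * r.2 ∈ colorAlg x col p.1 := mul_mem hp.1.1 (h ▸ hr.1)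
        have hgood : s.Good (P.reverse ++ (p.1, s.center (p.2 * r.2)) :: R) := by
          rw [s.good_append, s.good_cons]
          refine ⟨hP', ⟨⟨s.center_mem hmem, s.α_center _⟩, hR', ?_⟩, ?_⟩
          · rw [h]; exact hrR
          · intro q hq t ht
            simp at ht
            subst ht
            exact hpP q hq p (by simp)
        have h0 := s.α_lprod hgood (by simp)
        rw [← ih R hP' hR']
        have e : lprod (p :: P).reverse * lprod (r :: R) =
            lprod (P.reverse ++ (p.1, s.center (p.2 * r.2)) :: R) +
              s.α (p.2 * r.2) • (lprod P.reverse * lprod R) := by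
          have e1 : lprod (p :: P).reverse * lprod (r :: R) =
              lprod P.reverse * ((p.2 * r.2) * lprod R) := by
            simp [mul_assoc]
          rw [e1]
          conv_lhs => rw [s.eq_center_add (p.2 * r.2)]
          simp [add_mul, mul_add]
        rw [e, map_add, h0, map_smul, zero_add, smul_eq_mul]
      · have h1 : s.α (p.2 * r.2) = 0 := by
          have : s.Good [p, r] := by
            rw [s.good_cons, s.good_cons]
            exact ⟨hp.1, ⟨hr, s.good_nil, by simp [HeadNe]⟩, by simpa [HeadNe] using Ne.symm h⟩
          simpa using s.α_lprod this (by simp)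
        rw [h1, zero_mul, ← lprod_append]
        refine s.α_lprod ?_ (by simp)
        rw [List.reverse_cons, s.good_append, s.good_append, s.good_cons]
        exact ⟨⟨hP', hp, hpP⟩, hR, by simpa using h⟩

/-- Split `B` and `C` into centered parts and scalars. As soon as one centered part remains, the
product is alternating, after a rotation in one case, and has trace zero. Only the scalars times `α
(lprod P * lprod R)` survive. -/
theorem α_mul_lprod_mul_mul_lprod {c : I} {P R : List (I × A)} (hP : s.Good P) (hPne : P ≠ [])
    (hPh : HeadNe c P) (hPl : LastNe c P) (hR : s.Good R) (hRh : HeadNe c R) (hRl : LastNe c R)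
    {B C : A} (hB : B ∈ colorAlg x col c) (hC : C ∈ colorAlg x col c) :
    s.α (B * lprod P * C * lprod R) = s.α B * s.α C * s.spoke P.reverse R := by
  have hc : ∀ {B : A}, B ∈ colorAlg x col c →
      (((c, s.center B) : I × A).2 ∈ colorAlg x col ((c, s.center B) : I × A).1 ∧
        s.α ((c, s.center B) : I × A).2 = 0) := fun h => ⟨s.center_mem h, s.α_center _⟩
  have hCR : s.Good ((c, s.center C) :: R) := s.good_cons.2 ⟨hc hC, hR, hRh⟩
  have hPCR : s.Good (P ++ (c, s.center C) :: R) :=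
    s.good_append.2 ⟨hP, hCR, fun p hp q hq => by simp at hq; subst hq; exact hPl p hp⟩
  have h1 : s.α (s.center B * lprod P * s.center C * lprod R) = 0 := by
    have : s.Good ((c, s.center B) :: (P ++ (c, s.center C) :: R)) := by
      refine s.good_cons.2 ⟨hc hB, hPCR, ?_⟩
      obtain ⟨p, P', rfl⟩ := List.exists_cons_of_ne_nil hPne
      simpa [HeadNe] using hPh
    simpa [mul_assoc] using s.α_lprod this (by simp)
  have h2 : s.α (s.center B * lprod P * lprod R) = 0 := by
    have : s.Good (R ++ (c, s.center B) :: P) :=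
      s.good_append.2 ⟨hR, s.good_cons.2 ⟨hc hB, hP, hPh⟩,
        fun p hp q hq => by simp at hq; subst hq; exact hRl p hp⟩
    rw [s.α_comm]
    simpa [mul_assoc] using s.α_lprod this (by simp)
  have h3 : s.α (lprod P * s.center C * lprod R) = 0 := by
    simpa [mul_assoc] using s.α_lprod hPCR (by simp)
  have h4 : s.α (lprod P * lprod R) = s.spoke P.reverse R := by
    have := s.α_lprod_reverse_mul_lprod P.reverse R (by simpa using hP) hR
    simpa using this
  have e : B * lprod P * C * lprod R = s.center B * lprod P * s.center C * lprod R +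
      s.α C • (s.center B * lprod P * lprod R) + s.α B • (lprod P * s.center C * lprod R) +
      (s.α B * s.α C) • (lprod P * lprod R) := by
    conv_lhs => rw [s.eq_center_add B, s.eq_center_add C]
    simp only [add_mul, mul_add, smul_mul_assoc, mul_smul_comm, one_mul, mul_one, smul_smul,
      smul_add]
    rw [mul_comm (s.α C)]
    abel
  rw [e]
  simp [h1, h2, h3, h4]

/-! ### Second order freeness from the loop equations -/

/-- The cyclic derivative. -/
def K (a : L) (Q : A) : A := flipMul A (s.D a Q)

/-- If `f` solves the inhomogeneous loop equation with the source `κ`, then its values at cyclically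
alternating products are determined by the first factor. -/
theorem secondOrder_of_source {f Λ : A →ₗ[ℂ] ℂ} {κ : L → A}
    (hf : ∀ a P, f (x a * P) =
      tensorPair s.α f (s.D a P) + tensorPair f s.α (s.D a P) + s.α (P * κ a))
    {c : I} {P : List (I × A)} (hP : s.Good P) (hPne : P ≠ []) (hPh : HeadNe c P)
    (hPl : LastNe c P) (hΛ1 : Λ 1 = 0)
    (hΛ : ∀ a w, col a = c → (∀ b ∈ w, col b = c) → Λ (x a * word x w) =
      tensorPair s.α Λ (s.D a (word x w)) + s.α (word x w * lprod P * κ a))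
    {P₁ : A} (hP₁ : P₁ ∈ colorAlg x col c) (hP₁0 : s.α P₁ = 0) : f (P₁ * lprod P) = Λ P₁ := by
  -- For uncentered words the term `α(z) f(lprod P)` is subtracted. The difference vanishes at the
  -- empty word and obeys the recursion of `Λ`, because `α` itself satisfies the Schwinger-Dyson
  -- equation.
  suffices H : ∀ z : List L, (∀ a ∈ z, col a = c) →
      f (word x z * lprod P) - s.α (word x z) * f (lprod P) = Λ (word x z) by
    have := eq_zero_of_words (f ∘ₗ LinearMap.mulRight ℂ (lprod P) - f (lprod P) • s.α - Λ)
      (fun w hw => by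
        have := H w hw
        simp only [LinearMap.sub_apply, LinearMap.comp_apply, LinearMap.mulRight_apply,
          LinearMap.smul_apply, smul_eq_mul]
        rw [← this]; ring) hP₁
    simp only [LinearMap.sub_apply, LinearMap.comp_apply, LinearMap.mulRight_apply,
      LinearMap.smul_apply, hP₁0, smul_zero, sub_zero] at this
    exact sub_eq_zero.1 this
  intro z hz
  induction hk : z.length using Nat.strong_induction_on generalizing z with
  | _ k ih =>
    rcases z with _ | ⟨a, w⟩
    · simp [s.α_one, hΛ1]
    · have hac : col a = c := hz a List.mem_cons_self
      have hw : ∀ b ∈ w, col b = c := fun b hb => hz b (List.mem_cons_of_mem _ hb)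
      -- A cut inside a factor `p` of `P` contributes nothing. Both neighbouring lists `l₁` and `l₂`
      -- are nonempty because the end colors of `P` differ from `c`, so whichever leg carries `α`
      -- has trace zero by freeness.
      have hmid : ∀ l₁ p l₂, P = l₁ ++ p :: l₂ →
          tensorPair s.α f ((word x w ⊗ₜ 1) * ((lprod l₁ ⊗ₜ 1) * (s.D a p.2 * (1 ⊗ₜ lprod l₂)))) = 0
          ∧ tensorPair f s.α
            ((word x w ⊗ₜ 1) * ((lprod l₁ ⊗ₜ 1) * (s.D a p.2 * (1 ⊗ₜ lprod l₂)))) = 0 := by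
        intro l₁ p l₂ e
        by_cases hpc : p.1 = c
        swap
        · rw [s.D_eq_zero (c := p.1) (by rw [hac]; exact Ne.symm hpc)
            (hP.2 p (by simp [e])).1]
          simp
        have hgood := hP
        rw [e, s.good_append, s.good_cons] at hgood
        have hl₁ : l₁ ≠ [] := by
          rintro rfl
          exact hPh p (by simp [e]) hpc
        have hl₂ : l₂ ≠ [] := by
          rintro rfl
          exact hPl p (by simp [e]) hpc
        have hh : HeadNe c l₁ := by
          intro q hq
          refine hPh q ?_
          rw [e]
          simp at hq ⊢
          simp [hq]
        have hmem : p.2 ∈ colorAlg x col c := hpc ▸ (hP.2 p (by simp [e])).1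
        constructor
        · have key := s.apply_D_eq_of_tmul (c := c) a
            (f := tensorPair s.α f ∘ₗ LinearMap.mulLeft ℂ ((word x w * lprod l₁) ⊗ₜ 1) ∘ₗ
              LinearMap.mulRight ℂ (1 ⊗ₜ lprod l₂)) (h := 0) (P := p.2) ?_ hmem
          · simpa [mul_assoc, ← mul_assoc (word x w ⊗ₜ[ℂ] (1 : A))] using key
          · intro u hu v hv
            have := s.α_mul_lprod_mul hgood.1 hl₁ hh (word_mem_colorAlg hw) hu
            simp [this]
        · have key := s.apply_D_eq_of_tmul (c := c) a
            (f := tensorPair f s.α ∘ₗ LinearMap.mulLeft ℂ ((word x w * lprod l₁) ⊗ₜ 1) ∘ₗ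
              LinearMap.mulRight ℂ (1 ⊗ₜ lprod l₂)) (h := 0) (P := p.2) ?_ hmem
          · simpa [mul_assoc, ← mul_assoc (word x w ⊗ₜ[ℂ] (1 : A))] using key
          · intro u hu v hv
            have := s.α_mul_lprod hgood.2.1.2.1 hl₂ (hpc ▸ hgood.2.1.2.2) hv
            simp [this]
      have e1 : f (word x (a :: w) * lprod P) =
          splitSum w (fun u b v => g a b * (s.α (word x u) * f (word x v * lprod P))) +
            s.α (word x w * lprod P * κ a) := by
        rw [word_cons, mul_assoc, hf, s.D_mul, s.D_word, s.D_lprod, ← splitSum_mul_right,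
          ← splitSum_mul_left]
        simp only [map_add, map_splitSum]
        rw [splitSum_congr P (fun l₁ p l₂ e => (hmid l₁ p l₂ e).1),
          splitSum_congr P (fun l₁ p l₂ e => (hmid l₁ p l₂ e).2), splitSum_zero, add_zero, add_zero]
        congr 1
        rw [← splitSum_add]
        refine splitSum_congr _ fun u b v e => ?_
        have := s.α_mul_lprod hP hPne hPh (P := word x v)
          (word_mem_colorAlg fun a ha => hw a (by simp [e, ha]))
        simp [this]
      have e2 : s.α (word x (a :: w)) =
          splitSum w (fun u b v => g a b * (s.α (word x u) * s.α (word x v))) := by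
        rw [word_cons, s.α_x_mul, s.D_word, map_splitSum]
        simp
      rw [e1, e2, word_cons, hΛ a w hac hw, add_sub_right_comm, ← splitSum_mul_right,
        ← splitSum_sub, s.D_word, map_splitSum]
      congr 1
      refine splitSum_congr _ fun u b v e => ?_
      have := ih v.length (by simp [e] at hk; omega) v (fun a ha => hw a (by simp [e, ha])) rfl
      rw [map_smul, tensorPair_tmul, ← this, smul_eq_mul]
      ring

/-- The sum over all ways of pairing the list `z :: P` with the rotations of `Q` in opposite
order, as a linear functional of `z`. -/
def spokeSum (P Q : List (I × A)) : A →ₗ[ℂ] ℂ :=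
  splitSum Q (fun l₁ q l₂ => s.spoke P.reverse (l₂ ++ l₁) • (s.α ∘ₗ LinearMap.mulRight ℂ q.2))

theorem spokeSum_apply (P Q : List (I × A)) (z : A) :
    s.spokeSum P Q z =
      splitSum Q (fun l₁ q l₂ => s.spoke P.reverse (l₂ ++ l₁) * s.α (z * q.2)) := by
  have := map_splitSum (LinearMap.applyₗ (R := ℂ) (M₂ := ℂ) z) Q (fun l₁ q l₂ =>
    s.spoke P.reverse (l₂ ++ l₁) • (s.α ∘ₗ LinearMap.mulRight ℂ q.2))
  simpa [spokeSum] using this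

/-- A cyclically alternating list of centered elements. -/
def CycGood (Q : List (I × A)) : Prop :=
  s.Good Q ∧ (2 ≤ Q.length → ∀ p ∈ Q.getLast?, ∀ q ∈ Q.head?, p.1 ≠ q.1)

/-- Opening the cycle at `q` and removing `q` leaves an alternating list whose ends, if it is
nonempty, are neighbours of `q`. -/
theorem CycGood.rotate {Q l₁ l₂ : List (I × A)} {q : I × A} (hQ : s.CycGood Q)
    (e : Q = l₁ ++ q :: l₂) :
    s.Good (l₂ ++ l₁) ∧ HeadNe q.1 (l₂ ++ l₁) ∧ LastNe q.1 (l₂ ++ l₁) := by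
  obtain ⟨h1, h2⟩ := hQ
  subst e
  obtain ⟨g1, g2, g3⟩ := s.good_append.1 h1
  obtain ⟨g4, g5, g6⟩ := s.good_cons.1 g2
  have hlast : LastNe q.1 l₁ := fun p hp => g3 p hp q (by simp)
  refine ⟨s.good_append.2 ⟨g5, g1, ?_⟩, ?_, ?_⟩
  · intro p hp t ht
    rcases l₁ with _ | ⟨y, l₁⟩
    · simp at ht
    refine h2 (by simp; omega) p ?_ t (by simpa using ht)
    rw [List.getLast?_append, List.getLast?_cons]
    rw [Option.mem_def] at hp
    simp [hp]
  · rcases l₂ with _ | ⟨y, l₂⟩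
    · rcases l₁ with _ | ⟨y, l₁⟩
      · simp [HeadNe]
      · intro p hp
        exact (h2 (by simp) q (by rw [List.getLast?_append]; simp) p (by simpa using hp)).symm
    · simpa [HeadNe] using g6
  · rcases List.eq_nil_or_concat l₁ with rfl | ⟨l₁, y, rfl⟩
    · rcases List.eq_nil_or_concat l₂ with rfl | ⟨l₂, y, rfl⟩
      · simp [LastNe]
      · intro p hp
        exact h2 (by simp) p (by simpa [List.getLast?_append, List.getLast?_cons] using hp) q
          (by simp)
    · intro p hp
      exact hlast p (by simpa [List.getLast?_append] using hp)

theorem spokeSum_one {P Q : List (I × A)} (hQ : s.CycGood Q) : s.spokeSum P Q 1 = 0 := by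
  rw [spokeSum_apply, ← splitSum_zero Q]
  refine splitSum_congr _ fun l₁ q l₂ e => ?_
  rw [one_mul, (hQ.1.2 q (by simp [e])).2, mul_zero]

/-- The sum over rotations obeys the recursion required of `Λ`. In `α(x_a w q)` the derivative of
`w` gives the homogeneous part. The derivative of `q` gives the source, since `K` applied to `lprod
Q` is a sum of cycles opened inside a factor `q`, and `α_mul_lprod_mul_mul_lprod` evaluates each of
them after a rotation. -/
theorem spokeSum_x_mul {P Q : List (I × A)} {c : I} (hP : s.Good P) (hPne : P ≠ [])
    (hPh : HeadNe c P) (hPl : LastNe c P) (hQ : s.CycGood Q) {a : L} {w : List L}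
    (hac : col a = c) (hw : ∀ b ∈ w, col b = c) :
    s.spokeSum P Q (x a * word x w) =
      tensorPair s.α (s.spokeSum P Q) (s.D a (word x w)) +
        s.α (word x w * lprod P * s.K a (lprod Q)) := by
  have h1 : ∀ t : A ⊗[ℂ] A, tensorPair s.α (s.spokeSum P Q) t =
      splitSum Q (fun l₁ q l₂ => s.spoke P.reverse (l₂ ++ l₁) *
        tensorPair s.α s.α (t * (1 ⊗ₜ q.2))) := by
    intro t
    induction t using TensorProduct.induction_on with
    | zero => simp [splitSum_zero]
    | tmul u v =>
      rw [tensorPair_tmul, spokeSum_apply, ← splitSum_mul_left]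
      refine splitSum_congr _ fun l₁ q l₂ _ => ?_
      simp; ring
    | add t t' ht ht' =>
      rw [map_add, ht, ht', ← splitSum_add]
      refine splitSum_congr _ fun l₁ q l₂ _ => ?_
      rw [add_mul, map_add, mul_add]
  rw [h1, K, s.D_lprod, map_splitSum, ← splitSum_mul_left, map_splitSum, ← splitSum_add,
    spokeSum_apply]
  refine splitSum_congr _ fun l₁ q l₂ e => ?_
  rw [mul_assoc, s.α_x_mul, s.D_mul, map_add, mul_add]
  congr 1
  have hq := (hQ.1.2 q (by simp [e])).1
  by_cases hqc : q.1 = c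
  swap
  · rw [s.D_eq_zero (by rw [hac]; exact Ne.symm hqc) hq]
    simp
  obtain ⟨hR, hRh, hRl⟩ := CycGood.rotate s hQ e
  rw [hqc] at hRh hRl hq
  have key := s.apply_D_eq_of_tmul (c := c) a
    (f := s.spoke P.reverse (l₂ ++ l₁) • tensorPair s.α s.α ∘ₗ
      LinearMap.mulLeft ℂ (word x w ⊗ₜ 1))
    (h := s.α ∘ₗ LinearMap.mulLeft ℂ (word x w * lprod P) ∘ₗ flipMul A ∘ₗ
      LinearMap.mulLeft ℂ (lprod l₁ ⊗ₜ 1) ∘ₗ LinearMap.mulRight ℂ (1 ⊗ₜ lprod l₂)) ?_ hq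
  · simpa [mul_assoc] using key
  · intro u hu v hv
    have := s.α_mul_lprod_mul_mul_lprod hP hPne hPh hPl hR hRh hRl
      (mul_mem hu (word_mem_colorAlg hw)) hv
    simp only [LinearMap.smul_apply, LinearMap.comp_apply, LinearMap.mulLeft_apply,
      LinearMap.mulRight_apply, Algebra.TensorProduct.tmul_mul_tmul, tensorPair_tmul,
      flipMul_tmul, one_mul, mul_one, smul_eq_mul]
    rw [s.α_comm (word x w) u, mul_comm (s.spoke _ _), ← this, lprod_append]
    rw [show word x w * lprod P * (v * lprod l₂ * (lprod l₁ * u)) =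
      (word x w * lprod P * (v * lprod l₂ * lprod l₁)) * u by simp only [mul_assoc],
      s.α_comm _ u]
    simp only [mul_assoc]

/-- The covariance functional on cyclically alternating products of centered elements. -/
theorem secondOrder {f : A →ₗ[ℂ] ℂ} {ε : ℂ} {Q Q' : List (I × A)} (hQ : s.CycGood Q)
    (hQ' : s.CycGood Q')
    (hf : ∀ a P, f (x a * P) = tensorPair s.α f (s.D a P) + tensorPair f s.α (s.D a P) +
      s.α (P * (s.K a (lprod Q) + ε • s.K a (lprod Q'))))
    {p : I × A} {P : List (I × A)} (hP : s.CycGood (p :: P)) (hPne : P ≠ []) :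
    f (lprod (p :: P)) = s.spokeSum P Q p.2 + ε * s.spokeSum P Q' p.2 := by
  obtain ⟨hp, hP', hh⟩ := s.good_cons.1 hP.1
  have hPl : LastNe p.1 P := by
    obtain ⟨_, _, h⟩ := CycGood.rotate s hP (l₁ := []) rfl
    simpa using h
  rw [lprod_cons]
  -- The source is linear, so the candidate solution is the sum of the solutions for `Q` and for
  -- `Q'`.
  refine s.secondOrder_of_source (Λ := s.spokeSum P Q + ε • s.spokeSum P Q') hf hP' hPne hh hPl
    ?_ ?_ hp.1 hp.2
  · simp [s.spokeSum_one hQ, s.spokeSum_one hQ']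
  · intro a w hac hw
    have h1 : tensorPair s.α (s.spokeSum P Q + ε • s.spokeSum P Q') =
        tensorPair s.α (s.spokeSum P Q) + ε • tensorPair s.α (s.spokeSum P Q') := by
      ext u v; simp; ring
    rw [h1]
    simp only [LinearMap.add_apply, LinearMap.smul_apply, smul_eq_mul, mul_add, map_add,
      mul_smul_comm, map_smul]
    rw [s.spokeSum_x_mul hP' hPne hh hPl hQ hac hw, s.spokeSum_x_mul hP' hPne hh hPl hQ' hac hw]
    ring

end FreeLoopState

end Elliptic
end

noncomputable section
namespace Elliptic

/-! ### The limit functionals on the free algebra -/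

open scoped TensorProduct
open FreeLoopState (word word_cons word_nil word_append leibniz_word)

section FreeAlg

variable {L : Type*}

theorem basisFreeMonoid_eq_word (w : FreeMonoid L) :
    FreeAlgebra.basisFreeMonoid ℂ L w = word (FreeAlgebra.ι ℂ) (FreeMonoid.toList w) := by
  have h : FreeAlgebra.basisFreeMonoid ℂ L w = MonoidAlgebra.lift ℂ (FreeAlgebra ℂ L)
      (FreeMonoid L) (FreeMonoid.lift (FreeAlgebra.ι ℂ)) (MonoidAlgebra.single w 1) := by
    simp only [FreeAlgebra.basisFreeMonoid, Module.Basis.map_apply, Finsupp.coe_basisSingleOne]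
    rfl
  rw [h, MonoidAlgebra.lift_single, one_smul, FreeMonoid.lift_apply]
  rfl

/-- The basis of the free algebra formed by the words. -/
def wordBasis (L : Type*) : Module.Basis (List L) ℂ (FreeAlgebra ℂ L) :=
  (FreeAlgebra.basisFreeMonoid ℂ L).reindex FreeMonoid.toList

theorem wordBasis_apply (w : List L) : wordBasis L w = word (FreeAlgebra.ι ℂ) w := by
  simp [wordBasis, basisFreeMonoid_eq_word]

theorem linearMap_ext_words {M : Type*} [AddCommGroup M] [Module ℂ M]
    {f h : FreeAlgebra ℂ L →ₗ[ℂ] M}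
    (H : ∀ w, f (word (FreeAlgebra.ι ℂ) w) = h (word (FreeAlgebra.ι ℂ) w)) : f = h :=
  (wordBasis L).ext fun w => by rw [wordBasis_apply, H]

/-- The representation by upper triangular matrices whose corner is a free difference quotient. -/
def diffRep (h : L → ℂ) : FreeAlgebra ℂ L →ₐ[ℂ]
    Matrix (Fin 2) (Fin 2) (FreeAlgebra ℂ L ⊗[ℂ] FreeAlgebra ℂ L) :=
  FreeAlgebra.lift ℂ fun b =>
    !![FreeAlgebra.ι ℂ b ⊗ₜ 1, h b • 1; 0, 1 ⊗ₜ FreeAlgebra.ι ℂ b]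

theorem diffRep_diag (h : L → ℂ) (P : FreeAlgebra ℂ L) :
    diffRep h P 0 0 = P ⊗ₜ 1 ∧ diffRep h P 1 0 = 0 ∧ diffRep h P 1 1 = 1 ⊗ₜ P := by
  induction P using FreeAlgebra.induction with
  | grade0 r =>
    rw [AlgHom.commutes]
    refine ⟨?_, ?_, ?_⟩
    · simp [Matrix.algebraMap_matrix_apply, Algebra.TensorProduct.algebraMap_apply]
    · simp [Matrix.algebraMap_matrix_apply]
    · rw [Matrix.algebraMap_matrix_apply, if_pos rfl, Algebra.TensorProduct.algebraMap_apply']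
  | grade1 b => simp [diffRep]
  | mul P Q hP hQ =>
    simp only [map_mul, Matrix.mul_apply, Fin.sum_univ_two, hP, hQ]
    simp
  | add P Q hP hQ =>
    simp only [map_add, Matrix.add_apply, hP, hQ]
    simp [TensorProduct.add_tmul, TensorProduct.tmul_add]

/-- The free difference quotient with respect to all letters, the letter `b` having weight
`h b`. -/
def freeDiff (h : L → ℂ) : FreeAlgebra ℂ L →ₗ[ℂ] FreeAlgebra ℂ L ⊗[ℂ] FreeAlgebra ℂ L :=
  Matrix.entryLinearMap ℂ _ 0 1 ∘ₗ (diffRep h).toLinearMap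

/-- The corner entry of a product of two upper triangular matrices is the Leibniz rule, with the
actions on the two tensor legs on the diagonal. -/
theorem freeDiff_mul (h : L → ℂ) (P Q : FreeAlgebra ℂ L) :
    freeDiff h (P * Q) = freeDiff h P * (1 ⊗ₜ Q) + (P ⊗ₜ 1) * freeDiff h Q := by
  have e : ∀ P, freeDiff h P = diffRep h P 0 1 := fun P => rfl
  rw [e, map_mul, Matrix.mul_apply, Fin.sum_univ_two, (diffRep_diag h P).1,
    (diffRep_diag h Q).2.2, e, e, add_comm]

theorem freeDiff_ι (h : L → ℂ) (b : L) : freeDiff h (FreeAlgebra.ι ℂ b) = h b • 1 := by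
  simp [freeDiff, diffRep]

/-- The linear antiautomorphism of the free algebra that acts by `τ` on the letters. -/
def transposePoly (τ : L → L) : FreeAlgebra ℂ L →ₗ[ℂ] FreeAlgebra ℂ L :=
  (MulOpposite.opLinearEquiv ℂ).symm.toLinearMap ∘ₗ
    (FreeAlgebra.lift ℂ (fun b => MulOpposite.op (FreeAlgebra.ι ℂ (τ b)))).toLinearMap

theorem transposePoly_mul (τ : L → L) (P Q : FreeAlgebra ℂ L) :
    transposePoly τ (P * Q) = transposePoly τ Q * transposePoly τ P := by
  simp [transposePoly]

theorem transposePoly_ι (τ : L → L) (b : L) :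
    transposePoly τ (FreeAlgebra.ι ℂ b) = FreeAlgebra.ι ℂ (τ b) := by
  simp [transposePoly]

theorem transposePoly_one (τ : L → L) : transposePoly τ 1 = 1 := by
  simp [transposePoly]

theorem transposePoly_word (τ : L → L) (w : List L) :
    transposePoly τ (word (FreeAlgebra.ι ℂ) w) =
      word (FreeAlgebra.ι ℂ) (transposeWord τ w) := by
  induction w with
  | nil => simp [transposePoly_one, transposeWord]
  | cons a w ih =>
    have : transposeWord τ (a :: w) = transposeWord τ w ++ [τ a] := by simp [transposeWord]
    rw [word_cons, transposePoly_mul, ih, this, word_append, transposePoly_ι]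
    simp [word]

end FreeAlg

section LimitFunctionals

variable {L : Type*} {τ : L → L} {g : L → L → ℂ} {ε : ℂ}

/-- The value of a non-commutative polynomial at the matrices of a loop model. -/
def LoopModel.eval {N : ℕ} (m : LoopModel τ g ε N) :
    FreeAlgebra ℂ L →ₐ[ℂ] Matrix (Fin N) (Fin N) m.R := FreeAlgebra.lift ℂ m.Y

theorem LoopModel.eval_word {N : ℕ} (m : LoopModel τ g ε N) (w : List L) :
    m.eval (word (FreeAlgebra.ι ℂ) w) = m.W w := by
  simp [LoopModel.eval, word, LoopModel.W, map_list_prod, Function.comp_def]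

/-- The trace of a non-commutative polynomial. -/
def LoopModel.tr {N : ℕ} (m : LoopModel τ g ε N) : FreeAlgebra ℂ L →ₗ[ℂ] m.R :=
  Matrix.traceLinearMap (Fin N) ℂ m.R ∘ₗ m.eval.toLinearMap

theorem LoopModel.tr_apply {N : ℕ} (m : LoopModel τ g ε N) (P : FreeAlgebra ℂ L) :
    m.tr P = (m.eval P).trace := rfl

theorem LoopModel.tr_word {N : ℕ} (m : LoopModel τ g ε N) (w : List L) :
    m.tr (word (FreeAlgebra.ι ℂ) w) = m.T w := by
  rw [LoopModel.tr_apply, LoopModel.eval_word, LoopModel.T]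

theorem LoopModel.tr_mul_comm {N : ℕ} (m : LoopModel τ g ε N) (P Q : FreeAlgebra ℂ L) :
    m.tr (P * Q) = m.tr (Q * P) := by
  rw [LoopModel.tr_apply, LoopModel.tr_apply, map_mul, map_mul, Matrix.trace_mul_comm]

/-- The centered trace of a non-commutative polynomial. -/
def LoopModel.ctr {N : ℕ} (m : LoopModel τ g ε N) : FreeAlgebra ℂ L →ₗ[ℂ] m.R :=
  m.tr - Algebra.linearMap ℂ m.R ∘ₗ m.E ∘ₗ m.tr

theorem LoopModel.ctr_apply {N : ℕ} (m : LoopModel τ g ε N) (P : FreeAlgebra ℂ L) :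
    m.ctr P = m.tr P - algebraMap ℂ m.R (m.E (m.tr P)) := rfl

theorem LoopModel.ctr_word {N : ℕ} (m : LoopModel τ g ε N) (w : List L) :
    m.ctr (word (FreeAlgebra.ι ℂ) w) = m.Z w := by
  rw [LoopModel.ctr_apply, LoopModel.tr_word, LoopModel.Z]

theorem LoopModel.E_ctr_mul_ctr {N : ℕ} (m : LoopModel τ g ε N) (P Q : FreeAlgebra ℂ L) :
    m.E (m.ctr P * m.ctr Q) = m.E (m.tr P * m.tr Q) - m.E (m.tr P) * m.E (m.tr Q) := by
  have : m.ctr P * m.ctr Q = m.tr P * m.tr Q - m.E (m.tr P) • m.tr Q - m.E (m.tr Q) • m.tr P +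
      (m.E (m.tr P) * m.E (m.tr Q)) • 1 := by
    rw [m.ctr_apply, m.ctr_apply]
    simp only [Algebra.smul_def, map_mul]
    ring
  rw [this]
  simp only [map_add, map_sub, map_smul, m.E_one, smul_eq_mul]
  ring

variable (m : ∀ N, LoopModel τ g ε N)

/-- The limit of the normalized expected trace. -/
def limMean : FreeAlgebra ℂ L →ₗ[ℂ] ℂ := (wordBasis L).constr ℂ (meanLim m)

theorem limMean_word (w : List L) :
    limMean m (word (FreeAlgebra.ι ℂ) w) = meanLim m w := by
  rw [← wordBasis_apply, limMean, Module.Basis.constr_basis]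

/-- The limit of the covariance of traces. -/
def limCov : FreeAlgebra ℂ L →ₗ[ℂ] FreeAlgebra ℂ L →ₗ[ℂ] ℂ :=
  (wordBasis L).constr ℂ fun w => (wordBasis L).constr ℂ fun x => momentLim m [w, x]

theorem limCov_word (w x : List L) :
    limCov m (word (FreeAlgebra.ι ℂ) w) (word (FreeAlgebra.ι ℂ) x) = momentLim m [w, x] := by
  rw [← wordBasis_apply, ← wordBasis_apply, limCov, Module.Basis.constr_basis,
    Module.Basis.constr_basis]

theorem word_induction {p : FreeAlgebra ℂ L → Prop} (hw : ∀ w, p (word (FreeAlgebra.ι ℂ) w))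
    (hadd : ∀ P Q, p P → p Q → p (P + Q)) (hsmul : ∀ (c : ℂ) P, p P → p (c • P))
    (P : FreeAlgebra ℂ L) : p P := by
  have h := (wordBasis L).mem_span P
  induction h using Submodule.span_induction with
  | mem y hy =>
    obtain ⟨w, rfl⟩ := hy
    rw [wordBasis_apply]; exact hw w
  | zero => simpa using hsmul 0 _ (hw [])
  | add P Q _ _ hP hQ => exact hadd P Q hP hQ
  | smul c P _ hP => exact hsmul c P hP

theorem tendsto_limMean (P : FreeAlgebra ℂ L) :
    Tendsto (fun N : ℕ => (N : ℂ)⁻¹ * (m N).E ((m N).tr P)) atTop (𝓝 (limMean m P)) := by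
  induction P using word_induction with
  | hw w =>
    rw [limMean_word]
    simp only [LoopModel.tr_word]
    exact tendsto_meanLim m w
  | hadd P Q hP hQ => simpa [mul_add] using hP.add hQ
  | hsmul c P hP => simpa [mul_left_comm] using hP.const_mul c

theorem tendsto_limCov (P Q : FreeAlgebra ℂ L) :
    Tendsto (fun N => (m N).E ((m N).ctr P * (m N).ctr Q)) atTop (𝓝 (limCov m P Q)) := by
  induction P using word_induction with
  | hw w =>
    induction Q using word_induction with
    | hw x =>
      rw [limCov_word]
      simp only [LoopModel.ctr_word]
      simpa [LoopModel.moment, LoopModel.G] using tendsto_momentLim m [w, x]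
    | hadd P Q hP hQ => simpa [mul_add] using hP.add hQ
    | hsmul c P hP => simpa [mul_left_comm] using hP.const_mul c
  | hadd P Q hP hQ => simpa [add_mul] using hP.add hQ
  | hsmul c P hP => simpa [mul_left_comm] using hP.const_mul c

theorem limMean_one : limMean m 1 = 1 := by
  rw [← word_nil (x := FreeAlgebra.ι ℂ), limMean_word, meanLim_nil]

theorem limMean_mul_comm (P Q : FreeAlgebra ℂ L) : limMean m (P * Q) = limMean m (Q * P) :=
  tendsto_nhds_unique (tendsto_limMean m _) (by
    simpa only [LoopModel.tr_mul_comm _ P Q] using tendsto_limMean m (Q * P))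

theorem limCov_mul_comm_left (P Q R : FreeAlgebra ℂ L) :
    limCov m (P * Q) R = limCov m (Q * P) R :=
  tendsto_nhds_unique (tendsto_limCov m _ _) (by
    simpa only [LoopModel.ctr_apply, LoopModel.tr_mul_comm _ P Q] using tendsto_limCov m (Q * P) R)

theorem limCov_symm (P Q : FreeAlgebra ℂ L) : limCov m P Q = limCov m Q P :=
  tendsto_nhds_unique (tendsto_limCov m _ _) (by
    simpa only [mul_comm] using tendsto_limCov m Q P)

theorem limCov_one_left (P : FreeAlgebra ℂ L) : limCov m 1 P = 0 := by
  have : limCov m 1 = 0 := by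
    refine linearMap_ext_words fun w => ?_
    rw [← word_nil (x := FreeAlgebra.ι ℂ), limCov_word, momentLim_nil_cons]
    simp
  simp [this]

theorem limMean_ι_mul (a : L) (P : FreeAlgebra ℂ L) :
    limMean m (FreeAlgebra.ι ℂ a * P) =
      tensorPair (limMean m) (limMean m) (freeDiff (g a) P) := by
  have : limMean m ∘ₗ LinearMap.mulLeft ℂ (FreeAlgebra.ι ℂ a) =
      tensorPair (limMean m) (limMean m) ∘ₗ freeDiff (g a) := by
    refine linearMap_ext_words fun w => ?_
    rw [LinearMap.comp_apply, LinearMap.mulLeft_apply, ← word_cons, limMean_word, meanLim_cons,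
      LinearMap.comp_apply, leibniz_word (freeDiff_mul _) (freeDiff_ι _), map_splitSum]
    simp [limMean_word]
  exact LinearMap.congr_fun this P

/-- The limiting recursion for pairs of words in terms of difference quotients. Cutting `P` gives
the linearized Schwinger-Dyson equation in the first argument; joining with `Q` or its transpose
gives the cyclic derivatives. -/
theorem limCov_ι_mul (a : L) (P Q : FreeAlgebra ℂ L) :
    limCov m (FreeAlgebra.ι ℂ a * P) Q =
      tensorPair (limMean m) ((limCov m).flip Q) (freeDiff (g a) P) +
      tensorPair ((limCov m).flip Q) (limMean m) (freeDiff (g a) P) +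
      limMean m (P * (flipMul _ (freeDiff (g a) Q) +
        ε • flipMul _ (freeDiff (g a) (transposePoly τ Q)))) := by
  induction Q using word_induction with
  | hw x =>
    have : (limCov m).flip (word (FreeAlgebra.ι ℂ) x) ∘ₗ
        LinearMap.mulLeft ℂ (FreeAlgebra.ι ℂ a) =
        tensorPair (limMean m) ((limCov m).flip (word (FreeAlgebra.ι ℂ) x)) ∘ₗ freeDiff (g a) +
        tensorPair ((limCov m).flip (word (FreeAlgebra.ι ℂ) x)) (limMean m) ∘ₗ freeDiff (g a) +
        limMean m ∘ₗ LinearMap.mulRight ℂ (flipMul _ (freeDiff (g a) (word (FreeAlgebra.ι ℂ) x)) +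
          ε • flipMul _ (freeDiff (g a) (transposePoly τ (word (FreeAlgebra.ι ℂ) x)))) := by
      refine linearMap_ext_words fun w => ?_
      simp only [LinearMap.comp_apply, LinearMap.mulLeft_apply, LinearMap.add_apply,
        LinearMap.mulRight_apply, LinearMap.flip_apply]
      rw [← word_cons, limCov_word, momentLim_pair, transposePoly_word]
      simp only [leibniz_word (freeDiff_mul _) (freeDiff_ι _), map_splitSum]
      -- The splittings of the transposed word are rewritten as splittings of `x`. A cut at `τ b`
      -- then becomes a cut at `b` of weight `g a (τ b)`, with the two pieces transposed and
      -- exchanged.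
      rw [← splitSum_add, mul_add, map_add, ← splitSum_mul_left, mul_smul_comm,
        ← splitSum_mul_left, map_smul, map_splitSum, map_splitSum, ← splitSum_smul, transposeWord,
        splitSum_reverse, splitSum_map, ← splitSum_add]
      congr 1
      · refine splitSum_congr _ fun u b v _ => ?_
        simp [limMean_word, limCov_word]
        ring
      · refine splitSum_congr _ fun u b v _ => ?_
        simp only [map_smul, flipMul_tmul, mul_smul_comm, ← word_append, limMean_word,
          smul_eq_mul, transposeWord, List.map_append, List.reverse_append, mul_assoc]
    exact LinearMap.congr_fun this P
  | hadd Q Q' h h' =>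
    have e1 : tensorPair (limMean m) ((limCov m).flip (Q + Q')) =
        tensorPair (limMean m) ((limCov m).flip Q) +
        tensorPair (limMean m) ((limCov m).flip Q') := by
      ext u v; simp [mul_add]
    have e2 : tensorPair ((limCov m).flip (Q + Q')) (limMean m) =
        tensorPair ((limCov m).flip Q) (limMean m) +
        tensorPair ((limCov m).flip Q') (limMean m) := by
      ext u v; simp [add_mul]
    rw [map_add, h, h', e1, e2]
    simp only [map_add, LinearMap.add_apply, smul_add, mul_add]
    ring
  | hsmul c Q h =>
    have e1 : tensorPair (limMean m) ((limCov m).flip (c • Q)) =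
        c • tensorPair (limMean m) ((limCov m).flip Q) := by
      ext u v; simp [mul_left_comm]
    have e2 : tensorPair ((limCov m).flip (c • Q)) (limMean m) =
        c • tensorPair ((limCov m).flip Q) (limMean m) := by
      ext u v; simp [mul_assoc]
    rw [map_smul, h, e1, e2]
    simp only [map_smul, LinearMap.smul_apply, smul_eq_mul, mul_add, map_add, mul_smul_comm]
    ring

/-- The limit state, with its free difference quotients. -/
def limState {I : Type*} (col : L → I) (hg : ∀ a b, col a ≠ col b → g a b = 0) :
    FreeLoopState (FreeAlgebra.ι ℂ : L → FreeAlgebra ℂ L) col g where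
  D a := freeDiff (g a)
  D_mul a := freeDiff_mul (g a)
  D_x a := freeDiff_ι (g a)
  g_eq_zero := hg
  α := limMean m
  α_one := limMean_one m
  α_comm := limMean_mul_comm m
  α_x_mul := limMean_ι_mul m

end LimitFunctionals

end Elliptic
end

noncomputable section
namespace Elliptic

/-! ### Gaussian limit of the joint moments of centered traces -/

open FreeLoopState (word word_cons word_nil word_append leibniz_word)

theorem span_list_prod_X {σ : Type*} (F : MvPolynomial σ ℂ) :
    F ∈ Submodule.span ℂ
      (Set.range fun S : List σ => (S.map (MvPolynomial.X (R := ℂ))).prod) := by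
  suffices H : ∀ S : List σ, F * (S.map (MvPolynomial.X (R := ℂ))).prod ∈ Submodule.span ℂ
      (Set.range fun S : List σ => (S.map (MvPolynomial.X (R := ℂ))).prod) by
    simpa using H []
  induction F using MvPolynomial.induction_on with
  | C a =>
    intro S
    rw [← MvPolynomial.smul_eq_C_mul]
    exact Submodule.smul_mem _ _ (Submodule.subset_span ⟨S, rfl⟩)
  | add p q hp hq =>
    intro S
    rw [add_mul]
    exact add_mem (hp S) (hq S)
  | mul_X p j hp =>
    intro S
    simpa [mul_assoc] using hp (j :: S)

theorem derivation_finset_prod {ι R : Type*} [DecidableEq ι] [CommRing R] [Algebra ℂ R]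
    (D : Derivation ℂ R R) (f : ι → R) (S : Finset ι) :
    D (∏ k ∈ S, f k) = ∑ k ∈ S, D (f k) * ∏ j ∈ S.erase k, f j := by
  induction S using Finset.induction_on with
  | empty => simp
  | insert a S ha ih =>
    rw [Finset.prod_insert ha, Derivation.leibniz, ih, Finset.sum_insert ha,
      Finset.erase_insert ha, smul_eq_mul, smul_eq_mul, add_comm, mul_comm (D (f a)),
      Finset.mul_sum]
    congr 1
    refine Finset.sum_congr rfl fun k hk => ?_
    have hka : a ≠ k := fun h => ha (h ▸ hk)
    rw [Finset.erase_insert_of_ne hka, Finset.prod_insert (by simp [ha])]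
    ring

section WickLimit

variable {L : Type*} {τ : L → L} {g : L → L → ℂ} {ε : ℂ} (m : ∀ N, LoopModel τ g ε N)

theorem exists_limit_aeval_Z (F : MvPolynomial (List L) ℂ) :
    ∃ l, Tendsto (fun N => (m N).E (MvPolynomial.aeval (m N).Z F)) atTop (𝓝 l) := by
  induction span_list_prod_X F using Submodule.span_induction with
  | mem y hy =>
    obtain ⟨S, rfl⟩ := hy
    refine ⟨_, (tendsto_momentLim m S).congr fun N => ?_⟩
    simp [LoopModel.moment, LoopModel.G, map_list_prod, Function.comp_def]
  | zero => exact ⟨0, by simp⟩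
  | add P Q _ _ hP hQ =>
    obtain ⟨l, hl⟩ := hP
    obtain ⟨l', hl'⟩ := hQ
    exact ⟨_, by simpa using hl.add hl'⟩
  | smul c P _ hP =>
    obtain ⟨l, hl⟩ := hP
    exact ⟨_, by simpa using hl.const_mul c⟩

/-- The limit of the expectation of a polynomial in the centered traces of words. -/
def limPoly : MvPolynomial (List L) ℂ →ₗ[ℂ] ℂ where
  toFun F := (exists_limit_aeval_Z m F).choose
  map_add' F G := tendsto_nhds_unique (exists_limit_aeval_Z m (F + G)).choose_spec (by
    simpa using (exists_limit_aeval_Z m F).choose_spec.add (exists_limit_aeval_Z m G).choose_spec)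
  map_smul' c F := tendsto_nhds_unique (exists_limit_aeval_Z m (c • F)).choose_spec (by
    simpa using (exists_limit_aeval_Z m F).choose_spec.const_mul c)

theorem tendsto_limPoly (F : MvPolynomial (List L) ℂ) :
    Tendsto (fun N => (m N).E (MvPolynomial.aeval (m N).Z F)) atTop (𝓝 (limPoly m F)) :=
  (exists_limit_aeval_Z m F).choose_spec

theorem limPoly_list_prod (S : List (List L)) :
    limPoly m (S.map MvPolynomial.X).prod = momentLim m S :=
  tendsto_nhds_unique (tendsto_limPoly m _) ((tendsto_momentLim m S).congr fun N => by
    simp [LoopModel.moment, LoopModel.G, map_list_prod, Function.comp_def])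

/-- The Wick recursion read as integration by parts, with words as the variables. In this form it
extends by linearity from words to non-commutative polynomials. -/
theorem limPoly_X_mul (w : List L) (F : MvPolynomial (List L) ℂ) :
    limPoly m (MvPolynomial.X w * F) = limPoly m
      (MvPolynomial.mkDerivation ℂ (fun x => MvPolynomial.C (momentLim m [w, x])) F) := by
  induction span_list_prod_X F using Submodule.span_induction with
  | mem y hy =>
    obtain ⟨S, rfl⟩ := hy
    have h := limPoly_list_prod m (w :: S)
    rw [List.map_cons, List.prod_cons] at h
    rw [h, momentLim_wick, Derivation.list_prod, map_splitSum]
    refine splitSum_congr _ fun S₁ x S₂ _ => ?_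
    rw [MvPolynomial.mkDerivation_X, ← MvPolynomial.smul_eq_C_mul, map_smul, limPoly_list_prod,
      smul_eq_mul]
  | zero => simp
  | add P Q _ _ hP hQ => simp only [mul_add, map_add, hP, hQ]
  | smul c P _ hP => rw [mul_smul_comm, map_smul, hP, Derivation.map_smul, map_smul]

/-- The polynomial in traces of words that represents the trace of a non-commutative polynomial. -/
def tracePoly (L : Type*) : FreeAlgebra ℂ L →ₗ[ℂ] MvPolynomial (List L) ℂ :=
  (wordBasis L).constr ℂ MvPolynomial.X

theorem tracePoly_word (w : List L) :
    tracePoly L (word (FreeAlgebra.ι ℂ) w) = MvPolynomial.X w := by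
  rw [← wordBasis_apply, tracePoly, Module.Basis.constr_basis]

theorem aeval_tracePoly {N : ℕ} (m : LoopModel τ g ε N) (P : FreeAlgebra ℂ L) :
    MvPolynomial.aeval m.Z (tracePoly L P) = m.ctr P := by
  have : (MvPolynomial.aeval m.Z).toLinearMap ∘ₗ tracePoly L = m.ctr := by
    refine linearMap_ext_words fun w => ?_
    simp [tracePoly_word, LoopModel.ctr_word]
  exact LinearMap.congr_fun this P

/-- The derivation sends the linear form `tracePoly L (P k)` to a scalar, the covariance with the
word `w`. The statement is linear in `Q`, so words suffice. -/
theorem limPoly_tracePoly_mul_prod {r : ℕ} (Q : FreeAlgebra ℂ L) (P : Fin r → FreeAlgebra ℂ L)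
    (S : Finset (Fin r)) :
    limPoly m (tracePoly L Q * ∏ k ∈ S, tracePoly L (P k)) =
      ∑ k ∈ S, limCov m Q (P k) * limPoly m (∏ j ∈ S.erase k, tracePoly L (P j)) := by
  induction Q using word_induction with
  | hw w =>
    rw [tracePoly_word, limPoly_X_mul, derivation_finset_prod, map_sum]
    refine Finset.sum_congr rfl fun k _ => ?_
    have : (MvPolynomial.mkDerivation ℂ
          (fun x => MvPolynomial.C (momentLim m [w, x]))).toLinearMap ∘ₗ tracePoly L =
        Algebra.linearMap ℂ (MvPolynomial (List L) ℂ) ∘ₗ limCov m (word (FreeAlgebra.ι ℂ) w) := by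
      refine linearMap_ext_words fun x => ?_
      simp [tracePoly_word, limCov_word, MvPolynomial.mkDerivation_X, MvPolynomial.algebraMap_eq]
    have h := LinearMap.congr_fun this (P k)
    simp only [LinearMap.comp_apply, Derivation.coeFn_coe, Algebra.linearMap_apply] at h
    rw [h, ← Algebra.smul_def, map_smul, smul_eq_mul]
  | hadd P Q hP hQ =>
    simp only [map_add, add_mul, hP, hQ, LinearMap.add_apply, Finset.sum_add_distrib]
  | hsmul c P hP =>
    simp only [map_smul, smul_mul_assoc, hP, LinearMap.smul_apply, Finset.smul_sum]

/-- The joint moments of centered traces converge to Gaussian moments. -/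
theorem exists_wick_limit {r : ℕ} (P : Fin r → FreeAlgebra ℂ L) :
    ∃ M : Finset (Fin r) → ℂ,
      (∀ S, Tendsto (fun N => (m N).E (∏ j ∈ S, (m N).ctr (P j))) atTop (𝓝 (M S))) ∧
      ∀ S, ∀ j ∈ S, M S = ∑ k ∈ S.erase j, M {j, k} * M ((S.erase j).erase k) := by
  refine ⟨fun S => limPoly m (∏ j ∈ S, tracePoly L (P j)), fun S => ?_, fun S j hj => ?_⟩
  · refine (tendsto_limPoly m _).congr fun N => ?_
    rw [map_prod]
    simp only [aeval_tracePoly]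
  · have h1 : limPoly m 1 = 1 := by
      have := limPoly_list_prod m []
      simpa [momentLim_nil] using this
    beta_reduce
    rw [← Finset.mul_prod_erase S _ hj, limPoly_tracePoly_mul_prod]
    refine Finset.sum_congr rfl fun k hk => ?_
    have hjk : j ≠ k := fun h => by simp [h] at hk
    congr 1
    -- For a single further factor the recursion identifies the covariance with the second moment `M
    -- {j, k}`.
    have := limPoly_tracePoly_mul_prod m (P j) P {k}
    rw [Finset.prod_pair hjk]
    simpa [h1] using this.symm

end WickLimit

end Elliptic
end

noncomputable section
namespace Elliptic

/-! ### Alternating words indexed by `Fin n`, and rotations as arithmetic modulo `n` -/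

namespace FreeLoopState

variable {A L I : Type*} [Ring A] [Algebra ℂ A] {x : L → A} {col : L → I}
  {g : L → L → ℂ} (s : FreeLoopState x col g)

/-- The list of the elements `a r` with their colors `c r`. -/
def colored {n : ℕ} (c : Fin n → I) (a : Fin n → A) : List (I × A) :=
  List.ofFn fun r => (c r, a r)

@[simp] theorem length_colored {n : ℕ} (c : Fin n → I) (a : Fin n → A) :
    (colored c a).length = n := by simp [colored]

theorem lprod_colored {n : ℕ} (c : Fin n → I) (a : Fin n → A) :
    lprod (colored c a) = wordProd a := by
  simp [colored, lprod, wordProd, List.map_ofFn, Function.comp_def]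

theorem colored_succ {n : ℕ} (c : Fin (n + 1) → I) (a : Fin (n + 1) → A) :
    colored c a = (c 0, a 0) :: colored (fun r : Fin n => c r.succ) (fun r => a r.succ) := by
  simp [colored, List.ofFn_succ]

theorem good_colored {n : ℕ} {c : Fin n → I} {a : Fin n → A} (hc : Alternating c)
    (ha : ∀ r, a r ∈ colorAlg x col (c r) ∧ s.α (a r) = 0) : s.Good (colored c a) := by
  constructor
  · rw [List.isChain_iff_getElem]
    intro i hi
    simp only [colored, List.getElem_ofFn]
    exact hc _ _ rfl
  · intro p hp
    obtain ⟨r, rfl⟩ := List.mem_ofFn.1 hp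
    exact ha r

theorem alternating_of_cyclically {n : ℕ} {c : Fin n → I} (hc : CyclicallyAlternating c) :
    Alternating c := by
  intro r t hrt
  have hn : 2 ≤ n := by have := t.2; omega
  obtain ⟨n, rfl⟩ : ∃ k, n = k + 1 := ⟨n - 1, by omega⟩
  have : finRotate (n + 1) r = t := by
    ext
    rw [coe_finRotate_of_ne_last, hrt]
    intro h
    have := t.2
    simp [h] at hrt
    omega
  rw [← this]
  exact hc hn r

theorem cycGood_colored {n : ℕ} {c : Fin n → I} {a : Fin n → A} (hc : CyclicallyAlternating c)
    (ha : ∀ r, a r ∈ colorAlg x col (c r) ∧ s.α (a r) = 0) : s.CycGood (colored c a) := by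
  refine ⟨s.good_colored (alternating_of_cyclically hc) ha, ?_⟩
  rw [length_colored]
  intro hn p hp q hq
  obtain ⟨n, rfl⟩ : ∃ k, n = k + 1 := ⟨n - 1, by omega⟩
  have h := hc hn (Fin.last n)
  rw [finRotate_last] at h
  rw [colored_succ] at hq
  simp only [List.head?_cons, Option.mem_def, Option.some.injEq] at hq
  rw [colored, List.ofFn_succ_last] at hp
  simp at hp
  rw [← hp, ← hq]
  exact h

theorem spoke_eq_zero (P R : List (I × A)) (h : P.length ≠ R.length) : s.spoke P R = 0 := by
  induction P generalizing R with
  | nil =>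
    rcases R with _ | ⟨r, R⟩
    · simp at h
    · rfl
  | cons p P ih =>
    rcases R with _ | ⟨r, R⟩
    · rfl
    · rw [spoke, ih R (by simpa using h), mul_zero]

theorem spoke_colored {n : ℕ} (c d : Fin n → I) (a b : Fin n → A) :
    s.spoke (colored c a) (colored d b) = ∏ i, s.α (a i * b i) := by
  induction n with
  | zero => simp [colored, spoke]
  | succ n ih => rw [colored_succ, colored_succ, spoke, ih, Fin.prod_univ_succ]

theorem colored_reverse {n : ℕ} (c : Fin n → I) (a : Fin n → A) :
    (colored c a).reverse = colored (fun r => c r.rev) (fun r => a r.rev) := by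
  refine List.ext_getElem (by simp) fun i h1 h2 => ?_
  simp only [colored, List.getElem_reverse, List.getElem_ofFn]
  simp at h2
  have : (⟨(List.ofFn fun r => (c r, a r)).length - 1 - i, by simp; omega⟩ : Fin n) =
      (⟨i, h2⟩ : Fin n).rev := by
    ext; simp [Fin.rev]; omega
  exact congrArg (fun r => (c r, a r)) this

theorem colored_rotate {n : ℕ} (d : Fin (n + 1) → I) (b : Fin (n + 1) → A) (k : Fin (n + 1)) :
    (colored d b).drop (k + 1) ++ (colored d b).take k =
      colored (fun t : Fin n => d (k + 1 + t.castSucc)) (fun t => b (k + 1 + t.castSucc)) := by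
  have hk := k.2
  refine List.ext_getElem (by simp; omega) fun i h1 h2 => ?_
  rw [length_colored] at h2
  rw [List.getElem_append]
  have hl : (List.ofFn fun r => (d r, b r)).length = n + 1 := List.length_ofFn
  simp only [List.length_drop, List.getElem_drop, List.getElem_take, colored, List.getElem_ofFn]
  split_ifs with h
  · refine congrArg (fun r => (d r, b r)) ?_
    ext
    simp only [Fin.val_add, Fin.val_castSucc, Fin.val_one', Nat.add_mod_mod, Nat.mod_add_mod]
    rw [Nat.mod_eq_of_lt (by omega)]
  · refine congrArg (fun r => (d r, b r)) ?_
    ext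
    simp only [Fin.val_add, Fin.val_castSucc, Fin.val_one', Nat.add_mod_mod, Nat.mod_add_mod]
    rw [Nat.mod_eq_sub_mod (by omega), Nat.mod_eq_of_lt (by omega)]
    omega

theorem splitSum_colored {M : Type*} [AddCommMonoid M] {n : ℕ} (d : Fin n → I) (b : Fin n → A)
    (f : List (I × A) → I × A → List (I × A) → M) :
    splitSum (colored d b) f =
      ∑ k : Fin n, f ((colored d b).take k) (d k, b k) ((colored d b).drop (k + 1)) := by
  rw [splitSum]
  refine Fintype.sum_equiv (finCongr (length_colored d b)) _ _ fun k => ?_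
  have h : (colored d b).get k = (d (finCongr (length_colored d b) k),
      b (finCongr (length_colored d b) k)) := by
    exact List.get_ofFn _ k
  rw [h]
  rfl

/-- The rotation is labelled by the index `k` of the factor that meets `a 0`. The other factors are
met in opposite order, so `a i` faces `b (k - i)`. -/
theorem spokeSum_colored {n : ℕ} (c d : Fin (n + 1) → I) (a b : Fin (n + 1) → A) :
    s.spokeSum (colored (fun r : Fin n => c r.succ) (fun r => a r.succ)) (colored d b) (a 0) =
      ∑ k, ∏ i, s.α (a i * b (k - i)) := by
  rw [spokeSum_apply, splitSum_colored]
  refine Finset.sum_congr rfl fun k _ => ?_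
  rw [colored_rotate, colored_reverse, spoke_colored, Fin.prod_univ_succ, mul_comm, sub_zero,
    ← Equiv.prod_comp Fin.revPerm (fun i : Fin n => s.α (a i.succ * b (k - i.succ)))]
  congr 1
  refine Finset.prod_congr rfl fun t _ => ?_
  -- The positions `1 + t` and `(Fin.rev t).succ = n - t` add up to `n + 1`, which is zero in `Fin
  -- (n + 1)`.
  have : k + 1 + t.castSucc = k - (Fin.revPerm t).succ := by
    rw [eq_sub_iff_add_eq, add_assoc, add_assoc]
    convert add_zero k
    ext
    have ht := t.2
    simp only [Fin.val_add, Fin.val_castSucc, Fin.val_succ, Fin.revPerm_apply, Fin.val_rev,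
      Fin.val_one', Nat.add_mod_mod, Nat.mod_add_mod]
    rw [show 1 + (t.1 + (n - (t.1 + 1) + 1)) = n + 1 by omega]
    simp
  rw [this]
  rfl

theorem spokeSum_colored_ne {n q : ℕ} (hq : n + 1 ≠ q) (c : Fin (n + 1) → I) (d : Fin q → I)
    (a : Fin (n + 1) → A) (b : Fin q → A) (z : A) :
    s.spokeSum (colored (fun r : Fin n => c r.succ) (fun r => a r.succ)) (colored d b) z = 0 := by
  rw [spokeSum_apply, splitSum_colored]
  refine Finset.sum_eq_zero fun k _ => ?_
  rw [s.spoke_eq_zero, zero_mul]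
  have := k.2
  simp
  omega

/-- The substitution of `Fin.last n - k` for `k`: the transposed word lists its factors backwards,
which turns opposite order into parallel order. -/
theorem sum_prod_rev {n : ℕ} (F : Fin (n + 1) → Fin (n + 1) → ℂ) :
    ∑ k : Fin (n + 1), ∏ i, F i (k - i).rev = ∑ k : Fin (n + 1), ∏ i, F i (k + i) := by
  rw [← Equiv.sum_comp (Equiv.subLeft (Fin.last n)) (fun k => ∏ i, F i (k + i))]
  refine Finset.sum_congr rfl fun k _ => Finset.prod_congr rfl fun i _ => ?_
  congr 1
  rw [← Fin.last_sub, Equiv.subLeft_apply]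
  abel

/-- The loop equation for the covariance functional makes elements of different colors
uncorrelated. -/
theorem cov_eq_zero_of_color_ne {f : A →ₗ[ℂ] ℂ} {κ : L → A} (hf1 : f 1 = 0)
    (hf : ∀ a P, f (x a * P) =
      tensorPair s.α f (s.D a P) + tensorPair f s.α (s.D a P) + s.α (P * κ a))
    {c : I} (hκ : ∀ a, col a = c → κ a = 0) {P : A} (hP : P ∈ colorAlg x col c) : f P = 0 := by
  refine eq_zero_of_words f (fun z hz => ?_) hP
  induction hk : z.length using Nat.strong_induction_on generalizing z with
  | _ k ih =>
    rcases z with _ | ⟨a, w⟩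
    · simpa using hf1
    -- Without a source the recursion is homogeneous, and every term contains the value of `f` at a
    -- shorter word.
    · rw [word_cons, hf, hκ a (hz a List.mem_cons_self), mul_zero, map_zero, add_zero, s.D_word,
        map_splitSum, map_splitSum, ← splitSum_add, ← splitSum_zero w]
      refine splitSum_congr _ fun u b v e => ?_
      have hu := ih u.length (by simp [e] at hk; omega) u (fun a ha => hz a (by simp [e, ha])) rfl
      have hv := ih v.length (by simp [e] at hk; omega) v (fun a ha => hz a (by simp [e, ha])) rfl
      simp [hu, hv]

end FreeLoopState

end Elliptic
end

noncomputable section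
namespace Elliptic

/-! ### The limit space -/

open FreeLoopState (word word_cons word_nil word_append colorAlg colored lprod)

/-! ### The `*`-algebra of `*`-polynomials -/

section Star

variable {I : Type*}

/-- Complex conjugation of the coefficients of a non-commutative polynomial. -/
def conjPoly (L : Type*) : FreeAlgebra ℂ L →+* FreeAlgebra ℂ L :=
  (FreeAlgebra.equivMonoidAlgebraFreeMonoid (R := ℂ) (X := L)).symm.toRingEquiv.toRingHom.comp
    ((MonoidAlgebra.mapRingHom (FreeMonoid L) (starRingEnd ℂ)).comp
      (FreeAlgebra.equivMonoidAlgebraFreeMonoid (R := ℂ) (X := L)).toRingEquiv.toRingHom)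

theorem conjPoly_ι {L : Type*} (b : L) :
    conjPoly L (FreeAlgebra.ι ℂ b) = FreeAlgebra.ι ℂ b := by
  simp [conjPoly, FreeAlgebra.equivMonoidAlgebraFreeMonoid]

theorem conjPoly_algebraMap {L : Type*} (z : ℂ) :
    conjPoly L (algebraMap ℂ _ z) = algebraMap ℂ _ (conj z) := by
  simp [conjPoly, FreeAlgebra.equivMonoidAlgebraFreeMonoid]
  rw [Algebra.algebraMap_eq_smul_one]

/-- The adjoint of a `*`-polynomial. -/
def polyStar (P : StarPoly I) : StarPoly I := transposePoly Sum.swap (conjPoly _ P)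

theorem polyStar_mul (P Q : StarPoly I) : polyStar (P * Q) = polyStar Q * polyStar P := by
  rw [polyStar, map_mul, transposePoly_mul]; rfl

theorem polyStar_add (P Q : StarPoly I) : polyStar (P + Q) = polyStar P + polyStar Q := by
  rw [polyStar, map_add, map_add]; rfl

theorem polyStar_ι (b : I ⊕ I) : polyStar (FreeAlgebra.ι ℂ b) = FreeAlgebra.ι ℂ b.swap := by
  rw [polyStar, conjPoly_ι, transposePoly_ι]

theorem polyStar_algebraMap (z : ℂ) :
    polyStar (algebraMap ℂ (StarPoly I) z) = algebraMap ℂ _ (conj z) := by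
  rw [polyStar, conjPoly_algebraMap, Algebra.algebraMap_eq_smul_one, map_smul, transposePoly_one]

theorem polyStar_polyStar (P : StarPoly I) : polyStar (polyStar P) = P := by
  induction P using FreeAlgebra.induction with
  | grade0 z => simp [polyStar_algebraMap]
  | grade1 b => simp [polyStar_ι]
  | mul P Q hP hQ => rw [polyStar_mul, polyStar_mul, hP, hQ]
  | add P Q hP hQ => rw [polyStar_add, polyStar_add, hP, hQ]

/-- The `*`-algebra structure on the `*`-polynomials. -/
abbrev polyStarRing (I : Type*) : StarRing (StarPoly I) where
  star := polyStar
  star_involutive := polyStar_polyStar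
  star_mul := polyStar_mul
  star_add := polyStar_add

attribute [local instance] polyStarRing

theorem star_eq_polyStar (P : StarPoly I) : star P = polyStar P := rfl

theorem polyStarModule (I : Type*) : StarModule ℂ (StarPoly I) where
  star_smul z P := by
    rw [star_eq_polyStar, Algebra.smul_def, polyStar_mul, polyStar_algebraMap,
      ← Algebra.commutes, ← Algebra.smul_def]
    rfl

/-- The variable `x_i`. -/
def polyGen (i : I) : StarPoly I := FreeAlgebra.ι ℂ (Sum.inl i)

theorem star_polyGen (i : I) : star (polyGen i) = FreeAlgebra.ι ℂ (Sum.inr i) := polyStar_ι _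

theorem starEval_polyGen (P : StarPoly I) : starEval polyGen P = P := by
  have : starEval polyGen = AlgHom.id ℂ (StarPoly I) := by
    refine FreeAlgebra.hom_ext (funext fun b => ?_)
    rcases b with i | i
    · simp [starEval, polyGen]
    · simp [starEval, star_polyGen]
  rw [this]; rfl

/-- The color of the letters `x_i` and `x_i^*` is `i`. -/
def letterColor : I ⊕ I → I := Sum.elim id id

theorem letterColor_swap (a : I ⊕ I) : letterColor a.swap = letterColor a := by
  rcases a with i | i <;> rfl

theorem starAlg_polyGen (i : I) :
    starAlg (polyGen i) = colorAlg (FreeAlgebra.ι ℂ) letterColor i := by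
  rw [starAlg, colorAlg, star_polyGen]
  congr 1
  ext P
  constructor
  · rintro (rfl | rfl)
    · exact ⟨Sum.inl i, rfl, rfl⟩
    · exact ⟨Sum.inr i, rfl, rfl⟩
  · rintro ⟨a, ha, rfl⟩
    rcases a with j | j <;> obtain rfl : j = i := ha
    · exact Or.inl rfl
    · exact Or.inr rfl

theorem transposePoly_mem_colorAlg {c : I} {P : StarPoly I}
    (hP : P ∈ colorAlg (FreeAlgebra.ι ℂ) letterColor c) :
    transposePoly Sum.swap P ∈ colorAlg (FreeAlgebra.ι ℂ) letterColor c := by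
  -- Membership is expressed as vanishing in the quotient by the color algebra, a linear condition
  -- that can be checked on words.
  have h := FreeLoopState.eq_zero_of_words (c := c)
    ((colorAlg (FreeAlgebra.ι ℂ) letterColor c).toSubmodule.mkQ ∘ₗ transposePoly Sum.swap)
    (fun w hw => ?_) hP
  · simpa using h
  · rw [LinearMap.comp_apply, transposePoly_word, Submodule.mkQ_apply,
      Submodule.Quotient.mk_eq_zero]
    refine FreeLoopState.word_mem_colorAlg fun a ha => ?_
    obtain ⟨b, hb, rfl⟩ : ∃ b ∈ w, b.swap = a := by simpa [transposeWord] using ha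
    rw [letterColor_swap, hw b hb]

theorem transposePoly_swap_swap (P : StarPoly I) :
    transposePoly Sum.swap (transposePoly Sum.swap P) = P := by
  have : transposePoly Sum.swap ∘ₗ transposePoly Sum.swap =
      (LinearMap.id : StarPoly I →ₗ[ℂ] StarPoly I) := by
    refine linearMap_ext_words fun w => ?_
    simp [transposePoly_word, transposeWord, Function.comp_def]
  exact LinearMap.congr_fun this P

end Star

theorem transposePoly_wordProd {L : Type*} (τ : L → L) {n : ℕ} (b : Fin n → FreeAlgebra ℂ L) :
    transposePoly τ (wordProd b) = wordProd (fun r => transposePoly τ (b r.rev)) := by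
  have h : ∀ l : List (FreeAlgebra ℂ L),
      transposePoly τ l.prod = (l.map (transposePoly τ)).reverse.prod := by
    intro l
    induction l with
    | nil => simp [transposePoly_one]
    | cons P l ih => simp [transposePoly_mul, ih]
  rw [wordProd, h, wordProd]
  congr 1
  refine List.ext_getElem (by simp) fun i h1 h2 => ?_
  simp only [List.getElem_reverse, List.getElem_map, List.getElem_ofFn]
  simp at h2
  congr 2
  ext
  simp [Fin.rev]
  omega

theorem cyclicallyAlternating_rev {I : Type*} {n : ℕ} {d : Fin n → I}
    (hd : CyclicallyAlternating d) : CyclicallyAlternating (fun r => d r.rev) := by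
  intro hn r
  obtain ⟨n, rfl⟩ : ∃ k, n = k + 1 := ⟨n - 1, by omega⟩
  -- The successor of the reversed successor of `r` is the reverse of `r`.
  have h := hd hn (finRotate (n + 1) r).rev
  have e : finRotate (n + 1) (finRotate (n + 1) r).rev = r.rev := by
    rw [finRotate_apply, finRotate_apply, ← Fin.last_sub, ← Fin.last_sub]
    abel
  rw [e] at h
  exact h.symm

/-! ### The second-order limit space and its covariances -/

section Limit

variable {I : Type*} {g : I ⊕ I → I ⊕ I → ℂ} {ε : ℂ}

/-- The second-order space of the limit functionals. -/
def limSpace (m : ∀ N, LoopModel Sum.swap g ε N) : SecondOrderSpace (StarPoly I) where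
  φ₁ := limMean m
  φ₂ := limCov m
  φ₁_one := limMean_one m
  φ₁_tracial := limMean_mul_comm m
  φ₂_tracial_left := limCov_mul_comm_left m
  φ₂_tracial_right a b c := by
    rw [limCov_symm, limCov_mul_comm_left, limCov_symm]
  φ₂_symm := limCov_symm m
  φ₂_one_left := limCov_one_left m
  φ₂_one_right a := by rw [limCov_symm, limCov_one_left]

theorem LoopModel.eval_transposePoly {L : Type*} {τ : L → L} {g : L → L → ℂ} {N : ℕ}
    (m : LoopModel τ g ε N) (hε : ε ≠ 0) (P : FreeAlgebra ℂ L) :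
    m.eval (transposePoly τ P) = (m.eval P).transpose := by
  induction P using word_induction with
  | hw w => rw [transposePoly_word, m.eval_word, m.eval_word, m.W_transposeWord hε]
  | hadd P Q hP hQ => rw [map_add, map_add, map_add, hP, hQ, Matrix.transpose_add]
  | hsmul c P hP => rw [map_smul, map_smul, map_smul, hP, Matrix.transpose_smul]

variable (m : ∀ N, LoopModel Sum.swap g ε N)

/-- For `ε ≠ 0` the formal transposition is the transposition of matrices in every model. It
therefore preserves traces at every `N`, and the invariance passes to the limits. -/
theorem limSpace_isTransposition (hε : ε ≠ 0) :
    IsTransposition (limSpace m) (transposePoly Sum.swap) := by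
  have htr : ∀ N (P : StarPoly I), (m N).tr (transposePoly Sum.swap P) = (m N).tr P := by
    intro N P
    rw [(m N).tr_apply, (m N).eval_transposePoly hε, Matrix.trace_transpose, (m N).tr_apply]
  have hleft : ∀ P Q, limCov m (transposePoly Sum.swap P) Q = limCov m P Q := fun P Q =>
    tendsto_nhds_unique (tendsto_limCov m _ _) (by
      simpa only [LoopModel.ctr_apply, htr] using tendsto_limCov m P Q)
  refine ⟨transposePoly_swap_swap, transposePoly_mul _, fun P => ?_, hleft, fun P Q => ?_⟩
  · change limMean m _ = limMean m _
    exact tendsto_nhds_unique (tendsto_limMean m _) (by simpa only [htr] using tendsto_limMean m P)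
  · change limCov m _ _ = limCov m _ _
    rw [limCov_symm, hleft, limCov_symm]

variable (hg : ∀ a b, letterColor a ≠ letterColor b → g a b = 0)
include hg

/-- The covariance functional on cyclically alternating words of centered elements. -/
theorem limCov_wordProd {n q : ℕ} (hn : 1 ≤ n) {c : Fin (n + 1) → I} {d d' : Fin q → I}
    {a : Fin (n + 1) → StarPoly I} {b b' : Fin q → StarPoly I}
    (hc : CyclicallyAlternating c) (hd : CyclicallyAlternating d) (hd' : CyclicallyAlternating d')
    (ha : ∀ r, a r ∈ colorAlg (FreeAlgebra.ι ℂ) letterColor (c r) ∧ limMean m (a r) = 0)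
    (hb : ∀ r, b r ∈ colorAlg (FreeAlgebra.ι ℂ) letterColor (d r) ∧ limMean m (b r) = 0)
    (hb' : ∀ r, b' r ∈ colorAlg (FreeAlgebra.ι ℂ) letterColor (d' r) ∧ limMean m (b' r) = 0)
    (hbb' : ε ≠ 0 → wordProd b' = transposePoly Sum.swap (wordProd b)) :
    limCov m (wordProd a) (wordProd b) =
      (limState m letterColor hg).spokeSum (colored (fun r : Fin n => c r.succ) (fun r => a r.succ))
        (colored d b) (a 0) +
      ε * (limState m letterColor hg).spokeSum
        (colored (fun r : Fin n => c r.succ) (fun r => a r.succ)) (colored d' b') (a 0) := by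
  have h := (limState m letterColor hg).secondOrder (f := (limCov m).flip (wordProd b)) (ε := ε)
    ((limState m letterColor hg).cycGood_colored hd hb)
    ((limState m letterColor hg).cycGood_colored hd' hb') (fun x P => ?_)
    (p := (c 0, a 0)) (P := colored (fun r : Fin n => c r.succ) (fun r => a r.succ)) ?_ ?_
  · rw [← FreeLoopState.colored_succ, FreeLoopState.lprod_colored] at h
    exact h
  · rw [FreeLoopState.lprod_colored, FreeLoopState.lprod_colored, LinearMap.flip_apply,
      limCov_ι_mul]
    by_cases hε : ε = 0
    · subst hε
      simp only [zero_smul]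
      rfl
    · rw [hbb' hε]
      rfl
  · rw [← FreeLoopState.colored_succ]
    exact (limState m letterColor hg).cycGood_colored hc ha
  · intro h0
    have := congrArg List.length h0
    simp at this
    omega

/-- Vanishing of the covariance of words with different numbers of factors. -/
theorem limCov_wordProd_eq_zero
    (ht : ε ≠ 0 → ∀ P, limMean m (transposePoly Sum.swap P) = limMean m P)
    {p q : ℕ} (hp : 2 ≤ p) (hpq : p ≠ q) {c : Fin p → I} {d : Fin q → I}
    {a : Fin p → StarPoly I} {b : Fin q → StarPoly I}
    (hc : CyclicallyAlternating c) (hd : CyclicallyAlternating d)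
    (ha : ∀ r, a r ∈ colorAlg (FreeAlgebra.ι ℂ) letterColor (c r) ∧ limMean m (a r) = 0)
    (hb : ∀ r, b r ∈ colorAlg (FreeAlgebra.ι ℂ) letterColor (d r) ∧ limMean m (b r) = 0) :
    limCov m (wordProd a) (wordProd b) = 0 := by
  obtain ⟨n, rfl⟩ : ∃ n, p = n + 1 := ⟨p - 1, by omega⟩
  by_cases hε : ε = 0
  · rw [limCov_wordProd m hg (by omega) hc hd hd ha hb hb (fun h => absurd hε h),
      FreeLoopState.spokeSum_colored_ne _ hpq, mul_zero, add_zero]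
  · rw [limCov_wordProd m hg (by omega) hc hd (cyclicallyAlternating_rev hd) ha hb
        (fun r => ⟨transposePoly_mem_colorAlg (hb r.rev).1, by rw [ht hε, (hb r.rev).2]⟩)
        (fun _ => (transposePoly_wordProd Sum.swap b).symm),
      FreeLoopState.spokeSum_colored_ne _ hpq, FreeLoopState.spokeSum_colored_ne _ hpq, mul_zero,
      add_zero]

theorem limSpace_secondOrderFreeBase
    (ht : ε ≠ 0 → ∀ P, limMean m (transposePoly Sum.swap P) = limMean m P) :
    SecondOrderFreeBase (limSpace m)
      (fun i : I => colorAlg (FreeAlgebra.ι ℂ) letterColor i) := by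
  refine ⟨fun n hn c a hc ha => ?_, fun p q hp hq hpq c d a b hc hd ha hb => ?_,
    fun c d hcd a ha b hb => ?_⟩
  · have h := (limState m letterColor hg).α_lprod
      ((limState m letterColor hg).good_colored hc ha) (fun h0 => by
        have := congrArg List.length h0
        simp at this
        omega)
    rwa [FreeLoopState.lprod_colored] at h
  · change limCov m _ _ = 0
    -- The recursion in the first factor needs further factors in the first word. If `p = 1`, then
    -- `q` is at least two, and symmetry exchanges the two words.
    rcases Nat.lt_or_ge 1 p with h | h
    · exact limCov_wordProd_eq_zero m hg ht h hpq hc hd ha hb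
    · rw [limCov_symm]
      exact limCov_wordProd_eq_zero m hg ht (by omega) hpq.symm hd hc hb ha
  · refine (limState m letterColor hg).cov_eq_zero_of_color_ne (f := (limCov m).flip b)
      (limCov_one_left m b) (fun x P => limCov_ι_mul m x P b) (fun x hx => ?_) ha
    have h : ∀ Q ∈ colorAlg (FreeAlgebra.ι ℂ) letterColor d, freeDiff (g x) Q = 0 := fun Q hQ =>
      (limState m letterColor hg).D_eq_zero (hx ▸ hcd) hQ
    rw [h b hb, h _ (transposePoly_mem_colorAlg hb)]
    simp

end Limit

/-! ### Complex and real second-order freeness of the limit space -/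

section Free

variable {I : Type*} {g : I ⊕ I → I ⊕ I → ℂ}

theorem limSpace_secondOrderFree (m : ∀ N, LoopModel Sum.swap g 0 N)
    (hg : ∀ a b, letterColor a ≠ letterColor b → g a b = 0) :
    SecondOrderFree (limSpace m) (fun i : I => colorAlg (FreeAlgebra.ι ℂ) letterColor i) where
  toSecondOrderFreeBase := limSpace_secondOrderFreeBase m hg (fun h => absurd rfl h)
  cov_eq p hp c d a b hc hd ha hb := by
    obtain ⟨n, rfl⟩ : ∃ n, p = n + 1 := ⟨p - 1, by omega⟩
    refine (limCov_wordProd m hg (by omega) hc hd hd ha hb hb (fun h => absurd rfl h)).trans ?_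
    rw [FreeLoopState.spokeSum_colored, zero_mul, add_zero]
    rfl

theorem limSpace_realSecondOrderFree (m : ∀ N, LoopModel Sum.swap g 1 N)
    (hg : ∀ a b, letterColor a ≠ letterColor b → g a b = 0) :
    RealSecondOrderFree (limSpace m) (transposePoly Sum.swap)
      (fun i : I => colorAlg (FreeAlgebra.ι ℂ) letterColor i) where
  toSecondOrderFreeBase := limSpace_secondOrderFreeBase m hg
    (fun h => (limSpace_isTransposition m h).φ₁_map)
  cov_eq p hp c d a b hc hd ha hb := by
    obtain ⟨n, rfl⟩ : ∃ n, p = n + 1 := ⟨p - 1, by omega⟩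
    have ht := (limSpace_isTransposition m one_ne_zero).φ₁_map
    refine (limCov_wordProd m hg (by omega) hc hd (cyclicallyAlternating_rev hd) ha hb
        (fun r => ⟨transposePoly_mem_colorAlg (hb r.rev).1, (ht _).trans (hb r.rev).2⟩)
        (fun _ => (transposePoly_wordProd Sum.swap b).symm)).trans ?_
    -- The second sum runs over the rotations of the transposed word, whose factor at `r` is the
    -- transpose of `b r.rev`. Reindexing turns `(k - i).rev` into `k + i`.
    rw [FreeLoopState.spokeSum_colored, FreeLoopState.spokeSum_colored, one_mul,
      Finset.sum_add_distrib,
      FreeLoopState.sum_prod_rev fun i j => (limState m letterColor hg).α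
        (a i * transposePoly Sum.swap (b j))]
    rfl

end Free


end Elliptic
end

noncomputable section
namespace Elliptic

/-! ### Random matrices that realize a loop model -/

open FreeLoopState (colorAlg)

attribute [local instance] polyStarRing

/-- A random family of matrices `X i` that realizes a loop model: the elements of the model become
random variables with all moments, `E` becomes the expectation, and the matrices of the model
become `X i` and its adjoint. -/
structure Realization.{u, v} {I : Type u} {Ω : Type v} [MeasurableSpace Ω] (μ : Measure Ω) (g : I ⊕ I → I ⊕ I → ℂ)
    (ε : ℂ) {N : ℕ} (X : I → Ω → Matrix (Fin N) (Fin N) ℂ) where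
  model : LoopModel.{u, u} Sum.swap g ε N
  ev : Ω → model.R →ₐ[ℂ] ℂ
  allMoments : ∀ F, AllMoments μ (fun ω => ev ω F)
  E_eq : ∀ F, model.E F = ∫ ω, ev ω F ∂μ
  ev_inl : ∀ ω i, (model.Y (Sum.inl i)).map (ev ω) = X i ω
  ev_inr : ∀ ω i, (model.Y (Sum.inr i)).map (ev ω) = star (X i ω)

namespace Realization

variable {I Ω : Type*} [MeasurableSpace Ω] {μ : Measure Ω} {g : I ⊕ I → I ⊕ I → ℂ} {ε : ℂ} {N : ℕ}
  {X : I → Ω → Matrix (Fin N) (Fin N) ℂ} (ρ : Realization μ g ε X)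

theorem starEval_eq (ω : Ω) (P : StarPoly I) :
    starEval (fun i => X i ω) P = (ρ.ev ω).mapMatrix (ρ.model.eval P) := by
  have : starEval (fun i => X i ω) = (ρ.ev ω).mapMatrix.comp ρ.model.eval := by
    refine FreeAlgebra.hom_ext (funext fun b => ?_)
    rcases b with i | i
    · simp [starEval, LoopModel.eval, ρ.ev_inl]
    · simp [starEval, LoopModel.eval, ρ.ev_inr]
  rw [this]; rfl

theorem trace_starEval (ω : Ω) (P : StarPoly I) :
    (starEval (fun i => X i ω) P).trace = ρ.ev ω (ρ.model.tr P) := by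
  rw [ρ.starEval_eq, AlgHom.mapMatrix_apply, ρ.model.tr_apply]
  simp [Matrix.trace]

theorem trace_mapMatrix (ω : Ω) (P : StarPoly I) :
    ((ρ.ev ω).mapMatrix (ρ.model.eval P)).trace = ρ.ev ω (ρ.model.tr P) := by
  rw [← ρ.starEval_eq, ρ.trace_starEval]

theorem integral_normTrace_mapMatrix (P : StarPoly I) :
    ∫ ω, normTrace ((ρ.ev ω).mapMatrix (ρ.model.eval P)) ∂μ =
      (N : ℂ)⁻¹ * ρ.model.E (ρ.model.tr P) := by
  simp only [normTrace, ρ.trace_mapMatrix, ρ.E_eq]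
  rw [integral_div, div_eq_inv_mul]

theorem covar_ev (P Q : StarPoly I) :
    covar μ (fun ω => ρ.ev ω (ρ.model.tr P)) (fun ω => ρ.ev ω (ρ.model.tr Q)) =
      ρ.model.E (ρ.model.ctr P * ρ.model.ctr Q) := by
  rw [ρ.model.E_ctr_mul_ctr, ρ.E_eq, ρ.E_eq, ρ.E_eq, covar]
  simp only [map_mul]

/-- Traces and centered traces differ by constants, which cumulants of order at least two do not
see. -/
theorem cumulant_trace [IsProbabilityMeasure μ] {r : ℕ} (hr : 2 ≤ r) (P : Fin r → StarPoly I) :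
    cumulant μ (fun j ω => ρ.ev ω (ρ.model.tr (P j))) Finset.univ =
      cumulant μ (fun j ω => ρ.ev ω (ρ.model.ctr (P j))) Finset.univ := by
  rw [← cumulant_add_const μ (fun j ω => ρ.ev ω (ρ.model.ctr (P j)))
    (fun j => ρ.model.E (ρ.model.tr (P j)))]
  · congr 1
    funext j ω
    simp [ρ.model.ctr_apply]
  · intro c S
    have := (ρ.allMoments (∏ i ∈ S, (ρ.model.ctr (P i) + algebraMap ℂ _ (c i)))).integrable
    simpa using this
  · simpa using hr

end Realization

section Limit

universe u v

variable {I : Type u} {Ω : ℕ → Type v} [∀ N, MeasurableSpace (Ω N)] {μ : ∀ N, Measure (Ω N)}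
  [∀ N, IsProbabilityMeasure (μ N)] {g : I ⊕ I → I ⊕ I → ℂ} {ε : ℂ}
  {X : ∀ N, I → Ω N → Matrix (Fin N) (Fin N) ℂ} (ρ : ∀ N, Realization (μ N) g ε (X N))

theorem hasSecondOrderLimit :
    HasSecondOrderLimit μ X (limSpace fun N => (ρ N).model) polyGen where
  memLp N r P := by
    simp only [(ρ N).trace_starEval]
    exact (ρ N).allMoments _ _ (by simp)
  tendsto_mean P := by
    rw [starEval_polyGen]
    simp only [(ρ _).starEval_eq, (ρ _).integral_normTrace_mapMatrix]
    exact tendsto_limMean (fun N => (ρ N).model) P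
  tendsto_cov P Q := by
    rw [starEval_polyGen, starEval_polyGen]
    simp only [(ρ _).trace_starEval, (ρ _).covar_ev]
    exact tendsto_limCov (fun N => (ρ N).model) P Q
  tendsto_cumulant r hr P := by
    simp only [(ρ _).trace_starEval, (ρ _).cumulant_trace (show 2 ≤ r by omega)]
    obtain ⟨M, hM, hwick⟩ := exists_wick_limit (fun N => (ρ N).model) P
    have h := tendsto_cumulant_of_wick μ (fun N j ω => (ρ N).ev ω ((ρ N).model.ctr (P j))) M
      (fun S => by simpa only [(ρ _).E_eq, map_prod] using hM S) hwick Finset.univ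
      ⟨⟨0, by omega⟩, Finset.mem_univ _⟩
    rwa [if_neg (by simp; omega)] at h

/-- The algebra of `*`-polynomials with its generators serves as the limit: evaluation at the
generators is the identity, and the `*`-algebra generated by `x_i` is the color algebra of `i`. -/
theorem asymptoticallySecondOrderFree
    (ρ : ∀ N, Realization (μ N) g 0 (X N))
    (hg : ∀ a b, letterColor a ≠ letterColor b → g a b = 0) :
    AsymptoticallySecondOrderFree μ X := by
  refine ⟨StarPoly I, inferInstance, inferInstance, polyStarRing I, polyStarModule I,
    limSpace fun N => (ρ N).model, polyGen, hasSecondOrderLimit ρ, ?_⟩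
  simp only [starAlg_polyGen]
  exact limSpace_secondOrderFree _ hg

theorem asymptoticallyRealSecondOrderFree {X : ∀ N, I → Ω N → Matrix (Fin N) (Fin N) ℝ}
    (ρ : ∀ N, Realization (μ N) g 1 (fun i ω => complexify (X N i ω)))
    (hg : ∀ a b, letterColor a ≠ letterColor b → g a b = 0) :
    AsymptoticallyRealSecondOrderFree μ X := by
  refine ⟨StarPoly I, inferInstance, inferInstance, polyStarRing I, polyStarModule I,
    limSpace fun N => (ρ N).model, transposePoly Sum.swap, polyGen,
    limSpace_isTransposition _ one_ne_zero, fun i => ?_, hasSecondOrderLimit ρ, ?_⟩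
  · rw [star_polyGen, polyGen, transposePoly_ι]; rfl
  · simp only [starAlg_polyGen]
    exact limSpace_realSecondOrderFree _ hg

/-! ### The covariance formulas -/

/-- The polynomial `P` in the variable `x_i`. -/
def inVar (i : I) : StarPoly Unit →ₐ[ℂ] StarPoly I :=
  FreeAlgebra.lift ℂ (Sum.elim (fun _ => FreeAlgebra.ι ℂ (Sum.inl i))
    (fun _ => FreeAlgebra.ι ℂ (Sum.inr i)))

theorem inVar_mem (i : I) (P : StarPoly Unit) :
    inVar i P ∈ colorAlg (FreeAlgebra.ι ℂ) letterColor i := by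
  induction P using FreeAlgebra.induction with
  | grade0 z => rw [AlgHom.commutes]; exact Subalgebra.algebraMap_mem _ _
  | grade1 b =>
    rcases b with b | b
    · exact Algebra.subset_adjoin ⟨Sum.inl i, rfl, by simp [inVar]⟩
    · exact Algebra.subset_adjoin ⟨Sum.inr i, rfl, by simp [inVar]⟩
  | mul P Q hP hQ => rw [map_mul]; exact mul_mem hP hQ
  | add P Q hP hQ => rw [map_add]; exact add_mem hP hQ

theorem starEval_inVar {A : Type*} [Ring A] [Algebra ℂ A] [Star A] (x : I → A) (i : I)
    (P : StarPoly Unit) : starEval (fun _ => x i) P = starEval x (inVar i P) := by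
  have : starEval (fun _ => x i) = (starEval x).comp (inVar i) := by
    refine FreeAlgebra.hom_ext (funext fun b => ?_)
    rcases b with b | b <;> simp [starEval, inVar]
  rw [this]; rfl

/-- If linear functionals converge pointwise, they converge on products whose factors are
recentered by convergent scalars. -/
theorem tendsto_wordProd_sub_smul {A : Type*} [Ring A] [Algebra ℂ A] {n : ℕ} (a : Fin n → A)
    {z : ℕ → Fin n → ℂ} {z₀ : Fin n → ℂ} (hz : ∀ i, Tendsto (fun N => z N i) atTop (𝓝 (z₀ i)))
    {f : ℕ → A →ₗ[ℂ] ℂ} {f₀ : A →ₗ[ℂ] ℂ} (hf : ∀ P, Tendsto (fun N => f N P) atTop (𝓝 (f₀ P))) :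
    Tendsto (fun N => f N (wordProd fun i => a i - z N i • 1)) atTop
      (𝓝 (f₀ (wordProd fun i => a i - z₀ i • 1))) := by
  induction n generalizing f f₀ with
  | zero => simpa [wordProd] using hf 1
  | succ n ih =>
    have e : ∀ (f : A →ₗ[ℂ] ℂ) (z : Fin (n + 1) → ℂ), f (wordProd fun i => a i - z i • 1) =
        (f ∘ₗ LinearMap.mulLeft ℂ (a 0)) (wordProd fun i : Fin n => a i.succ - z i.succ • 1) -
          z 0 * f (wordProd fun i : Fin n => a i.succ - z i.succ • 1) := by
      intro f z
      simp [wordProd, List.ofFn_succ, sub_mul]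
    simp only [e]
    refine (ih (fun i => a i.succ) (fun i => hz i.succ) fun P => ?_).sub
      ((hz 0).mul (ih (fun i => a i.succ) (fun i => hz i.succ) hf))
    exact hf _

theorem tendsto_bilin_wordProd_sub_smul {A : Type*} [Ring A] [Algebra ℂ A] {n k : ℕ} (a : Fin n → A)
    (b : Fin k → A) {z : ℕ → Fin n → ℂ} {z₀ : Fin n → ℂ}
    (hz : ∀ i, Tendsto (fun N => z N i) atTop (𝓝 (z₀ i)))
    {y : ℕ → Fin k → ℂ} {y₀ : Fin k → ℂ} (hy : ∀ i, Tendsto (fun N => y N i) atTop (𝓝 (y₀ i)))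
    {f : ℕ → A →ₗ[ℂ] A →ₗ[ℂ] ℂ} {f₀ : A →ₗ[ℂ] A →ₗ[ℂ] ℂ}
    (hf : ∀ P Q, Tendsto (fun N => f N P Q) atTop (𝓝 (f₀ P Q))) :
    Tendsto (fun N => f N (wordProd fun i => a i - z N i • 1) (wordProd fun i => b i - y N i • 1))
      atTop (𝓝 (f₀ (wordProd fun i => a i - z₀ i • 1) (wordProd fun i => b i - y₀ i • 1))) :=
  tendsto_wordProd_sub_smul b hy fun Q =>
    tendsto_wordProd_sub_smul a hz (f := fun N => (f N).flip Q) (f₀ := f₀.flip Q)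
      fun P => hf P Q

theorem map_wordProd {A B : Type*} [Ring A] [Algebra ℂ A] [Ring B] [Algebra ℂ B] (f : A →ₐ[ℂ] B)
    {n : ℕ} (a : Fin n → A) : f (wordProd a) = wordProd fun i => f (a i) := by
  rw [wordProd, map_list_prod, List.map_ofFn]; rfl

/-- The normalized expected trace of `P` at the matrix of color `i`. -/
def LoopModel.meanIn {N : ℕ} (m : LoopModel Sum.swap g ε N) (i : I) (P : StarPoly Unit) : ℂ :=
  (N : ℂ)⁻¹ * m.E (m.tr (inVar i P))

theorem Realization.centeredEval_eq {Ω : Type*} [MeasurableSpace Ω] {μ : Measure Ω} {N : ℕ}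
    {X : I → Ω → Matrix (Fin N) (Fin N) ℂ} (ρ : Realization μ g ε X) (i : I) (P : StarPoly Unit)
    (ω : Ω) : centeredEval μ (X i) P ω =
      (ρ.ev ω).mapMatrix (ρ.model.eval (inVar i P - ρ.model.meanIn i P • 1)) := by
  have h : ∀ ω, starEval (fun _ => X i ω) P = (ρ.ev ω).mapMatrix (ρ.model.eval (inVar i P)) :=
    fun ω => by rw [starEval_inVar (fun i => X i ω), ρ.starEval_eq]
  rw [centeredEval, h, map_sub, map_sub, map_smul, map_smul, map_one, map_one, LoopModel.meanIn,
    ← ρ.integral_normTrace_mapMatrix]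
  simp only [h]

/-- The limit of the centered element `P - E tr P` in the variable `x_i`. -/
def limCenter (m : ∀ N, LoopModel Sum.swap g ε N) (i : I) (P : StarPoly Unit) : StarPoly I :=
  inVar i P - limMean m (inVar i P) • 1

theorem limCenter_mem (m : ∀ N, LoopModel Sum.swap g ε N) (i : I) (P : StarPoly Unit) :
    limCenter m i P ∈ colorAlg (FreeAlgebra.ι ℂ) letterColor i ∧
      (limSpace m).φ₁ (limCenter m i P) = 0 := by
  refine ⟨sub_mem (inVar_mem i P) (Subalgebra.smul_mem _ (one_mem _) _), ?_⟩
  rw [limCenter, map_sub, map_smul, (limSpace m).φ₁_one]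
  simp [limSpace]

theorem tendsto_meanIn (m : ∀ N, LoopModel Sum.swap g ε N) (i : I) (P : StarPoly Unit) :
    Tendsto (fun N => (m N).meanIn i P) atTop (𝓝 (limMean m (inVar i P))) :=
  tendsto_limMean m _

/-- The factors are centered by their means at size `N`, which converge to the limiting means.
Expanding the product leaves finitely many covariances of fixed polynomials with convergent
coefficients. -/
theorem tendsto_wordCov {p q : ℕ} (c : Fin p → I) (d : Fin q → I)
    (P : Fin p → StarPoly Unit) (Q : Fin q → StarPoly Unit) :
    Tendsto (wordCov μ X c d P Q) atTop (𝓝 (limCov (fun N => (ρ N).model)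
      (wordProd fun i => limCenter (fun N => (ρ N).model) (c i) (P i))
      (wordProd fun j => limCenter (fun N => (ρ N).model) (d j) (Q j)))) := by
  refine (tendsto_bilin_wordProd_sub_smul (fun i => inVar (c i) (P i)) (fun j => inVar (d j) (Q j))
    (fun i => tendsto_meanIn (fun N => (ρ N).model) (c i) (P i))
    (fun j => tendsto_meanIn (fun N => (ρ N).model) (d j) (Q j))
    (f := fun N => ((LinearMap.mul ℂ (ρ N).model.R).compl₁₂ (ρ N).model.ctr
      (ρ N).model.ctr).compr₂ (ρ N).model.E)
    (tendsto_limCov fun N => (ρ N).model)).congr fun N => ?_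
  rw [wordCov]
  simp only [(ρ N).centeredEval_eq, ← map_wordProd, (ρ N).trace_mapMatrix, (ρ N).covar_ev]
  rfl

theorem tendsto_mean_mul (m : ∀ N, LoopModel Sum.swap g ε N) (a b : StarPoly I) {z y : ℕ → ℂ}
    {z₀ y₀ : ℂ} (hz : Tendsto z atTop (𝓝 z₀)) (hy : Tendsto y atTop (𝓝 y₀)) :
    Tendsto (fun N : ℕ => (N : ℂ)⁻¹ * (m N).E ((m N).tr ((a - z N • 1) * (b - y N • 1)))) atTop
      (𝓝 (limMean m ((a - z₀ • 1) * (b - y₀ • 1)))) := by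
  -- Each factor is treated as a word with one letter, in the bilinear functional `(P, Q) ↦ N⁻¹ E
  -- Tr(P Q)`.
  have h := tendsto_bilin_wordProd_sub_smul (fun _ : Fin 1 => a) (fun _ : Fin 1 => b)
    (fun _ => hz) (fun _ => hy)
    (f := fun N => (LinearMap.mul ℂ (StarPoly I)).compr₂ ((N : ℂ)⁻¹ • (m N).E ∘ₗ (m N).tr))
    (f₀ := (LinearMap.mul ℂ (StarPoly I)).compr₂ (limMean m))
    (fun P Q => tendsto_limMean m (P * Q))
  have e : ∀ x : StarPoly I, wordProd (fun _ : Fin 1 => x) = x := fun x => by simp [wordProd]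
  simp only [e] at h
  exact h

theorem tendsto_mean_centeredEval_mul (i j : I) (P Q : StarPoly Unit) :
    Tendsto (fun N => ∫ ω, normTrace (centeredEval (μ N) (X N i) P ω *
        centeredEval (μ N) (X N j) Q ω) ∂(μ N)) atTop
      (𝓝 ((limSpace fun N => (ρ N).model).φ₁ (limCenter (fun N => (ρ N).model) i P *
        limCenter (fun N => (ρ N).model) j Q))) := by
  simp only [(ρ _).centeredEval_eq, ← map_mul, (ρ _).integral_normTrace_mapMatrix]
  exact tendsto_mean_mul _ _ _ (tendsto_meanIn _ i P) (tendsto_meanIn _ j Q)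

theorem tendsto_mean_centeredEval_mul_transpose (hε : ε ≠ 0) (i j : I) (P Q : StarPoly Unit) :
    Tendsto (fun N => ∫ ω, normTrace (centeredEval (μ N) (X N i) P ω *
        (centeredEval (μ N) (X N j) Q ω).transpose) ∂(μ N)) atTop
      (𝓝 ((limSpace fun N => (ρ N).model).φ₁ (limCenter (fun N => (ρ N).model) i P *
        transposePoly Sum.swap (limCenter (fun N => (ρ N).model) j Q)))) := by
  have h : ∀ N ω, (centeredEval (μ N) (X N j) Q ω).transpose = ((ρ N).ev ω).mapMatrix
      ((ρ N).model.eval (transposePoly Sum.swap (inVar j Q) -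
        (ρ N).model.meanIn j Q • 1)) := by
    intro N ω
    have e : transposePoly Sum.swap (inVar j Q) - (ρ N).model.meanIn j Q • 1 =
        transposePoly Sum.swap (inVar j Q - (ρ N).model.meanIn j Q • 1) := by
      rw [map_sub, map_smul, transposePoly_one]
    rw [e, (ρ N).centeredEval_eq, (ρ N).model.eval_transposePoly hε, AlgHom.mapMatrix_apply,
      AlgHom.mapMatrix_apply, Matrix.transpose_map]
  simp only [h]
  simp only [(ρ _).centeredEval_eq, ← map_mul, (ρ _).integral_normTrace_mapMatrix]
  rw [limCenter, limCenter, map_sub, map_smul, transposePoly_one]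
  exact tendsto_mean_mul _ _ _ (tendsto_meanIn _ i P) (tendsto_meanIn _ j Q)

theorem tendsto_wordCov_zero
    (hfree : SecondOrderFreeBase (limSpace fun N => (ρ N).model)
      (fun i : I => colorAlg (FreeAlgebra.ι ℂ) letterColor i))
    {p q : ℕ} (hp : 2 ≤ p) (hq : 2 ≤ q) (hpq : p ≠ q) (c : Fin p → I) (d : Fin q → I)
    (P : Fin p → StarPoly Unit) (Q : Fin q → StarPoly Unit)
    (hc : CyclicallyAlternating c) (hd : CyclicallyAlternating d) :
    Tendsto (wordCov μ X c d P Q) atTop (𝓝 0) := by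
  rw [← hfree.cov_ne p q (by omega) (by omega) hpq c d _ _ hc hd
    (fun r => limCenter_mem _ (c r) (P r)) (fun r => limCenter_mem _ (d r) (Q r))]
  exact tendsto_wordCov ρ c d P Q

theorem covarianceFormula (ρ : ∀ N, Realization (μ N) g 0 (X N))
    (hg : ∀ a b, letterColor a ≠ letterColor b → g a b = 0) : CovarianceFormula μ X := by
  have hfree := limSpace_secondOrderFree (fun N => (ρ N).model) hg
  refine ⟨fun p q hp hq hpq c d P Q hc hd =>
    tendsto_wordCov_zero ρ hfree.toSecondOrderFreeBase hp hq hpq c d P Q hc hd,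
    fun p hp c d P Q hc hd =>
      ⟨_, fun i j => tendsto_mean_centeredEval_mul ρ (c i) (d j) (P i) (Q j), ?_⟩⟩
  rw [← hfree.cov_eq p hp c d _ _ hc hd (fun r => limCenter_mem _ (c r) (P r))
    (fun r => limCenter_mem _ (d r) (Q r))]
  exact tendsto_wordCov ρ c d P Q

theorem realCovarianceFormula (ρ : ∀ N, Realization (μ N) g 1 (X N))
    (hg : ∀ a b, letterColor a ≠ letterColor b → g a b = 0) : RealCovarianceFormula μ X := by
  have hfree := limSpace_realSecondOrderFree (fun N => (ρ N).model) hg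
  refine ⟨fun p q hp hq hpq c d P Q hc hd =>
    tendsto_wordCov_zero ρ hfree.toSecondOrderFreeBase hp hq hpq c d P Q hc hd,
    fun p hp c d P Q hc hd =>
      ⟨_, _, fun i j => tendsto_mean_centeredEval_mul ρ (c i) (d j) (P i) (Q j),
        fun i j => tendsto_mean_centeredEval_mul_transpose ρ one_ne_zero (c i) (d j) (P i) (Q j),
        ?_⟩⟩
  rw [← hfree.cov_eq p hp c d _ _ hc hd (fun r => limCenter_mem _ (c r) (P r))
    (fun r => limCenter_mem _ (d r) (Q r))]
  exact tendsto_wordCov ρ c d P Q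

end Limit

end Elliptic
end

noncomputable section
namespace Elliptic

/-! ### Loop models from Gaussian processes -/

section GaussModel

variable {Ω J : Type*} [MeasurableSpace Ω] {P : Measure Ω} {ξ : J → Ω → ℝ}

/-- The derivation that corresponds to the linear form `y` under Gaussian integration by parts. -/
def gaussDer (hξ : IsGaussianProcess ξ P) (y : MvPolynomial J ℂ) :
    Derivation ℂ (MvPolynomial J ℂ) (MvPolynomial J ℂ) :=
  MvPolynomial.mkDerivation ℂ fun f => MvPolynomial.C (gaussExp hξ (y * MvPolynomial.X f))

theorem gaussDer_add (hξ : IsGaussianProcess ξ P) (y z : MvPolynomial J ℂ) :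
    gaussDer hξ (y + z) = gaussDer hξ y + gaussDer hξ z := by
  refine MvPolynomial.derivation_ext fun f => ?_
  simp [gaussDer, MvPolynomial.mkDerivation_X, add_mul]

theorem gaussDer_smul (hξ : IsGaussianProcess ξ P) (c : ℂ) (y : MvPolynomial J ℂ) :
    gaussDer hξ (c • y) = c • gaussDer hξ y := by
  refine MvPolynomial.derivation_ext fun f => ?_
  rw [gaussDer, MvPolynomial.mkDerivation_X, smul_mul_assoc, map_smul, smul_eq_mul,
    MvPolynomial.C_mul, ← MvPolynomial.smul_eq_C_mul, Derivation.smul_apply, gaussDer,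
    MvPolynomial.mkDerivation_X]

/-- Both sides are linear in `y`. The extension from variables to complex linear forms is needed
because a complex entry combines its real and imaginary parts. -/
theorem gaussExp_mul (hξ : IsGaussianProcess ξ P) (hc : ∀ j, ∫ ω, ξ j ω ∂P = 0)
    {y : MvPolynomial J ℂ} (hy : y ∈ Submodule.span ℂ (Set.range MvPolynomial.X))
    (F : MvPolynomial J ℂ) : gaussExp hξ (y * F) = gaussExp hξ (gaussDer hξ y F) := by
  induction hy using Submodule.span_induction with
  | mem y hy =>
    obtain ⟨j, rfl⟩ := hy
    exact gaussExp_X_mul hξ hc j F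
  | zero =>
    have : gaussDer hξ 0 = 0 := by simpa using gaussDer_smul hξ 0 0
    simp [this]
  | add y z _ _ hy hz => rw [gaussDer_add, add_mul, map_add, hy, hz]; simp
  | smul c y _ hy => rw [gaussDer_smul, smul_mul_assoc, map_smul, hy]; simp

theorem gaussDer_apply (hξ : IsGaussianProcess ξ P) (y : MvPolynomial J ℂ)
    {z : MvPolynomial J ℂ} (hz : z ∈ Submodule.span ℂ (Set.range MvPolynomial.X)) :
    gaussDer hξ y z = MvPolynomial.C (gaussExp hξ (y * z)) := by
  induction hz using Submodule.span_induction with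
  | mem z hz =>
    obtain ⟨j, rfl⟩ := hz
    rw [gaussDer, MvPolynomial.mkDerivation_X]
  | zero => simp
  | add z w _ _ hz hw => rw [map_add, hz, hw, mul_add, map_add, map_add]
  | smul c z _ hz =>
    rw [Derivation.map_smul, hz, mul_smul_comm, map_smul, smul_eq_mul,
      MvPolynomial.C_mul, MvPolynomial.smul_eq_C_mul]

end GaussModel

/-- A realization by linear forms in a centered Gaussian process. -/
def gaussRealization.{u, v} {I J : Type u} {Ω : Type v} [MeasurableSpace Ω] {μ : Measure Ω}
    {g : I ⊕ I → I ⊕ I → ℂ} {ε : ℂ} {N : ℕ} {X : I → Ω → Matrix (Fin N) (Fin N) ℂ}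
    {ξ : J → Ω → ℝ} (hξ : IsGaussianProcess ξ μ) (hc : ∀ j, ∫ ω, ξ j ω ∂μ = 0)
    (Y : I ⊕ I → Matrix (Fin N) (Fin N) (MvPolynomial J ℂ))
    (hY : ∀ a i j, Y a i j ∈ Submodule.span ℂ (Set.range MvPolynomial.X))
    (hcov : ∀ a i j b k l, ∫ ω, polyEval ξ ω (Y a i j) * polyEval ξ ω (Y b k l) ∂μ =
      (N : ℂ)⁻¹ * ((if k = j ∧ l = i then g a b else 0) +
        if k = i ∧ l = j then ε * g a b.swap else 0))
    (htr : ε ≠ 0 → ∀ a, Y a.swap = (Y a).transpose)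
    (hinl : ∀ ω i k l, polyEval ξ ω (Y (Sum.inl i) k l) = X i ω k l)
    (hinr : ∀ ω i k l, polyEval ξ ω (Y (Sum.inr i) k l) = conj (X i ω l k)) :
    Realization μ g ε X where
  model :=
    { R := MvPolynomial J ℂ
      E := gaussExp hξ
      E_one := gaussExp_one hξ
      Y := Y
      D := fun a i j => gaussDer hξ (Y a i j)
      D_Y := fun a i j b k l => by
        rw [gaussDer_apply hξ _ (hY b k l), ← hcov a i j b k l, gaussExp_apply]
        simp only [map_mul]
        rfl
      ibp := fun a i j F => gaussExp_mul hξ hc (hY a i j) F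
      transpose := htr }
  ev := polyEval ξ
  allMoments := polyEval_allMoments hξ
  E_eq := gaussExp_apply hξ
  ev_inl ω i := by ext k l; exact hinl ω i k l
  ev_inr ω i := by ext k l; exact hinr ω i k l

/-! ### Gaussian processes from elliptic matrices -/

section Entries

variable {Ω V : Type*} [MeasurableSpace Ω] {μ : Measure Ω} {N : ℕ}

/-- The unordered pair of indices, written in increasing order. -/
def sortedPair (i j : Fin N) : {e : Fin N × Fin N // e.1 ≤ e.2} :=
  if h : i ≤ j then ⟨(i, j), h⟩ else ⟨(j, i), (not_le.1 h).le⟩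

theorem eq_or_eq_of_sortedPair_eq {i j k l : Fin N} (h : sortedPair i j = sortedPair k l) :
    (k = i ∧ l = j) ∨ (k = j ∧ l = i) := by
  unfold sortedPair at h
  split_ifs at h <;> simp only [Subtype.mk.injEq, Prod.mk.injEq] at h <;> grind

/-- The coordinate that recovers the entry at `(i, j)` from the pair at `sortedPair i j`. -/
def pairCoord (V : Type*) (i j : Fin N) (x : V × V) : V := if i ≤ j then x.1 else x.2

theorem pairCoord_sortedPair (X : Matrix (Fin N) (Fin N) V) (i j : Fin N) :
    pairCoord V i j (X (sortedPair i j).1.1 (sortedPair i j).1.2,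
      X (sortedPair i j).1.2 (sortedPair i j).1.1) = X i j := by
  unfold pairCoord sortedPair
  split_ifs <;> rfl

theorem measurable_pairCoord [MeasurableSpace V] (i j : Fin N) : Measurable (pairCoord V i j) := by
  unfold pairCoord
  split_ifs
  · exact measurable_fst
  · exact measurable_snd

/-- Each entry is a coordinate of the pair at its unordered position, and pairs at different
positions are independent. -/
theorem indepFun_entries [MeasurableSpace V] {X : Ω → Matrix (Fin N) (Fin N) V}
    (hX : iIndepFun (fun (e : {e : Fin N × Fin N // e.1 ≤ e.2}) (ω : Ω) =>
      (X ω e.1.1 e.1.2, X ω e.1.2 e.1.1)) μ) {i j k l : Fin N}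
    (h : ¬ ((k = i ∧ l = j) ∨ (k = j ∧ l = i))) :
    IndepFun (fun ω => X ω i j) (fun ω => X ω k l) μ := by
  have := (hX.indepFun fun h' => h (eq_or_eq_of_sortedPair_eq h')).comp
    (measurable_pairCoord (V := V) i j) (measurable_pairCoord (V := V) k l)
  simpa only [Function.comp_def, pairCoord_sortedPair] using this

variable [NormedAddCommGroup V] [NormedSpace ℝ V] [MeasurableSpace V] [BorelSpace V]
  [SecondCountableTopology V] [CompleteSpace V]

/-- Independent Gaussian pairs are jointly Gaussian, and the matrix is a continuous linear image of
the family of pairs. -/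
theorem hasGaussianLaw_entries {X : Ω → Matrix (Fin N) (Fin N) V}
    (hX : iIndepFun (fun (e : {e : Fin N × Fin N // e.1 ≤ e.2}) (ω : Ω) =>
      (X ω e.1.1 e.1.2, X ω e.1.2 e.1.1)) μ)
    (hpair : ∀ i j, i < j → HasGaussianLaw (fun ω => (X ω i j, X ω j i)) μ)
    (hdiag : ∀ i, HasGaussianLaw (fun ω => X ω i i) μ) :
    HasGaussianLaw (fun ω (e : Fin N × Fin N) => X ω e.1 e.2) μ := by
  have h1 : ∀ e : {e : Fin N × Fin N // e.1 ≤ e.2},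
      HasGaussianLaw (fun ω => (X ω e.1.1 e.1.2, X ω e.1.2 e.1.1)) μ := by
    rintro ⟨⟨i, j⟩, hij⟩
    rcases lt_or_eq_of_le hij with h | h
    · exact hpair i j h
    · dsimp only at h
      subst h
      -- On the diagonal the pair is the image of one Gaussian variable under the diagonal
      -- embedding.
      exact (hdiag i).map_fun
        ((ContinuousLinearMap.id ℝ V).prod (ContinuousLinearMap.id ℝ V))
  have h2 := (iIndepFun.hasGaussianLaw h1 hX).map_fun
    (ContinuousLinearMap.pi fun e : Fin N × Fin N =>
      (if e.1 ≤ e.2 then ContinuousLinearMap.fst ℝ V V else ContinuousLinearMap.snd ℝ V V).comp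
        (ContinuousLinearMap.proj (sortedPair e.1 e.2)))
  refine h2.congr (Eventually.of_forall fun ω => funext fun e => ?_)
  dsimp only
  rw [← pairCoord_sortedPair (X ω) e.1 e.2, pairCoord]
  rw [ContinuousLinearMap.pi_apply, ContinuousLinearMap.comp_apply]
  split_ifs <;> rfl

theorem isGaussianProcess_entries {I B : Type*} {X : I → Ω → Matrix (Fin N) (Fin N) V}
    (hX : IndepMatrices μ X)
    (hgauss : ∀ i, HasGaussianLaw (fun ω (e : Fin N × Fin N) => X i ω e.1 e.2) μ)
    (ℓ : B → V →L[ℝ] ℝ) :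
    IsGaussianProcess
      (fun (t : I × (Fin N × Fin N) × B) ω => ℓ t.2.2 (X t.1 ω t.2.1.1 t.2.1.2)) μ where
  hasGaussianLaw S := by
    classical
    -- A finite set of coordinates involves only finitely many matrices, so the joint law of a
    -- finite independent family suffices even if `I` is infinite.
    have h1 : iIndepFun (fun (i : S.image Prod.fst) ω (e : Fin N × Fin N) => X i ω e.1 e.2) μ :=
      iIndepFun.precomp Subtype.val_injective hX
    have h2 := (iIndepFun.hasGaussianLaw (fun i => hgauss i.1) h1).map_fun
      (ContinuousLinearMap.pi fun t : S => (ℓ t.1.2.2).comp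
        ((ContinuousLinearMap.proj (R := ℝ) (φ := fun _ : Fin N × Fin N => V) t.1.2.1).comp
          (ContinuousLinearMap.proj (R := ℝ)
            (φ := fun _ : S.image Prod.fst => Fin N × Fin N → V)
            ⟨t.1.1, Finset.mem_image_of_mem _ t.2⟩)))
    exact h2

end Entries

/-! ### Covariances of elliptic matrices -/

open Classical in
/-- The covariances of the letters of elliptic matrices. -/
def ellipticCov {I : Type*} (γ : I → ℝ) : I ⊕ I → I ⊕ I → ℂ
  | Sum.inl i, Sum.inl j => if i = j then (γ i : ℂ) else 0
  | Sum.inr i, Sum.inr j => if i = j then (γ i : ℂ) else 0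
  | Sum.inl i, Sum.inr j => if i = j then 1 else 0
  | Sum.inr i, Sum.inl j => if i = j then 1 else 0

theorem ellipticCov_eq_zero {I : Type*} (γ : I → ℝ) (a b : I ⊕ I)
    (h : letterColor a ≠ letterColor b) : ellipticCov γ a b = 0 := by
  rcases a with i | i <;> rcases b with j | j <;> exact if_neg h

theorem ellipticCov_comm {I : Type*} (γ : I → ℝ) (a b : I ⊕ I) :
    ellipticCov γ a b = ellipticCov γ b a := by
  rcases a with i | i <;> rcases b with j | j <;> simp only [ellipticCov] <;>
    rcases eq_or_ne i j with rfl | h <;> simp [*, Ne.symm]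

/-- For `N = 0` both sides are `0`, so that this size needs no separate treatment. -/
theorem inv_sqrt_mul_inv_sqrt (N : ℕ) : (√(N : ℝ))⁻¹ * (√(N : ℝ))⁻¹ = (N : ℝ)⁻¹ := by
  rw [← mul_inv, Real.mul_self_sqrt (Nat.cast_nonneg N)]

theorem integral_entries_eq_zero {Ω V I B : Type*} [MeasurableSpace Ω] {μ : Measure Ω} {N : ℕ}
    [NormedAddCommGroup V] [NormedSpace ℝ V] [MeasurableSpace V] [BorelSpace V]
    [SecondCountableTopology V] [CompleteSpace V] {X : I → Ω → Matrix (Fin N) (Fin N) V}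
    (hgauss : ∀ i, HasGaussianLaw (fun ω (e : Fin N × Fin N) => X i ω e.1 e.2) μ)
    (hc : ∀ i k l, ∫ ω, X i ω k l ∂μ = 0) (ℓ : B → V →L[ℝ] ℝ) (t : I × (Fin N × Fin N) × B) :
    ∫ ω, ℓ t.2.2 (X t.1 ω t.2.1.1 t.2.1.2) ∂μ = 0 := by
  rw [ContinuousLinearMap.integral_comp_comm, hc, map_zero]
  exact ((hgauss t.1).eval t.2.1).integrable

section Independence

variable {Ω I 𝕜 : Type*} [MeasurableSpace Ω] {μ : Measure Ω} {N : ℕ}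

theorem integral_mul_eq_zero [RCLike 𝕜] {x y : Ω → 𝕜} (h : IndepFun x y μ) (hx : AEMeasurable x μ)
    (hy : AEMeasurable y μ) (hx0 : ∫ ω, x ω ∂μ = 0) : ∫ ω, x ω * y ω ∂μ = 0 := by
  rw [h.integral_fun_mul_eq_mul_integral hx.aestronglyMeasurable hy.aestronglyMeasurable, hx0,
    zero_mul]

theorem integral_mul_conj_eq_zero {x y : Ω → ℂ} (h : IndepFun x y μ) (hx : AEMeasurable x μ)
    (hy : AEMeasurable y μ) (hx0 : ∫ ω, x ω ∂μ = 0) : ∫ ω, x ω * conj (y ω) ∂μ = 0 :=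
  integral_mul_eq_zero (y := fun ω => conj (y ω))
    (h.comp measurable_id Complex.continuous_conj.measurable) hx
    (Complex.continuous_conj.measurable.comp_aemeasurable hy) hx0

theorem IndepMatrices.indepFun [MeasurableSpace 𝕜] {X : I → Ω → Matrix (Fin N) (Fin N) 𝕜} (hX : IndepMatrices μ X)
    {p q : I} (hpq : p ≠ q) (i j k l : Fin N) :
    IndepFun (fun ω => X p ω i j) (fun ω => X q ω k l) μ :=
  (iIndepFun.indepFun hX hpq).comp (measurable_pi_apply (i, j)) (measurable_pi_apply (k, l))

end Independence

/-! ### Covariances of complex elliptic matrices -/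

section Complex

variable {Ω I : Type*} [MeasurableSpace Ω] {μ : Measure Ω} {N : ℕ}

theorem IsComplexElliptic.hasGaussianLaw {γ : ℝ} {X : Ω → Matrix (Fin N) (Fin N) ℂ}
    (hX : IsComplexElliptic μ γ X) :
    HasGaussianLaw (fun ω (e : Fin N × Fin N) => X ω e.1 e.2) μ :=
  hasGaussianLaw_entries hX.indep hX.gaussian_pair hX.gaussian_diag

theorem IsComplexElliptic.aemeasurable {γ : ℝ} {X : Ω → Matrix (Fin N) (Fin N) ℂ}
    (hX : IsComplexElliptic μ γ X) (i j : Fin N) : AEMeasurable (fun ω => X ω i j) μ :=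
  hX.hasGaussianLaw.aemeasurable.eval (i, j)

theorem IsComplexElliptic.integral_mul {γ : ℝ} {X : Ω → Matrix (Fin N) (Fin N) ℂ}
    (hX : IsComplexElliptic μ γ X) (i j k l : Fin N) :
    ∫ ω, X ω i j * X ω k l ∂μ = if k = j ∧ l = i then (γ : ℂ) else 0 := by
  by_cases h : (k = i ∧ l = j) ∨ (k = j ∧ l = i)
  · rcases eq_or_ne i j with rfl | hij
    · obtain ⟨rfl, rfl⟩ : k = i ∧ l = i := by tauto
      simpa [sq] using hX.sq_diag l
    · rcases h with ⟨rfl, rfl⟩ | ⟨rfl, rfl⟩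
      · rw [if_neg (fun h => hij h.1)]
        simpa [sq] using hX.sq_offdiag k l hij
      · rw [if_pos ⟨rfl, rfl⟩]
        rcases lt_or_gt_of_ne hij with h | h
        · exact hX.mul_offdiag _ _ h
        · simpa only [mul_comm] using hX.mul_offdiag _ _ h
  · rw [if_neg (fun h' => h (Or.inr h'))]
    exact integral_mul_eq_zero (indepFun_entries hX.indep h) (hX.aemeasurable i j)
      (hX.aemeasurable k l) (hX.centered i j)

theorem IsComplexElliptic.integral_mul_conj {γ : ℝ} {X : Ω → Matrix (Fin N) (Fin N) ℂ}
    (hX : IsComplexElliptic μ γ X) (i j k l : Fin N) :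
    ∫ ω, X ω i j * conj (X ω k l) ∂μ = if k = i ∧ l = j then 1 else 0 := by
  by_cases h' : k = i ∧ l = j
  · obtain ⟨rfl, rfl⟩ := h'
    rw [if_pos ⟨rfl, rfl⟩]
    simp only [Complex.mul_conj']
    have := congrArg (fun x : ℝ => (x : ℂ)) (hX.norm_sq k l)
    simp only [← integral_complex_ofReal] at this
    simpa using this
  · rw [if_neg h']
    by_cases h : k = j ∧ l = i
    · obtain ⟨rfl, rfl⟩ := h
      have hlk : l ≠ k := fun h => h' ⟨h.symm, h⟩
      rcases lt_or_gt_of_ne hlk with h | h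
      · exact hX.mul_conj_offdiag _ _ h
      -- The hypothesis covers increasing indices only; the other order follows by complex
      -- conjugation.
      · have := congrArg conj (hX.mul_conj_offdiag _ _ h)
        rw [← integral_conj] at this
        simpa [mul_comm] using this
    · exact integral_mul_conj_eq_zero (indepFun_entries hX.indep (not_or.2 ⟨h', h⟩))
        (hX.aemeasurable i j) (hX.aemeasurable k l) (hX.centered i j)

/-- The entries of `X_i` and `X_i^*` as linear forms in the real and imaginary parts of the entries
of `X_i`. -/
def complexForm (I : Type*) (N : ℕ) :
    I ⊕ I → Matrix (Fin N) (Fin N) (MvPolynomial (I × (Fin N × Fin N) × Bool) ℂ)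
  | Sum.inl i => fun k l => MvPolynomial.X (i, (k, l), true) +
      Complex.I • MvPolynomial.X (i, (k, l), false)
  | Sum.inr i => fun k l => MvPolynomial.X (i, (l, k), true) -
      Complex.I • MvPolynomial.X (i, (l, k), false)

theorem complexForm_mem_span (a : I ⊕ I) (k l : Fin N) :
    complexForm I N a k l ∈ Submodule.span ℂ (Set.range MvPolynomial.X) := by
  rcases a with i | i
  · exact add_mem (Submodule.subset_span ⟨_, rfl⟩)
      (Submodule.smul_mem _ _ (Submodule.subset_span ⟨_, rfl⟩))
  · exact sub_mem (Submodule.subset_span ⟨_, rfl⟩)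
      (Submodule.smul_mem _ _ (Submodule.subset_span ⟨_, rfl⟩))

/-- The normalized real and imaginary parts. -/
def reImPart (N : ℕ) (b : Bool) : ℂ →L[ℝ] ℝ :=
  (√(N : ℝ))⁻¹ • (if b then Complex.reCLM else Complex.imCLM)

theorem polyEval_complexForm_inl (X : I → Ω → Matrix (Fin N) (Fin N) ℂ) (ω : Ω) (i : I)
    (k l : Fin N) :
    polyEval (fun (t : I × (Fin N × Fin N) × Bool) ω => reImPart N t.2.2 (X t.1 ω t.2.1.1 t.2.1.2))
      ω (complexForm I N (Sum.inl i) k l) = ((√(N : ℝ))⁻¹ • X i ω) k l := by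
  simp only [complexForm, map_add, map_smul, polyEval_X]
  apply Complex.ext <;> simp [reImPart]

theorem polyEval_complexForm_inr (X : I → Ω → Matrix (Fin N) (Fin N) ℂ) (ω : Ω) (i : I)
    (k l : Fin N) :
    polyEval (fun (t : I × (Fin N × Fin N) × Bool) ω => reImPart N t.2.2 (X t.1 ω t.2.1.1 t.2.1.2))
      ω (complexForm I N (Sum.inr i) k l) = conj (((√(N : ℝ))⁻¹ • X i ω) l k) := by
  simp only [complexForm, map_sub, map_smul, polyEval_X]
  apply Complex.ext <;> simp [reImPart]

variable {γ : I → ℝ} {X : I → Ω → Matrix (Fin N) (Fin N) ℂ}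
  (hX : ∀ i, IsComplexElliptic μ (γ i) (X i)) (hI : IndepMatrices μ X)
include hX hI

theorem complex_integral_mul (p q : I) (i j k l : Fin N) :
    ∫ ω, X p ω i j * X q ω k l ∂μ =
      if k = j ∧ l = i then ellipticCov γ (Sum.inl p) (Sum.inl q) else 0 := by
  rcases eq_or_ne p q with rfl | hpq
  · simp [(hX p).integral_mul, ellipticCov]
  · rw [integral_mul_eq_zero (hI.indepFun hpq i j k l) ((hX p).aemeasurable i j)
      ((hX q).aemeasurable k l) ((hX p).centered i j)]
    simp [ellipticCov, hpq]

theorem complex_integral_mul_conj (p q : I) (i j k l : Fin N) :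
    ∫ ω, X p ω i j * conj (X q ω k l) ∂μ =
      if k = i ∧ l = j then ellipticCov γ (Sum.inl p) (Sum.inr q) else 0 := by
  rcases eq_or_ne p q with rfl | hpq
  · simp [(hX p).integral_mul_conj, ellipticCov]
  · rw [integral_mul_conj_eq_zero (hI.indepFun hpq i j k l) ((hX p).aemeasurable i j)
      ((hX q).aemeasurable k l) ((hX p).centered i j)]
    simp [ellipticCov, hpq]

end Complex

/-- Normalized independent complex elliptic matrices realize a loop model. -/
def complexRealization.{u, v} {I : Type u} {Ω : Type v} [MeasurableSpace Ω] {μ : Measure Ω}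
    {N : ℕ} {γ : I → ℝ} {X : I → Ω → Matrix (Fin N) (Fin N) ℂ}
    (hX : ∀ i, IsComplexElliptic μ (γ i) (X i)) (hI : IndepMatrices μ X) :
    Realization μ (ellipticCov γ) 0 (fun i ω => (√(N : ℝ))⁻¹ • X i ω) :=
  gaussRealization
    (isGaussianProcess_entries hI (fun i => (hX i).hasGaussianLaw) (reImPart N))
    (integral_entries_eq_zero (fun i => (hX i).hasGaussianLaw) (fun i => (hX i).centered)
      (reImPart N))
    (complexForm I N) complexForm_mem_span
    (fun a i j b k l => by
      have hs : (((√(N : ℝ))⁻¹ : ℝ) : ℂ) * (((√(N : ℝ))⁻¹ : ℝ) : ℂ) = (N : ℂ)⁻¹ := by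
        rw [← Complex.ofReal_mul, inv_sqrt_mul_inv_sqrt]; simp
      have e : ∀ x y : ℂ, ((√(N : ℝ))⁻¹ • x) * ((√(N : ℝ))⁻¹ • y) = (N : ℂ)⁻¹ * (x * y) := by
        intro x y
        rw [Complex.real_smul, Complex.real_smul, mul_mul_mul_comm, hs]
      have ec : ∀ x : ℂ, conj ((√(N : ℝ))⁻¹ • x) = (√(N : ℝ))⁻¹ • conj x := by
        intro x
        simp
      have h1 := fun p q => complex_integral_mul hX hI p q
      have h2 := fun p q => complex_integral_mul_conj hX hI p q
      -- With `ε = 0` only one contraction remains. The four combinations of letters and adjoint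
      -- letters reduce to the two covariances above by conjugation and commutation.
      rw [zero_mul, ite_self, add_zero]
      rcases a with p | p <;> rcases b with q | q <;>
        simp only [polyEval_complexForm_inl, polyEval_complexForm_inr, Matrix.smul_apply, ec, e,
          integral_const_mul]
      · rw [h1]
      · rw [h2]
        congr 1
        exact if_congr and_comm rfl rfl
      · simp only [mul_comm (conj _)]
        rw [h2]
        congr 1
        refine if_congr ⟨fun h => ⟨h.1.symm, h.2.symm⟩, fun h => ⟨h.1.symm, h.2.symm⟩⟩ ?_ rfl
        exact ellipticCov_comm γ _ _
      -- For two adjoints the covariance is the conjugate of that of the matrices, and the same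
      -- value `γ` results because it is real.
      · simp only [← map_mul]
        rw [integral_conj, h1]
        congr 1
        rw [apply_ite conj, map_zero]
        refine if_congr and_comm ?_ rfl
        simp only [ellipticCov]
        split_ifs <;> simp)
    (fun h => absurd rfl h)
    (polyEval_complexForm_inl X) (polyEval_complexForm_inr X)

/-! ### Covariances of real elliptic matrices -/

section Real

variable {Ω I : Type*} [MeasurableSpace Ω] {μ : Measure Ω} {N : ℕ}

theorem IsRealElliptic.hasGaussianLaw {γ : ℝ} {X : Ω → Matrix (Fin N) (Fin N) ℝ}
    (hX : IsRealElliptic μ γ X) :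
    HasGaussianLaw (fun ω (e : Fin N × Fin N) => X ω e.1 e.2) μ :=
  hasGaussianLaw_entries hX.indep hX.gaussian_pair hX.gaussian_diag

theorem IsRealElliptic.aemeasurable {γ : ℝ} {X : Ω → Matrix (Fin N) (Fin N) ℝ}
    (hX : IsRealElliptic μ γ X) (i j : Fin N) : AEMeasurable (fun ω => X ω i j) μ :=
  hX.hasGaussianLaw.aemeasurable.eval (i, j)

/-- On the diagonal the two contractions coincide, which accounts for the variance `1 + γ`. -/
theorem IsRealElliptic.integral_mul {γ : ℝ} {X : Ω → Matrix (Fin N) (Fin N) ℝ}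
    (hX : IsRealElliptic μ γ X) (i j k l : Fin N) :
    ∫ ω, X ω i j * X ω k l ∂μ =
      (if k = j ∧ l = i then γ else 0) + if k = i ∧ l = j then 1 else 0 := by
  by_cases h : (k = i ∧ l = j) ∨ (k = j ∧ l = i)
  · rcases eq_or_ne i j with rfl | hij
    · obtain ⟨rfl, rfl⟩ : k = i ∧ l = i := by tauto
      simpa [sq, add_comm] using hX.sq_diag l
    · rcases h with ⟨rfl, rfl⟩ | ⟨rfl, rfl⟩
      · rw [if_neg (fun h => hij h.1)]
        simpa [sq] using hX.sq_offdiag k l hij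
      · rw [if_pos ⟨rfl, rfl⟩, if_neg (fun h => hij h.2), add_zero]
        rcases lt_or_gt_of_ne hij with h | h
        · exact hX.mul_offdiag _ _ h
        · simpa only [mul_comm] using hX.mul_offdiag _ _ h
  · rw [if_neg (fun h' => h (Or.inr h')), if_neg (fun h' => h (Or.inl h')), add_zero]
    exact integral_mul_eq_zero (indepFun_entries hX.indep h) (hX.aemeasurable i j)
      (hX.aemeasurable k l) (hX.centered i j)

theorem real_integral_mul {γ : I → ℝ} {X : I → Ω → Matrix (Fin N) (Fin N) ℝ}
    (hX : ∀ i, IsRealElliptic μ (γ i) (X i)) (hI : IndepMatrices μ X) (p q : I)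
    (i j k l : Fin N) :
    ∫ ω, (X p ω i j : ℂ) * (X q ω k l : ℂ) ∂μ =
      (if k = j ∧ l = i then ellipticCov γ (Sum.inl p) (Sum.inl q) else 0) +
        if k = i ∧ l = j then ellipticCov γ (Sum.inl p) (Sum.inr q) else 0 := by
  simp only [← Complex.ofReal_mul]
  rw [integral_complex_ofReal]
  rcases eq_or_ne p q with rfl | hpq
  · rw [(hX p).integral_mul]
    simp [ellipticCov, apply_ite Complex.ofReal]
  · rw [integral_mul_eq_zero (hI.indepFun hpq i j k l) ((hX p).aemeasurable i j)
      ((hX q).aemeasurable k l) ((hX p).centered i j)]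
    simp [ellipticCov, hpq]

/-- The entries of `X_i` and its transpose as linear forms in the entries of `X_i`. -/
def realForm (I : Type*) (N : ℕ) :
    I ⊕ I → Matrix (Fin N) (Fin N) (MvPolynomial (I × (Fin N × Fin N) × Unit) ℂ)
  | Sum.inl i => fun k l => MvPolynomial.X (i, (k, l), ())
  | Sum.inr i => fun k l => MvPolynomial.X (i, (l, k), ())

theorem realForm_swap (a : I ⊕ I) : realForm I N a.swap = (realForm I N a).transpose := by
  rcases a with i | i <;> rfl

theorem realForm_mem_span (a : I ⊕ I) (k l : Fin N) :
    realForm I N a k l ∈ Submodule.span ℂ (Set.range MvPolynomial.X) := by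
  rcases a with i | i <;> exact Submodule.subset_span ⟨_, rfl⟩

/-- Multiplication by the normalization. -/
def scalePart (N : ℕ) (_ : Unit) : ℝ →L[ℝ] ℝ := (√(N : ℝ))⁻¹ • ContinuousLinearMap.id ℝ ℝ

theorem polyEval_realForm_inl (X : I → Ω → Matrix (Fin N) (Fin N) ℝ) (ω : Ω) (i : I)
    (k l : Fin N) :
    polyEval (fun (t : I × (Fin N × Fin N) × Unit) ω =>
      scalePart N t.2.2 (X t.1 ω t.2.1.1 t.2.1.2)) ω (realForm I N (Sum.inl i) k l) =
        complexify ((√(N : ℝ))⁻¹ • X i ω) k l := by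
  simp only [realForm, polyEval_X]
  simp [scalePart, complexify]

theorem polyEval_realForm_inr (X : I → Ω → Matrix (Fin N) (Fin N) ℝ) (ω : Ω) (i : I)
    (k l : Fin N) :
    polyEval (fun (t : I × (Fin N × Fin N) × Unit) ω =>
      scalePart N t.2.2 (X t.1 ω t.2.1.1 t.2.1.2)) ω (realForm I N (Sum.inr i) k l) =
        conj (complexify ((√(N : ℝ))⁻¹ • X i ω) l k) := by
  simp only [realForm, polyEval_X]
  simp [scalePart, complexify]

end Real

/-- Normalized independent real elliptic matrices realize a loop model. -/
def realRealization.{u, v} {I : Type u} {Ω : Type v} [MeasurableSpace Ω] {μ : Measure Ω}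
    {N : ℕ} {γ : I → ℝ} {X : I → Ω → Matrix (Fin N) (Fin N) ℝ}
    (hX : ∀ i, IsRealElliptic μ (γ i) (X i)) (hI : IndepMatrices μ X) :
    Realization μ (ellipticCov γ) 1 (fun i ω => complexify ((√(N : ℝ))⁻¹ • X i ω)) :=
  gaussRealization
    (isGaussianProcess_entries hI (fun i => (hX i).hasGaussianLaw) (scalePart N))
    (integral_entries_eq_zero (fun i => (hX i).hasGaussianLaw) (fun i => (hX i).centered)
      (scalePart N))
    (realForm I N) realForm_mem_span
    (fun a i j b k l => by
      have hs : (((√(N : ℝ))⁻¹ : ℝ) : ℂ) * (((√(N : ℝ))⁻¹ : ℝ) : ℂ) = (N : ℂ)⁻¹ := by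
        rw [← Complex.ofReal_mul, inv_sqrt_mul_inv_sqrt]; simp
      have e : ∀ (p : I) (ω : Ω) (k l : Fin N), complexify ((√(N : ℝ))⁻¹ • X p ω) k l =
          (((√(N : ℝ))⁻¹ : ℝ) : ℂ) * (X p ω k l : ℂ) := by
        intro p ω k l
        simp [complexify]
      have e' : ∀ x y : ℂ, (((√(N : ℝ))⁻¹ : ℝ) : ℂ) * x * ((((√(N : ℝ))⁻¹ : ℝ) : ℂ) * y) =
          (N : ℂ)⁻¹ * (x * y) := fun x y => by rw [mul_mul_mul_comm, hs]
      have h := fun p q => real_integral_mul hX hI p q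
      rw [one_mul]
      -- An adjoint letter is a transpose here, so it swaps the two indices. This exchanges the two
      -- contractions and, with them, the weights `g a b` and `g a (τ b)`.
      rcases a with p | p <;> rcases b with q | q <;>
        simp only [polyEval_realForm_inl, polyEval_realForm_inr, e, map_mul, Complex.conj_ofReal,
          e', integral_const_mul, h, Sum.swap_inl, Sum.swap_inr]
      · rw [add_comm]
        simp only [and_comm]
      · rw [add_comm]
        rfl
      · simp only [and_comm (a := l = j), and_comm (a := l = i)]
        rfl)
    (fun _ => realForm_swap)
    (polyEval_realForm_inl X) (polyEval_realForm_inr X)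

end Elliptic
end

/-! ### Conclusion for elliptic matrices -/

theorem theorem1p6 {I : Type*} (γ : I → ℝ) (hγ : ∀ i, γ i ∈ Set.Icc (-1 : ℝ) 1)
    {Ω : ℕ → Type*} [∀ N, MeasurableSpace (Ω N)] (μ : ∀ N, Measure (Ω N))
    [∀ N, IsProbabilityMeasure (μ N)] :
    (∀ X : ∀ N, I → Ω N → Matrix (Fin N) (Fin N) ℂ,
      (∀ N i, Elliptic.IsComplexElliptic (μ N) (γ i) (X N i)) →
      (∀ N, Elliptic.IndepMatrices (μ N) (X N)) →
      Elliptic.AsymptoticallySecondOrderFree μ (fun N i ω => (Real.sqrt N)⁻¹ • X N i ω) ∧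
      Elliptic.CovarianceFormula μ (fun N i ω => (Real.sqrt N)⁻¹ • X N i ω)) ∧
    (∀ X : ∀ N, I → Ω N → Matrix (Fin N) (Fin N) ℝ,
      (∀ N i, Elliptic.IsRealElliptic (μ N) (γ i) (X N i)) →
      (∀ N, Elliptic.IndepMatrices (μ N) (X N)) →
      Elliptic.AsymptoticallyRealSecondOrderFree μ
        (fun N i ω => (Real.sqrt N)⁻¹ • X N i ω) ∧
      Elliptic.RealCovarianceFormula μ
        (fun N i ω => Elliptic.complexify ((Real.sqrt N)⁻¹ • X N i ω))) := by
  refine ⟨fun X hX hI => ?_, fun X hX hI => ?_⟩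
  · have ρ := fun N => Elliptic.complexRealization (hX N) (hI N)
    exact ⟨Elliptic.asymptoticallySecondOrderFree ρ (Elliptic.ellipticCov_eq_zero γ),
      Elliptic.covarianceFormula ρ (Elliptic.ellipticCov_eq_zero γ)⟩
  · have ρ := fun N => Elliptic.realRealization (hX N) (hI N)
    exact ⟨Elliptic.asymptoticallyRealSecondOrderFree ρ (Elliptic.ellipticCov_eq_zero γ),
      Elliptic.realCovarianceFormula ρ (Elliptic.ellipticCov_eq_zero γ)⟩
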